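/- Let $G=(V,E,w)$ be a complete undirected graph with $|V|=n\ge 3$ vertices and an arbitrary edge-weight function $w:E\to\mathbb{R}_{\ge 0}$ (put $w(v,v)=0$). A TSP tour is a cyclic sequence visiting every vertex exactly once; its weight is the sum of the weights of its $n$ edges, and $\mathrm{OPT}(G)$ is the minimum weight of a TSP tour. Let $q=q(G)$ be the minimum size of a set $S\subseteq V$ such that $G[V\setminus S]$ is metric, i.e. $w(a,b)\le w(a,c)+w(c,b)$ for all $a,b,c\in V\setminus S$. **Theorem.** For TSP parameterized by $q$ there is an FPT $3$-approximation algorithm running in time $2^{\mathcal{O}(q\log q)}\cdot n^{\mathcal{O}(1)}$. That is, there are one deterministic algorithm and absolute constants $c_1,c_2,c_3\in\mathbb{N}$ such that, given $G$ (the number $n$ and the weight matrix; $q$ is not part of the input), the algorithm halts after at most $c_1\cdot 2^{c_2\,q\log_2 q}\cdot n^{c_3}$ steps (with $0\log_2 0=0$) and outputs a TSP tour of weight at most $3\cdot\mathrm{OPT}(G)$. Steps are counted on a random access machine with natural-number and real registers, on which additions, subtractions, comparisons, indexed memory accesses, assignments and branchings each cost one step. -/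

import Mathlib

namespace ParamTSP

/-! ### The travelling salesman problem on edge-weighted complete graphs -/

/-- A complete graph on the vertices `0, …, n - 1` with non-negative real edge weights:
`w a b` is the weight of the (undirected) edge `ab`.  As usual `w a a = 0`. -/
structure Instance where
  n : ℕ
  w : Fin n → Fin n → ℝ
  w_nonneg : ∀ a b, 0 ≤ w a b
  w_symm : ∀ a b, w a b = w b a
  w_self : ∀ a, w a a = 0

namespace Instance

variable (G : Instance)

/-- The subgraph induced by the vertex set `U` is metric. -/
def MetricOn (U : Set (Fin G.n)) : Prop :=
  ∀ a ∈ U, ∀ b ∈ U, ∀ c ∈ U,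
    G.w a a = 0 ∧ G.w a b = G.w b a ∧ G.w a b ≤ G.w a c + G.w c b

/-- `S` is a violating set: deleting `S` leaves a metric graph. -/
def IsViolatingSet (S : Finset (Fin G.n)) : Prop :=
  G.MetricOn {v | v ∉ S}

/-- The parameter `q`: the size of a minimum violating set. -/
noncomputable def q : ℕ :=
  sInf {k | ∃ S : Finset (Fin G.n), G.IsViolatingSet S ∧ S.card = k}

/-- The minimum in the definition of `q` is attained. -/
theorem q_attained : ∃ S : Finset (Fin G.n), G.IsViolatingSet S ∧ S.card = G.q := by
  have h : {k | ∃ S : Finset (Fin G.n), G.IsViolatingSet S ∧ S.card = k}.Nonempty :=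
    ⟨_, Finset.univ, by intro a ha; simp at ha, rfl⟩
  exact Nat.sInf_mem h

/-- A TSP tour (Hamiltonian cycle), as the sequence `T 0, T 1, …, T (n - 1)` in which it visits
the vertices, each exactly once. -/
abbrev Tour : Type := Equiv.Perm (Fin G.n)

/-- The weight of the closed tour: the edges join cyclically consecutive vertices. -/
noncomputable def weight (T : G.Tour) : ℝ :=
  ∑ i : Fin G.n, G.w (T i) (T (finRotate G.n i))

/-- The weight of an optimal TSP tour. -/
noncomputable def opt : ℝ := ⨅ T : G.Tour, G.weight T

/-- The infimum in the definition of `opt` is a minimum. -/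
theorem opt_isLeast : IsLeast (Set.range G.weight) G.opt := by
  refine ⟨?_, ?_⟩
  · obtain ⟨T, hT⟩ := exists_eq_ciInf_of_finite (f := G.weight)
    exact ⟨T, hT⟩
  · rintro _ ⟨T, rfl⟩
    exact ciInf_le (Set.finite_range _).bddBelow T

end Instance

/-! ### A random access machine over the reals with a step count

The memory consists of natural-number registers, of arrays of natural numbers and of arrays of
reals.  A program mentions finitely many registers and arrays; array entries are addressed
by computed indices.  The available operations are addition and subtraction, and comparison, on
naturals (truncated subtraction) and on reals.  There is no multiplication, no rounding, no
conversion between reals and naturals, and `0` is the only real constant.  Every operation, memory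
access, assignment and branching takes one step. -/

/-- A memory state. -/
structure State where
  /-- natural-number registers -/
  reg : ℕ → ℕ
  /-- `arr a i` is entry `i` of the natural-number array `a` -/
  arr : ℕ → ℕ → ℕ
  /-- `rarr a i` is entry `i` of the real array `a` -/
  rarr : ℕ → ℕ → ℝ

/-- Natural-number expressions. -/
inductive NExp where
  | const (k : ℕ)
  | reg (x : ℕ)
  | get (a : ℕ) (i : NExp)
  | add (e f : NExp)
  | sub (e f : NExp)

namespace NExp

def eval (s : State) : NExp → ℕ
  | const k => k
  | reg x => s.reg x
  | get a i => s.arr a (i.eval s)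
  | add e f => e.eval s + f.eval s
  | sub e f => e.eval s - f.eval s

/-- Number of steps needed to evaluate the expression. -/
def cost : NExp → ℕ
  | const _ => 1
  | reg _ => 1
  | get _ i => i.cost + 1
  | add e f => e.cost + f.cost + 1
  | sub e f => e.cost + f.cost + 1

end NExp

/-- Real expressions. -/
inductive RExp where
  | zero
  | get (a : ℕ) (i : NExp)
  | add (e f : RExp)
  | sub (e f : RExp)

namespace RExp

noncomputable def eval (s : State) : RExp → ℝ
  | zero => 0
  | get a i => s.rarr a (i.eval s)
  | add e f => e.eval s + f.eval s
  | sub e f => e.eval s - f.eval s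

/-- Number of steps needed to evaluate the expression. -/
def cost : RExp → ℕ
  | zero => 1
  | get _ i => i.cost + 1
  | add e f => e.cost + f.cost + 1
  | sub e f => e.cost + f.cost + 1

end RExp

/-- Tests. -/
inductive Test where
  | eqN (e f : NExp)
  | ltN (e f : NExp)
  | ltR (e f : RExp)
  | neg (b : Test)
  | conj (b c : Test)

namespace Test

/-- The test succeeds in the state `s`. -/
def Holds (s : State) : Test → Prop
  | eqN e f => e.eval s = f.eval s
  | ltN e f => e.eval s < f.eval s
  | ltR e f => e.eval s < f.eval s
  | neg b => ¬ b.Holds s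
  | conj b c => b.Holds s ∧ c.Holds s

/-- Number of steps needed to evaluate the test. -/
def cost : Test → ℕ
  | eqN e f => e.cost + f.cost + 1
  | ltN e f => e.cost + f.cost + 1
  | ltR e f => e.cost + f.cost + 1
  | neg b => b.cost + 1
  | conj b c => b.cost + c.cost + 1

end Test

/-- Programs. -/
inductive Prog where
  | skip
  /-- `reg x := e` -/
  | setReg (x : ℕ) (e : NExp)
  /-- `arr a [i] := e` -/
  | setArr (a : ℕ) (i e : NExp)
  /-- `rarr a [i] := e` -/
  | setReal (a : ℕ) (i : NExp) (e : RExp)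
  | seq (P Q : Prog)
  /-- if `b` then `P` else `Q` -/
  | branch (b : Test) (P Q : Prog)
  /-- while `b` do `P` -/
  | loop (b : Test) (P : Prog)

namespace State

def setReg (s : State) (x v : ℕ) : State :=
  { s with reg := Function.update s.reg x v }

def setArr (s : State) (a i v : ℕ) : State :=
  { s with arr := Function.update s.arr a (Function.update (s.arr a) i v) }

noncomputable def setReal (s : State) (a i : ℕ) (v : ℝ) : State :=
  { s with rarr := Function.update s.rarr a (Function.update (s.rarr a) i v) }

end State

/-- `Runs P s t s'`: started in the state `s`, the program `P` halts after exactly `t` steps, in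
the state `s'`. -/
inductive Runs : Prog → State → ℕ → State → Prop where
  | skip (s : State) : Runs .skip s 1 s
  | setReg (s : State) (x : ℕ) (e : NExp) :
      Runs (.setReg x e) s (e.cost + 1) (s.setReg x (e.eval s))
  | setArr (s : State) (a : ℕ) (i e : NExp) :
      Runs (.setArr a i e) s (i.cost + e.cost + 1) (s.setArr a (i.eval s) (e.eval s))
  | setReal (s : State) (a : ℕ) (i : NExp) (e : RExp) :
      Runs (.setReal a i e) s (i.cost + e.cost + 1) (s.setReal a (i.eval s) (e.eval s))
  | seq {P Q : Prog} {s s' s'' : State} {t t' : ℕ} :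
      Runs P s t s' → Runs Q s' t' s'' → Runs (.seq P Q) s (t + t') s''
  | branchTrue {b : Test} {P Q : Prog} {s s' : State} {t : ℕ} :
      b.Holds s → Runs P s t s' → Runs (.branch b P Q) s (b.cost + 1 + t) s'
  | branchFalse {b : Test} {P Q : Prog} {s s' : State} {t : ℕ} :
      ¬ b.Holds s → Runs Q s t s' → Runs (.branch b P Q) s (b.cost + 1 + t) s'
  | loopTrue {b : Test} {P : Prog} {s s' s'' : State} {t t' : ℕ} :
      b.Holds s → Runs P s t s' → Runs (.loop b P) s' t' s'' →
        Runs (.loop b P) s (b.cost + 1 + t + t') s''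
  | loopFalse {b : Test} {P : Prog} {s : State} :
      ¬ b.Holds s → Runs (.loop b P) s (b.cost + 1) s

/-- The machine is deterministic: the number of steps and the final state of a halting computation
are determined by the program and the initial state. -/
theorem Runs.unique {P : Prog} {s s₁ : State} {t₁ : ℕ} (h₁ : Runs P s t₁ s₁) :
    ∀ {t₂ : ℕ} {s₂ : State}, Runs P s t₂ s₂ → t₁ = t₂ ∧ s₁ = s₂ := by
  induction h₁ with
  | skip => intro t₂ s₂ h; cases h; exact ⟨rfl, rfl⟩
  | setReg => intro t₂ s₂ h; cases h; exact ⟨rfl, rfl⟩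
  | setArr => intro t₂ s₂ h; cases h; exact ⟨rfl, rfl⟩
  | setReal => intro t₂ s₂ h; cases h; exact ⟨rfl, rfl⟩
  | seq _ _ ih ih' =>
    intro t₂ s₂ h
    cases h with
    | seq h h' =>
      obtain ⟨rfl, rfl⟩ := ih h
      obtain ⟨rfl, rfl⟩ := ih' h'
      exact ⟨rfl, rfl⟩
  | branchTrue hb _ ih =>
    intro t₂ s₂ h
    cases h with
    | branchTrue _ h => obtain ⟨rfl, rfl⟩ := ih h; exact ⟨rfl, rfl⟩
    | branchFalse hb' _ => exact absurd hb hb'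
  | branchFalse hb _ ih =>
    intro t₂ s₂ h
    cases h with
    | branchTrue hb' _ => exact absurd hb' hb
    | branchFalse _ h => obtain ⟨rfl, rfl⟩ := ih h; exact ⟨rfl, rfl⟩
  | loopTrue hb _ _ ih ih' =>
    intro t₂ s₂ h
    cases h with
    | loopTrue _ h h' =>
      obtain ⟨rfl, rfl⟩ := ih h
      obtain ⟨rfl, rfl⟩ := ih' h'
      exact ⟨rfl, rfl⟩
    | loopFalse hb' => exact absurd hb hb'
  | loopFalse hb =>
    intro t₂ s₂ h
    cases h with
    | loopTrue hb' _ _ => exact absurd hb' hb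
    | loopFalse _ => exact ⟨rfl, rfl⟩

/-- Input convention: register `0` holds `n`, real array `0` holds the weight matrix row by row
(entry `a * n + b` is `w a b`), and the rest of the memory is `0`. -/
noncomputable def Instance.input (G : Instance) : State where
  reg x := if x = 0 then G.n else 0
  arr _ _ := 0
  rarr r k :=
    if h : r = 0 ∧ k < G.n * G.n then
      G.w ⟨k / G.n, Nat.div_lt_of_lt_mul h.2⟩
        ⟨k % G.n, Nat.mod_lt k (Nat.pos_of_ne_zero fun h0 => by simp [h0] at h)⟩
    else 0

/-- Output convention: natural-number array `0` lists the vertices in the order of the tour. -/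
def Instance.IsOutput (G : Instance) (s : State) (T : G.Tour) : Prop :=
  ∀ i : Fin G.n, s.arr 0 i = T i

end ParamTSP

open ParamTSP

/-! A violating set `S` with `k ≤ 3q + 1` elements is found greedily: as long as a triple outside
`S` violates the triangle inequality, all three vertices are added, and every violating set contains
one of them. Vertex 0 is put into `S` in advance, so that there is a known vertex of `S` at which
tours start.

The metric part is clustered as in Kruskal's algorithm, merging along cheapest edges until at most
`k` clusters are left. Each cluster is the vertex set of a cycle of a permutation `π`, and a merge
along `ab` multiplies `π` by the transposition of `a` and `b`, which by the triangle inequality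
costs at most `2 w(a, b)`. A tour is cut by `S` into at most `k` paths, so while there are more than
`k` clusters it has enough edges between clusters to charge every merge to an edge of its own. Hence
`π` costs at most `2 OPT` (`cost_of_merges`).

An optimal tour is shortcut to a skeleton of at most `4k` vertices: `S`, the tour neighbours of `S`,
and for every cluster in which some tour edge of the metric part starts, the start of one such edge
(`exists_skeleton`). All shortcuts bypass metric vertices only, so the skeleton weighs at most
`OPT`. Its vertices cannot be guessed, since there are `n` choices for each, but their clusters can.
A cheapest closed path that visits the right clusters in the right order is found by dynamic
programming over layers (`layered_path`). To keep its vertices distinct, every vertex also carries a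
colour, and the layer of a position consists of the vertices of the guessed cluster with the guessed
colour. The colours, which also serve as names of the clusters, are values of a hash function with
`O(k^2)` values taken from a polynomial family, one member of which separates the `6k` vertices that
matter (`exists_hash`). A guess is thus a word of `8k` digits over `O(k^2)` symbols, and there are
`2^{O(k log k)}` guesses.

The cheapest path visits every cluster as often as the skeleton does. Wherever it uses an edge of
the metric part, the cycle of `π` through the start of the edge is inserted, skipping vertices that
are on the path or already listed (`assemble_cost`). Every cluster is exhausted by the path or
inserted in this way, so the result is a tour of weight at most `OPT + 2 OPT`. The algorithm keeps
the best tour over all hash functions and guesses; wrong ones do no harm.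

For the running time, the program uses only for-loops with bounds fixed on entry. If all bounds are
at most `M`, the time is polynomial in `M` (`timeBound_poly`), and here `M = 2n + 1 + A^{8k}`, where
`A^{8k}` is the number of guesses. -/

namespace ParamTSP

/-! ### A language of for-loops, compiled to the machine -/

/-- Programs all of whose loops are of the form `for x < y`. -/
inductive ForProg where
  | skip
  | setReg (x : ℕ) (e : NExp)
  | setArr (a : ℕ) (i e : NExp)
  | setReal (a : ℕ) (i : NExp) (e : RExp)
  | seq (P Q : ForProg)
  | ite (b : Test) (P Q : ForProg)
  | for_ (x y : ℕ) (P : ForProg)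

@[simp] theorem State.setReg_reg (s : State) (x v y : ℕ) :
    (s.setReg x v).reg y = if y = x then v else s.reg y := by
  simp [State.setReg, Function.update_apply]
@[simp] theorem State.setReg_arr (s : State) (x v : ℕ) : (s.setReg x v).arr = s.arr := rfl
@[simp] theorem State.setReg_rarr (s : State) (x v : ℕ) : (s.setReg x v).rarr = s.rarr := rfl
@[simp] theorem State.setArr_reg (s : State) (a i v : ℕ) : (s.setArr a i v).reg = s.reg := rfl
@[simp] theorem State.setArr_rarr (s : State) (a i v : ℕ) : (s.setArr a i v).rarr = s.rarr := rfl
@[simp] theorem State.setArr_arr (s : State) (a i v b : ℕ) : (s.setArr a i v).arr b =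
    if b = a then Function.update (s.arr a) i v else s.arr b := by
  by_cases h : b = a <;> simp [State.setArr, h]
@[simp] theorem State.setReal_reg (s : State) (a i : ℕ) (v : ℝ) :
    (s.setReal a i v).reg = s.reg := rfl
@[simp] theorem State.setReal_arr (s : State) (a i : ℕ) (v : ℝ) :
    (s.setReal a i v).arr = s.arr := rfl
@[simp] theorem State.setReal_rarr (s : State) (a i : ℕ) (v : ℝ) (b : ℕ) :
    (s.setReal a i v).rarr b =
    if b = a then Function.update (s.rarr a) i v else s.rarr b := by
  by_cases h : b = a <;> simp [State.setReal, h]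

/-- The state before round `i` of a for-loop with counter `x` and body `f`. -/
def loopDen (f : State → State) (x : ℕ) : ℕ → State → State
  | 0, s => s.setReg x 0
  | i + 1, s => (f (loopDen f x i s)).setReg x (i + 1)

theorem loopDen_counter (f : State → State) (x i : ℕ) (s : State) :
    (loopDen f x i s).reg x = i := by
  cases i <;> simp [loopDen]

/-- Invariants need not record the counter: its value at the start of round `i` is supplied to the
induction step. -/
theorem loopDen_induction {f : State → State} {x N : ℕ} {s : State} (I : ℕ → State → Prop)
    (h0 : I 0 (s.setReg x 0))
    (hs : ∀ i < N, ∀ s', s'.reg x = i → I i s' → I (i + 1) ((f s').setReg x (i + 1))) :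
    I N (loopDen f x N s) := by
  suffices h : ∀ i ≤ N, I i (loopDen f x i s) from h N le_rfl
  intro i
  induction i with
  | zero => intro _; exact h0
  | succ i ih => intro hi; exact hs i hi _ (loopDen_counter _ _ _ _) (ih (by omega))

/-! ### Semantics, compilation and running time of programs with for-loops -/

namespace ForProg

/-- The state transformation effected by a program. -/
noncomputable def den : ForProg → State → State
  | skip, s => s
  | setReg x e, s => s.setReg x (e.eval s)
  | setArr a i e, s => s.setArr a (i.eval s) (e.eval s)
  | setReal a i e, s => s.setReal a (i.eval s) (e.eval s)
  | seq P Q, s => Q.den (P.den s)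
  | ite b P Q, s => open Classical in if b.Holds s then P.den s else Q.den s
  | for_ x y P, s => loopDen P.den x (s.reg y) s

/-- Compilation. -/
def toProg : ForProg → Prog
  | skip => .skip
  | setReg x e => .setReg x e
  | setArr a i e => .setArr a i e
  | setReal a i e => .setReal a i e
  | seq P Q => .seq P.toProg Q.toProg
  | ite b P Q => .branch b P.toProg Q.toProg
  | for_ x y P => .seq (.setReg x (.const 0))
      (.loop (.ltN (.reg x) (.reg y)) (.seq P.toProg (.setReg x (.add (.reg x) (.const 1)))))

/-- Registers written to. -/
def writtenRegs : ForProg → List ℕ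
  | setReg x _ => [x]
  | seq P Q => P.writtenRegs ++ Q.writtenRegs
  | ite _ P Q => P.writtenRegs ++ Q.writtenRegs
  | for_ x _ P => x :: P.writtenRegs
  | _ => []

/-- Natural-number arrays written to. -/
def writtenArrs : ForProg → List ℕ
  | setArr a _ _ => [a]
  | seq P Q => P.writtenArrs ++ Q.writtenArrs
  | ite _ P Q => P.writtenArrs ++ Q.writtenArrs
  | for_ _ _ P => P.writtenArrs
  | _ => []

/-- Real arrays written to. -/
def writtenReals : ForProg → List ℕ
  | setReal a _ _ => [a]
  | seq P Q => P.writtenReals ++ Q.writtenReals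
  | ite _ P Q => P.writtenReals ++ Q.writtenReals
  | for_ _ _ P => P.writtenReals
  | _ => []

/-- Registers holding loop bounds. -/
def boundRegs : ForProg → List ℕ
  | seq P Q => P.boundRegs ++ Q.boundRegs
  | ite _ P Q => P.boundRegs ++ Q.boundRegs
  | for_ _ y P => y :: P.boundRegs
  | _ => []

/-- Loop bodies do not touch their counters. -/
def CountersSafe : ForProg → Prop
  | seq P Q => P.CountersSafe ∧ Q.CountersSafe
  | ite _ P Q => P.CountersSafe ∧ Q.CountersSafe
  | for_ x _ P => x ∉ P.writtenRegs ∧ P.CountersSafe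
  | _ => True

/-- Frame property. The list of written registers is syntactic, so for a concrete program the
hypothesis is settled by `decide`, and specifications need to speak only of the memory that changes.
-/
theorem den_reg {P : ForProg} {x : ℕ} (s : State) (h : x ∉ P.writtenRegs) :
    (P.den s).reg x = s.reg x := by
  induction P generalizing s with
  | skip | setArr | setReal => simp [den]
  | setReg y e => simp [writtenRegs] at h; simp [den, h]
  | seq P Q ihP ihQ => simp [writtenRegs] at h; simp [den, ihP _ h.1, ihQ _ h.2]
  | ite b P Q ihP ihQ =>
    simp [writtenRegs] at h
    simp only [den]; split <;> simp [ihP _ h.1, ihQ _ h.2]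
  | for_ y z P ih =>
    simp [writtenRegs] at h
    simp only [den]
    generalize s.reg z = N
    refine loopDen_induction (fun _ s' => s'.reg x = s.reg x) (by simp [h]) ?_
    intro i _ s' _ hs'
    simp [h, ih s' h.2, hs']

theorem den_arr {P : ForProg} {a : ℕ} (s : State) (h : a ∉ P.writtenArrs) :
    (P.den s).arr a = s.arr a := by
  induction P generalizing s with
  | skip | setReg | setReal => simp [den]
  | setArr y e => simp [writtenArrs] at h; simp [den, h]
  | seq P Q ihP ihQ => simp [writtenArrs] at h; simp [den, ihP _ h.1, ihQ _ h.2]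
  | ite b P Q ihP ihQ =>
    simp [writtenArrs] at h
    simp only [den]; split <;> simp [ihP _ h.1, ihQ _ h.2]
  | for_ y z P ih =>
    simp only [den]
    refine loopDen_induction (fun _ s' => s'.arr a = s.arr a) (by simp) ?_
    intro i _ s' _ hs'
    simp [ih s' h, hs']

theorem den_rarr {P : ForProg} {a : ℕ} (s : State) (h : a ∉ P.writtenReals) :
    (P.den s).rarr a = s.rarr a := by
  induction P generalizing s with
  | skip | setReg | setArr => simp [den]
  | setReal y e => simp [writtenReals] at h; simp [den, h]
  | seq P Q ihP ihQ => simp [writtenReals] at h; simp [den, ihP _ h.1, ihQ _ h.2]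
  | ite b P Q ihP ihQ =>
    simp [writtenReals] at h
    simp only [den]; split <;> simp [ihP _ h.1, ihQ _ h.2]
  | for_ y z P ih =>
    simp only [den]
    refine loopDen_induction (fun _ s' => s'.rarr a = s.rarr a) (by simp) ?_
    intro i _ s' _ hs'
    simp [ih s' h, hs']

/-- Running time if all loop bounds are at most `M`. -/
def timeBound : ForProg → ℕ → ℕ
  | skip, _ => 1
  | setReg _ e, _ => e.cost + 1
  | setArr _ i e, _ => i.cost + e.cost + 1
  | setReal _ i e, _ => i.cost + e.cost + 1
  | seq P Q, M => P.timeBound M + Q.timeBound M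
  | ite b P Q, M => b.cost + 1 + (P.timeBound M + Q.timeBound M)
  | for_ _ _ P, M => M * (P.timeBound M + 8) + 6

/-- The compiled loop reads its counter and its bound anew in every round. The body writes to
neither, so the number of rounds is the value of the bound on entry, and induction on the number of
remaining rounds gives halting and the time bound together. -/
theorem runs_toProg {P : ForProg} {M : ℕ} (hP : P.CountersSafe)
    (hw : ∀ y ∈ P.boundRegs, y ∉ P.writtenRegs) (s : State) (hM : ∀ y ∈ P.boundRegs, s.reg y ≤ M) :
    ∃ t ≤ P.timeBound M, Runs P.toProg s t (P.den s) := by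
  induction P generalizing s with
  | skip => exact ⟨_, le_rfl, .skip s⟩
  | setReg x e => exact ⟨_, le_rfl, .setReg s x e⟩
  | setArr a i e => exact ⟨_, le_rfl, .setArr s a i e⟩
  | setReal a i e => exact ⟨_, le_rfl, .setReal s a i e⟩
  | seq P Q ihP ihQ =>
    simp only [boundRegs, writtenRegs, List.mem_append, not_or] at hw hM
    obtain ⟨t, ht, hr⟩ := ihP hP.1 (fun y hy => (hw y (.inl hy)).1) s (fun y hy => hM y (.inl hy))
    obtain ⟨t', ht', hr'⟩ := ihQ hP.2 (fun y hy => (hw y (.inr hy)).2) (P.den s)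
      (fun y hy => by rw [den_reg s (hw y (.inr hy)).1]; exact hM y (.inr hy))
    exact ⟨_, add_le_add ht ht', hr.seq hr'⟩
  | ite b P Q ihP ihQ =>
    simp only [boundRegs, writtenRegs, List.mem_append, not_or] at hw hM
    by_cases hb : b.Holds s
    · obtain ⟨t, ht, hr⟩ := ihP hP.1 (fun y hy => (hw y (.inl hy)).1) s
        (fun y hy => hM y (.inl hy))
      refine ⟨b.cost + 1 + t, ?_, ?_⟩
      · simp only [timeBound]; omega
      · simp only [den, hb, if_true]; exact .branchTrue hb hr
    · obtain ⟨t, ht, hr⟩ := ihQ hP.2 (fun y hy => (hw y (.inr hy)).2) s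
        (fun y hy => hM y (.inr hy))
      refine ⟨b.cost + 1 + t, ?_, ?_⟩
      · simp only [timeBound]; omega
      · simp only [den, hb, if_false]; exact .branchFalse hb hr
  | for_ x y P ih =>
    simp only [boundRegs, writtenRegs, List.mem_cons, not_or] at hw hM
    have hyx : y ≠ x := (hw y (.inl rfl)).1
    -- Besides its body, a round costs 4 steps for test and branching and 4 for the increment; the
    -- final failing test costs 4. Initializing the counter adds 2, whence the 8 and the 6 in
    -- `timeBound`.
    have key : ∀ d i, i + d = s.reg y → (∃ t ≤ d * (P.timeBound M + 8) + 4,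
        Runs (.loop (.ltN (.reg x) (.reg y)) (.seq P.toProg
          (.setReg x (.add (.reg x) (.const 1))))) (loopDen P.den x i s) t
          (loopDen P.den x (s.reg y) s)) := by
      have hfr : ∀ z, z ≠ x → z ∉ P.writtenRegs → ∀ i, (loopDen P.den x i s).reg z = s.reg z := by
        intro z hz hz' i
        refine loopDen_induction (fun _ s' => s'.reg z = s.reg z) (by simp [hz]) ?_
        intro i _ s' _ hs'
        simp [hz, den_reg s' hz', hs']
      intro d
      induction d with
      | zero =>
        intro i hi
        have : i = s.reg y := by omega
        subst this
        refine ⟨_, ?_, .loopFalse ?_⟩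
        · simp [Test.cost, NExp.cost]
        · simp [Test.Holds, NExp.eval, loopDen_counter, hfr y hyx (hw y (.inl rfl)).2]
      | succ d ihd =>
        intro i hi
        obtain ⟨t', ht', hr'⟩ := ihd (i + 1) (by omega)
        obtain ⟨t, ht, hr⟩ := ih hP.2 (fun z hz => (hw z (.inr hz)).2) (loopDen P.den x i s)
          (fun z hz => by
            rw [hfr z (hw z (.inr hz)).1 (hw z (.inr hz)).2]; exact hM z (.inr hz))
        have hset := Runs.setReg (P.den (loopDen P.den x i s)) x (.add (.reg x) (.const 1))
        have hx : (NExp.add (.reg x) (.const 1)).eval (P.den (loopDen P.den x i s)) = i + 1 := by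
          simp [NExp.eval, den_reg _ hP.1, loopDen_counter]
        rw [hx] at hset
        refine ⟨_, ?_, .loopTrue ?_ (hr.seq hset) hr'⟩
        · simp only [Test.cost, NExp.cost]
          rw [add_mul]; omega
        · simp [Test.Holds, NExp.eval, loopDen_counter, hfr y hyx (hw y (.inl rfl)).2]
          omega
    obtain ⟨t, ht, hr⟩ := key (s.reg y) 0 (by simp)
    refine ⟨_, ?_, (Runs.setReg s x (.const 0)).seq hr⟩
    have := Nat.mul_le_mul_right (P.timeBound M + 8) (hM y (.inl rfl))
    simp only [NExp.cost, timeBound]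
    omega

/-- Each level of nesting multiplies the time by about `M`, and the nesting depth is a constant of
the program. -/
theorem timeBound_poly (P : ForProg) : ∃ C d, ∀ M, P.timeBound M ≤ C * (M + 1) ^ d := by
  have mono : ∀ {C d C' d' M : ℕ}, C ≤ C' → d ≤ d' → C * (M + 1) ^ d ≤ C' * (M + 1) ^ d' :=
    fun h h' => Nat.mul_le_mul h (Nat.pow_le_pow_right (by omega) h')
  induction P with
  | skip => exact ⟨1, 0, by simp [timeBound]⟩
  | setReg x e => exact ⟨e.cost + 1, 0, by simp [timeBound]⟩
  | setArr a i e => exact ⟨i.cost + e.cost + 1, 0, by simp [timeBound]⟩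
  | setReal a i e => exact ⟨i.cost + e.cost + 1, 0, by simp [timeBound]⟩
  | seq P Q ihP ihQ =>
    obtain ⟨C, d, h⟩ := ihP
    obtain ⟨C', d', h'⟩ := ihQ
    refine ⟨C + C', max d d', fun M => ?_⟩
    rw [add_mul]
    exact add_le_add ((h M).trans (mono le_rfl (le_max_left ..)))
      ((h' M).trans (mono le_rfl (le_max_right ..)))
  | ite b P Q ihP ihQ =>
    obtain ⟨C, d, h⟩ := ihP
    obtain ⟨C', d', h'⟩ := ihQ
    refine ⟨b.cost + 1 + (C + C'), max d d', fun M => ?_⟩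
    rw [add_mul (b.cost + 1), add_mul C]
    refine add_le_add ?_ (add_le_add ((h M).trans (mono le_rfl (le_max_left ..)))
      ((h' M).trans (mono le_rfl (le_max_right ..))))
    exact Nat.le_mul_of_pos_right _ (by positivity)
  | for_ x y P ih =>
    obtain ⟨C, d, h⟩ := ih
    refine ⟨C + 14, d + 1, fun M => ?_⟩
    simp only [timeBound]
    have h1 := h M
    have h2 : 1 ≤ (M + 1) ^ d := Nat.one_le_pow _ _ (by omega)
    calc M * (P.timeBound M + 8) + 6 ≤ (M + 1) * (C * (M + 1) ^ d + 8) + 6 * (M + 1) := by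
          gcongr <;> omega
      _ = (M + 1) * (C * (M + 1) ^ d + 14 * 1) := by ring
      _ ≤ (M + 1) * (C * (M + 1) ^ d + 14 * (M + 1) ^ d) := by gcongr
      _ = (C + 14) * (M + 1) ^ (d + 1) := by ring

end ForProg
/-! ### A polynomial family of hash functions -/

theorem card_multiples_le (p R : ℕ) :
    ((Finset.Ioo 0 p).filter (fun z => R ∣ z)).card * R ≤ p - 1 := by
  have h : (Finset.Ioo 0 p).filter (fun z => R ∣ z) = (Finset.Ioc 0 (p - 1)).filter (R ∣ ·) := by
    ext z; simp; intros; omega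
  rw [h, Nat.Ioc_filter_dvd_card_eq_div]
  exact Nat.div_mul_le_self _ _

/-- Put `z = a * (y - x) % p`. The two residues modulo `p` differ by `z` or, after a wrap-around, by
`p - z`; a collision modulo `R` therefore makes `R` divide `z` or `p - z`. As `a` varies, `z` takes
each value at most once, and at most `(p - 1) / R` values are admissible in either case. -/
theorem card_collision_le {p R x y : ℕ} (hp : p.Prime) (hy : y < p) (hxy : x < y) :
    ((Finset.Ioo 0 p).filter (fun a => (a * x % p) % R = (a * y % p) % R)).card * R
      ≤ 2 * (p - 1) := by
  set A := (Finset.Ioo 0 p).filter (fun z => R ∣ z) with hA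
  set B := (Finset.Ioo 0 p).filter (fun z => R ∣ p - z) with hB
  have hBA : B.card = A.card := by
    refine Finset.card_bij' (fun z _ => p - z) (fun z _ => p - z) ?_ ?_ ?_ ?_
    · intro z hz; simp [hA, hB] at hz ⊢; omega
    · intro z hz
      simp [hA, hB] at hz ⊢
      have : p - (p - z) = z := by omega
      rw [this]; exact ⟨by omega, hz.2⟩
    · intro z hz; simp [hB] at hz; omega
    · intro z hz; simp [hA] at hz; omega
  have hle : ((Finset.Ioo 0 p).filter (fun a => (a * x % p) % R = (a * y % p) % R)).card
      ≤ (A ∪ B).card := by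
    refine Finset.card_le_card_of_injOn (fun a => a * (y - x) % p) ?_ ?_
    · intro a ha
      simp only [Finset.coe_filter, Finset.mem_Ioo, Set.mem_ofPred_eq] at ha
      obtain ⟨⟨ha0, hap⟩, hc⟩ := ha
      have hpos : 0 < a * (y - x) % p := by
        refine Nat.pos_of_ne_zero fun h => ?_
        rcases hp.dvd_mul.1 (Nat.dvd_of_mod_eq_zero h) with h | h
        · exact absurd (Nat.le_of_dvd ha0 h) (by omega)
        · exact absurd (Nat.le_of_dvd (by omega) h) (by omega)
      have hlt : a * (y - x) % p < p := Nat.mod_lt _ hp.pos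
      set e := a * x % p with he
      set f := a * y % p with hf
      set z := a * (y - x) % p with hz
      have hsum : (e + z) % p = f := by
        rw [he, hz, hf, ← Nat.add_mod, ← mul_add]; congr 2; omega
      have hep : e < p := Nat.mod_lt _ hp.pos
      simp only [Finset.coe_union, Set.mem_union, Finset.mem_coe, hA, hB, Finset.mem_filter,
        Finset.mem_Ioo]
      by_cases hw : e + z < p
      · rw [Nat.mod_eq_of_lt hw] at hsum
        left
        refine ⟨⟨hpos, hlt⟩, ?_⟩
        have := (Nat.modEq_iff_dvd' (show e ≤ f by omega)).1 hc
        rwa [show f - e = z by omega] at this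
      · rw [Nat.mod_eq_sub_mod (by omega), Nat.mod_eq_of_lt (by omega)] at hsum
        right
        refine ⟨⟨hpos, hlt⟩, ?_⟩
        have := (Nat.modEq_iff_dvd' (show f ≤ e by omega)).1 hc.symm
        rwa [show e - f = p - z by omega] at this
    · intro a ha b hb hab
      simp only [Finset.coe_filter, Finset.mem_Ioo, Set.mem_ofPred_eq] at ha hb
      have hcop : Nat.gcd p (y - x) = 1 :=
        (Nat.Prime.coprime_iff_not_dvd hp).2 fun h =>
          absurd (Nat.le_of_dvd (by omega) h) (by omega)
      have := Nat.ModEq.cancel_right_of_coprime hcop hab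
      rwa [Nat.ModEq, Nat.mod_eq_of_lt ha.1.2, Nat.mod_eq_of_lt hb.1.2] at this
  have h1 := Finset.card_union_le A B
  have h2 : A.card * R ≤ p - 1 := card_multiples_le p R
  calc _ ≤ (A ∪ B).card * R := Nat.mul_le_mul_right _ hle
    _ ≤ (A.card + B.card) * R := Nat.mul_le_mul_right _ h1
    _ ≤ _ := by rw [hBA, add_mul]; omega

/-- Union bound: Bertrand's postulate supplies a prime `p`, and each of the at most `m * m` pairs
excludes at most `2 * (p - 1) / R` of the `p - 1` multipliers. Since `R` exceeds `2 * (m * m)`, some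
multiplier survives. There are only polynomially many pairs `p`, `a`, so all of them can be tried.
-/
theorem exists_hash {n m : ℕ} (X : Finset ℕ) (hX : ∀ x ∈ X, x < n) (hm : X.card ≤ m) (hn : n ≠ 0) :
    ∃ p a, p ≤ 2 * n ∧ a < p ∧
      Set.InjOn (fun v => (a * v % p) % (2 * (m * m) + 1)) (X : Set ℕ) := by
  obtain ⟨p, hp, hnp, hpn⟩ := Nat.exists_prime_lt_and_le_two_mul n hn
  set R := 2 * (m * m) + 1 with hR
  set D := (X ×ˢ X).filter (fun q => q.1 < q.2) with hD
  set bad := fun q : ℕ × ℕ =>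
    (Finset.Ioo 0 p).filter (fun a => (a * q.1 % p) % R = (a * q.2 % p) % R) with hbad
  have hDc : D.card ≤ m * m := by
    calc D.card ≤ (X ×ˢ X).card := Finset.card_filter_le _ _
      _ = X.card * X.card := Finset.card_product _ _
      _ ≤ m * m := Nat.mul_le_mul hm hm
  have hb : (D.biUnion bad).card * R ≤ (m * m) * (2 * (p - 1)) := by
    calc (D.biUnion bad).card * R ≤ (∑ q ∈ D, (bad q).card) * R :=
          Nat.mul_le_mul_right _ Finset.card_biUnion_le
      _ = ∑ q ∈ D, (bad q).card * R := Finset.sum_mul _ _ _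
      _ ≤ ∑ q ∈ D, 2 * (p - 1) := by
          refine Finset.sum_le_sum fun q hq => ?_
          simp only [hD, Finset.mem_filter, Finset.mem_product] at hq
          exact card_collision_le hp ((hX _ hq.1.2).trans hnp) hq.2
      _ ≤ _ := by rw [Finset.sum_const, smul_eq_mul]; exact Nat.mul_le_mul_right _ hDc
  have hlt : (D.biUnion bad).card < (Finset.Ioo 0 p).card := by
    rw [Nat.card_Ioo]
    by_contra hcon
    have h2 := hp.two_le
    have : (p - 0 - 1) * R ≤ (m * m) * (2 * (p - 1)) :=
      (Nat.mul_le_mul_right _ (not_lt.1 hcon)).trans hb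
    rw [Nat.sub_zero, hR] at this
    have h3 : (p - 1) * (2 * (m * m) + 1) = (m * m) * (2 * (p - 1)) + (p - 1) := by ring
    omega
  obtain ⟨a, ha, hna⟩ := Finset.exists_mem_notMem_of_card_lt_card hlt
  refine ⟨p, a, hpn, (Finset.mem_Ioo.1 ha).2, ?_⟩
  have key : ∀ x ∈ X, ∀ y ∈ X, x < y → (a * x % p) % R ≠ (a * y % p) % R := by
    intro x hx y hy hxy h
    refine hna (Finset.mem_biUnion.2 ⟨(x, y), ?_, ?_⟩)
    · simp [hD, hx, hy, hxy]
    · rw [hbad]; exact Finset.mem_filter.2 ⟨ha, h⟩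
  intro x hx y hy h
  rcases lt_trichotomy x y with hlt | heq | hlt
  · exact absurd h (key x hx y hy hlt)
  · exact heq
  · exact absurd h.symm (key y hy x hx hlt)

/-! ### Clusterings of the metric part by closed walks, merged greedily -/

theorem Instance.IsViolatingSet.triangle {G : Instance} {S : Finset (Fin G.n)}
    (h : G.IsViolatingSet S) {a b c : Fin G.n} (ha : a ∉ S) (hb : b ∉ S) (hc : c ∉ S) :
    G.w a b ≤ G.w a c + G.w c b :=
  (h a ha b hb c hc).2.2

/-- `comp` assigns cluster representatives, and the cycles of `π` are the clusters; the elements of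
`S` form clusters of their own. -/
structure IsClustering {V : Type*} (S : Finset V) (comp : V → V) (π : Equiv.Perm V) : Prop where
  comp_comp : ∀ v, comp (comp v) = comp v
  comp_perm : ∀ v, comp (π v) = comp v
  sameCycle : ∀ u v, comp u = comp v → π.SameCycle u v
  comp_S : ∀ s ∈ S, comp s = s
  eq_of_comp_eq : ∀ s ∈ S, ∀ v, comp v = s → v = s

namespace IsClustering

variable {V : Type*} {S : Finset V} {comp : V → V} {π : Equiv.Perm V}

theorem init (S : Finset V) : IsClustering S id 1 where
  comp_comp _ := rfl
  comp_perm _ := rfl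
  sameCycle u v h := by cases h; exact .refl _ _
  comp_S _ _ := rfl
  eq_of_comp_eq _ _ _ h := h

theorem comp_notMem (h : IsClustering S comp π) {v : V} (hv : v ∉ S) : comp v ∉ S :=
  fun hs => hv (by rw [h.eq_of_comp_eq _ hs v rfl]; exact hs)

theorem perm_notMem (h : IsClustering S comp π) {v : V} (hv : v ∉ S) : π v ∉ S := fun hs => by
  have h1 := h.eq_of_comp_eq _ hs v (by rw [← h.comp_perm, h.comp_S _ hs])
  exact hv (h1 ▸ hs)

variable [DecidableEq V] [Finite V]

/-- The new permutation sends `a` to `π b` and then follows the old cycle of `b`. That cycle avoids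
`a`, so nothing changes along it before `b` is reached; hence `a` and `b` come to lie on one cycle.
-/
theorem sameCycle_mul_swap {a b : V} (hab : ¬ π.SameCycle a b) :
    (π * Equiv.swap a b).SameCycle a b ∧
      ∀ u v, π.SameCycle u v → (π * Equiv.swap a b).SameCycle u v := by
  set π' := π * Equiv.swap a b with hπ'
  have e1 : π' a = π b := by simp [hπ']
  have e2 : π' b = π a := by simp [hπ']
  have e3 : ∀ v, v ≠ a → v ≠ b → π' v = π v := fun v ha hb => by
    simp [hπ', Equiv.swap_apply_of_ne_of_ne ha hb]
  have main : π'.SameCycle a b := by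
    by_contra hcon
    have key : ∀ j : ℕ, π'.SameCycle a ((π ^ j) (π b)) := by
      intro j
      induction j with
      | zero => rw [pow_zero, Equiv.Perm.one_apply, ← e1]; exact Equiv.Perm.sameCycle_apply_right.2 (.refl _ _)
      | succ j ih =>
        set u := (π ^ j) (π b) with hu
        have hua : u ≠ a := fun h => hab (by
          rw [← h, hu, ← Equiv.Perm.mul_apply, ← pow_succ]
          exact (Equiv.Perm.sameCycle_pow_left).2 (.refl _ _))
        have hub : u ≠ b := fun h => hcon (h ▸ ih)
        rw [pow_succ', Equiv.Perm.mul_apply, ← hu, ← e3 u hua hub]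
        exact Equiv.Perm.sameCycle_apply_right.2 ih
    obtain ⟨j, hj⟩ := (Equiv.Perm.sameCycle_apply_left.2 (.refl π b) : π.SameCycle (π b) b).exists_nat_pow_eq
    exact hcon (hj ▸ key j)
  have step : ∀ v, π'.SameCycle v (π v) := by
    intro v
    by_cases ha : v = a
    · subst ha
      rw [← e2]; exact Equiv.Perm.sameCycle_apply_right.2 main
    by_cases hb : v = b
    · subst hb
      rw [← e1]; exact Equiv.Perm.sameCycle_apply_right.2 main.symm
    rw [← e3 v ha hb]; exact Equiv.Perm.sameCycle_apply_right.2 (.refl _ _)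
  refine ⟨main, ?_⟩
  have pw : ∀ j : ℕ, ∀ v, π'.SameCycle v ((π ^ j) v) := by
    intro j v
    induction j with
    | zero => exact .refl _ _
    | succ j ih => rw [pow_succ', Equiv.Perm.mul_apply]; exact ih.trans (step _)
  intro u v h
  obtain ⟨i, rfl⟩ := h.exists_nat_pow_eq
  exact pw i u

theorem merge (h : IsClustering S comp π) {a b : V} (ha : a ∉ S) (hb : b ∉ S)
    (hab : comp a ≠ comp b) :
    IsClustering S (fun v => if comp v = comp b then comp a else comp v) (π * Equiv.swap a b) := by
  have hnc : ¬ π.SameCycle a b := by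
    intro hsc
    obtain ⟨i, hi⟩ := hsc.exists_nat_pow_eq
    apply hab
    have pw : ∀ j : ℕ, ∀ v, comp ((π ^ j) v) = comp v := by
      intro j v
      induction j with
      | zero => rfl
      | succ j ih => rw [pow_succ', Equiv.Perm.mul_apply, h.comp_perm, ih]
    rw [← hi]; exact (pw i a).symm
  obtain ⟨hs, hm⟩ := sameCycle_mul_swap hnc
  refine ⟨fun v => ?_, fun v => ?_, fun u v huv => ?_, fun s hs => ?_, fun s hs v hv => ?_⟩
  · by_cases h1 : comp v = comp b <;> simp [h1, h.comp_comp, hab]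
  · by_cases h1 : v = a
    · simp [h1, h.comp_perm]
    · by_cases h2 : v = b
      · simp [h2, h.comp_perm]
      · simp [Equiv.swap_apply_of_ne_of_ne h1 h2, h.comp_perm]
  · by_cases h1 : comp u = comp b <;> by_cases h2 : comp v = comp b <;> simp only [h1, h2, if_true, if_false] at huv
    · exact hm _ _ (h.sameCycle _ _ (h1.trans h2.symm))
    · exact ((hm _ _ (h.sameCycle _ _ h1)).trans hs.symm).trans (hm _ _ (h.sameCycle _ _ huv))
    · exact ((hm _ _ (h.sameCycle _ _ huv)).trans hs).trans (hm _ _ (h.sameCycle _ _ h2)).symm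
    · exact hm _ _ (h.sameCycle _ _ huv)
  · have : comp s ≠ comp b := fun hc => h.comp_notMem hb (by rw [← hc, h.comp_S s hs]; exact hs)
    rw [if_neg this, h.comp_S s hs]
  · by_cases h1 : comp v = comp b
    · simp only [h1, if_true] at hv
      exact absurd hs (hv ▸ h.comp_notMem ha)
    · simp only [h1, if_false] at hv
      exact h.eq_of_comp_eq s hs v hv

end IsClustering

/-- The clustering `(comp', π')` results from `(comp, π)` by merging along a cheapest edge. -/
def IsMerge (G : Instance) (S : Finset (Fin G.n)) (comp : Fin G.n → Fin G.n)
    (π : Equiv.Perm (Fin G.n)) (comp' : Fin G.n → Fin G.n) (π' : Equiv.Perm (Fin G.n)) : Prop :=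
  ∃ a b, a ∉ S ∧ b ∉ S ∧ comp a ≠ comp b ∧
    (∀ a' b', a' ∉ S → b' ∉ S → comp a' ≠ comp b' → G.w a b ≤ G.w a' b') ∧
    comp' = (fun v => if comp v = comp b then comp a else comp v) ∧ π' = π * Equiv.swap a b

section Merge

variable {G : Instance} {S : Finset (Fin G.n)} {comp comp' : Fin G.n → Fin G.n}
  {π π' : Equiv.Perm (Fin G.n)}

theorem IsMerge.isClustering (h : IsMerge G S comp π comp' π') (hc : IsClustering S comp π) :
    IsClustering S comp' π' := by
  obtain ⟨a, b, ha, hb, hab, -, rfl, rfl⟩ := h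
  exact hc.merge ha hb hab

theorem IsMerge.card_image (h : IsMerge G S comp π comp' π') :
    (Sᶜ.image comp').card + 1 = (Sᶜ.image comp).card := by
  obtain ⟨a, b, ha, hb, hab, -, rfl, rfl⟩ := h
  have : Sᶜ.image (fun v => if comp v = comp b then comp a else comp v) =
      (Sᶜ.image comp).erase (comp b) := by
    ext u
    simp only [Finset.mem_image, Finset.mem_compl, Finset.mem_erase]
    constructor
    · rintro ⟨v, hv, rfl⟩
      by_cases h1 : comp v = comp b
      · simp only [h1, if_true]; exact ⟨hab, a, ha, rfl⟩
      · simp only [h1, if_false]; exact ⟨h1, v, hv, rfl⟩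
    · rintro ⟨hu, v, hv, rfl⟩
      exact ⟨v, hv, by simp [hu]⟩
  rw [this]
  exact Finset.card_erase_add_one (Finset.mem_image_of_mem _ (by simpa using hb))

/-- Only the edges leaving `a` and `b` change: `a` now goes to `π b` through `b`, and `b` to `π a`
through `a`. Both detours use the edge `ab`, and all four vertices are outside `S`. Any edge between
clusters bounds the weight of `ab`, as `ab` is a cheapest one. -/
theorem IsMerge.cost_le (h : IsMerge G S comp π comp' π') (hc : IsClustering S comp π)
    (hS : G.IsViolatingSet S) {c : ℝ}
    (hle : ∃ a b, a ∉ S ∧ b ∉ S ∧ comp a ≠ comp b ∧ G.w a b ≤ c) :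
    ∑ v, G.w v (π' v) ≤ ∑ v, G.w v (π v) + 2 * c := by
  obtain ⟨a, b, ha, hb, hab, hmin, rfl, rfl⟩ := h
  obtain ⟨a', b', ha', hb', hab', hle⟩ := hle
  have hne : a ≠ b := fun h => hab (h ▸ rfl)
  have hwc := (hmin a' b' ha' hb' hab').trans hle
  have hsplit : ∀ f : Fin G.n → ℝ, ∑ v, f v = f a + f b + ∑ v ∈ (Finset.univ.erase a).erase b, f v := by
    intro f
    rw [← Finset.add_sum_erase _ f (Finset.mem_univ a),
      ← Finset.add_sum_erase _ f (Finset.mem_erase.2 ⟨hne.symm, Finset.mem_univ b⟩)]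
    ring
  rw [hsplit, hsplit (fun v => G.w v (π v))]
  have hrest : ∑ v ∈ (Finset.univ.erase a).erase b, G.w v ((π * Equiv.swap a b) v) =
      ∑ v ∈ (Finset.univ.erase a).erase b, G.w v (π v) := by
    refine Finset.sum_congr rfl fun v hv => ?_
    simp only [Finset.mem_erase] at hv
    simp [Equiv.swap_apply_of_ne_of_ne hv.2.1 hv.1]
  rw [hrest]
  have hπa := hc.perm_notMem ha
  have hπb := hc.perm_notMem hb
  have h1 := hS.triangle ha hπb hb
  have h2 := hS.triangle hb hπa ha
  have h3 := G.w_symm a b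
  simp only [Equiv.Perm.mul_apply, Equiv.swap_apply_left, Equiv.swap_apply_right]
  linarith

/-- Many edges of a tour join different clusters. -/
theorem card_image_le_crossing {τ : Equiv.Perm (Fin G.n)} {idx : Fin G.n → ℕ}
    (hidx : ∀ v, τ v ∈ S ∨ idx v < idx (τ v)) :
    (Sᶜ.image comp).card ≤ S.card +
      (Finset.univ.filter fun v => v ∉ S ∧ τ v ∉ S ∧ comp v ≠ comp (τ v)).card := by
  set X := Finset.univ.filter fun v => v ∉ S ∧ τ v ∉ S ∧ comp v ≠ comp (τ v) with hX
  -- The vertex of a cluster that is last with respect to `idx` is left by the tour into `S` or into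
  -- another cluster, so every cluster has a vertex in this union.
  have hsub : Sᶜ.image comp ⊆ (S.image τ.symm ∪ X).image comp := by
    intro c hc
    have hne : (Sᶜ.filter fun v => comp v = c).Nonempty := by
      obtain ⟨v, hv, rfl⟩ := Finset.mem_image.1 hc
      exact ⟨v, by simpa using hv⟩
    obtain ⟨v, hv, hmax⟩ := Finset.exists_max_image _ idx hne
    simp only [Finset.mem_filter, Finset.mem_compl] at hv hmax
    refine Finset.mem_image.2 ⟨v, ?_, hv.2⟩
    rcases hidx v with h | h
    · exact Finset.mem_union_left _ (Finset.mem_image.2 ⟨τ v, h, by simp⟩)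
    · by_cases hs : τ v ∈ S
      · exact Finset.mem_union_left _ (Finset.mem_image.2 ⟨τ v, hs, by simp⟩)
      · refine Finset.mem_union_right _ ?_
        simp only [hX, Finset.mem_filter, Finset.mem_univ, true_and]
        refine ⟨hv.1, hs, fun he => ?_⟩
        exact absurd (hmax _ ⟨hs, he.symm.trans hv.2⟩) (by omega)
  calc _ ≤ _ := Finset.card_le_card hsub
    _ ≤ (S.image τ.symm ∪ X).card := Finset.card_image_le
    _ ≤ (S.image τ.symm).card + X.card := Finset.card_union_le _ _
    _ ≤ S.card + X.card := Nat.add_le_add_right Finset.card_image_le _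

theorem isClustering_of_merges {M : ℕ} {comp : ℕ → Fin G.n → Fin G.n}
    {π : ℕ → Equiv.Perm (Fin G.n)} (h0 : comp 0 = id) (h0' : π 0 = 1)
    (hm : ∀ j < M, IsMerge G S (comp j) (π j) (comp (j + 1)) (π (j + 1))) :
    IsClustering S (comp M) (π M) ∧ (Sᶜ.image (comp M)).card + M + S.card = G.n := by
  induction M with
  | zero =>
    rw [h0, h0']
    refine ⟨.init S, ?_⟩
    rw [Finset.image_id (s := Sᶜ), Finset.card_compl, Fintype.card_fin]
    have := S.card_le_univ
    rw [Fintype.card_fin] at this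
    omega
  | succ j ih =>
    obtain ⟨h1, h2⟩ := ih fun i hi => hm i (by omega)
    have h3 := (hm j (by omega)).card_image
    exact ⟨(hm j (by omega)).isClustering h1, by omega⟩

/-- Merging down to `|S|` clusters costs at most twice the weight of any tour. -/
theorem cost_of_merges {M : ℕ} {comp : ℕ → Fin G.n → Fin G.n} {π : ℕ → Equiv.Perm (Fin G.n)}
    (hS : G.IsViolatingSet S) (h0 : comp 0 = id) (h0' : π 0 = 1)
    (hM : M = 0 ∨ M + 2 * S.card ≤ G.n)
    (hm : ∀ j < M, IsMerge G S (comp j) (π j) (comp (j + 1)) (π (j + 1)))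
    {τ : Equiv.Perm (Fin G.n)} {idx : Fin G.n → ℕ} (hidx : ∀ v, τ v ∈ S ∨ idx v < idx (τ v)) :
    ∑ v, G.w v (π M v) ≤ 2 * ∑ v, G.w v (τ v) := by
  have hc : ∀ j ≤ M, IsClustering S (comp j) (π j) ∧
      (Sᶜ.image (comp j)).card + j + S.card = G.n :=
    fun j hj => isClustering_of_merges h0 h0' fun i hi => hm i (by omega)
  set X := fun j => Finset.univ.filter fun v => v ∉ S ∧ τ v ∉ S ∧ comp j v ≠ comp j (τ v) with hX
  -- After `j` merges, `G.n - |S| - j` clusters are left outside `S`, and at most `|S|` of them fail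
  -- to supply a crossing edge.
  have hXcard : ∀ j ≤ M, M - j ≤ (X j).card := by
    intro j hj
    have h1 := card_image_le_crossing (S := S) (comp := comp j) (τ := τ) hidx
    have h2 := (hc j hj).2
    have h3 : (X j).card = (Finset.univ.filter fun v => v ∉ S ∧ τ v ∉ S ∧ comp j v ≠ comp j (τ v)).card := rfl
    rcases hM with h | h <;> omega
  have hXsub : ∀ j < M, X (j + 1) ⊆ X j := by
    intro j hj v hv
    simp only [hX, Finset.mem_filter, Finset.mem_univ, true_and] at hv ⊢
    refine ⟨hv.1, hv.2.1, fun he => hv.2.2 ?_⟩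
    obtain ⟨a, b, -, -, -, -, h, -⟩ := hm j hj
    simp only [h, he]
  -- The merges are charged to different tour edges, from the last merge to the first. Edges that
  -- cross later clusters also cross earlier ones, so the `d` edges already charged are among the at
  -- least `d + 1` edges crossing now, and one of these is still free.
  have key : ∀ d ≤ M, ∃ Y ⊆ X (M - d), Y.card = d ∧
      ∑ v, G.w v (π M v) ≤ ∑ v, G.w v (π (M - d) v) + 2 * ∑ v ∈ Y, G.w v (τ v) := by
    intro d
    induction d with
    | zero => intro _; exact ⟨∅, by simp, by simp, by simp⟩
    | succ d ih =>
      intro hd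
      obtain ⟨Y, hY, hYc, hle⟩ := ih (by omega)
      have e : M - d = M - (d + 1) + 1 := by omega
      set j := M - (d + 1) with hj
      rw [e] at hY hle
      obtain ⟨v, hv, hvY⟩ : ∃ v ∈ X j, v ∉ Y := by
        have := hXcard j (by omega)
        exact Finset.exists_mem_notMem_of_card_lt_card (by omega)
      refine ⟨insert v Y, ?_, by simp [hvY, hYc], ?_⟩
      · intro u hu
        rcases Finset.mem_insert.1 hu with rfl | hu
        · exact hv
        · exact hXsub j (by omega) (hY hu)
      · have hv' := hv
        simp only [hX, Finset.mem_filter, Finset.mem_univ, true_and] at hv'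
        have := (hm j (by omega)).cost_le (hc j (by omega)).1 hS
          ⟨v, τ v, hv'.1, hv'.2.1, hv'.2.2, le_rfl⟩
        rw [Finset.sum_insert hvY]
        linarith
  obtain ⟨Y, -, -, hle⟩ := key M le_rfl
  rw [Nat.sub_self, h0'] at hle
  have h1 : ∑ v, G.w v ((1 : Equiv.Perm (Fin G.n)) v) = 0 :=
    Finset.sum_eq_zero fun v _ => G.w_self v
  have h2 : ∑ v ∈ Y, G.w v (τ v) ≤ ∑ v, G.w v (τ v) :=
    Finset.sum_le_sum_of_subset_of_nonneg (Finset.subset_univ _) fun _ _ _ => G.w_nonneg _ _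
  linarith

end Merge
/-! ### Tours and skeletons of tours -/

/-- The vertex after `v` on a tour. -/
def tourSucc {n : ℕ} (T : Equiv.Perm (Fin n)) : Equiv.Perm (Fin n) :=
  (T.symm.trans (finRotate n)).trans T

theorem Instance.weight_eq_sum (G : Instance) (T : G.Tour) :
    G.weight T = ∑ v, G.w v (tourSucc T v) := by
  refine Fintype.sum_equiv T _ _ fun i => ?_
  simp [tourSucc]

open Fin.NatCast Fin.CommRing in
-- Positions form a cyclic group, and the index of `v` is the difference of the positions of `v` and
-- `z`. Only the edge returning to `z` does not increase it.
theorem exists_tour_index {n : ℕ} (T : Equiv.Perm (Fin n)) (z : Fin n) :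
    ∃ idx : Fin n → ℕ, (∀ v, idx v < n) ∧ (∀ v, (tourSucc T)^[idx v] z = v) ∧
      (∀ i < n, idx ((tourSucc T)^[i] z) = i) ∧ (tourSucc T)^[n] z = z ∧
      ∀ v, tourSucc T v = z ∨ idx v < idx (tourSucc T v) := by
  obtain ⟨m, rfl⟩ : ∃ m, n = m + 1 := ⟨n - 1, by have := z.pos; omega⟩
  have key : ∀ i : ℕ, (tourSucc T)^[i] z = T (T.symm z + (i : Fin (m + 1))) := by
    intro i
    induction i with
    | zero => simp
    | succ i ih =>
      rw [Function.iterate_succ_apply', ih]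
      simp [tourSucc, add_assoc]
  have h2 : ∀ v, (tourSucc T)^[(T.symm v - T.symm z : Fin (m + 1)).val] z = v := by
    intro v; rw [key]; simp
  have h3 : ∀ i < m + 1, (T.symm ((tourSucc T)^[i] z) - T.symm z : Fin (m + 1)).val = i := by
    intro i hi
    rw [key]
    simp [Nat.mod_eq_of_lt hi]
  have h4 : (tourSucc T)^[m + 1] z = z := by
    rw [key]; simp
  refine ⟨fun v => (T.symm v - T.symm z : Fin (m + 1)).val, fun v => Fin.isLt _, h2, h3, h4, ?_⟩
  intro v
  have hv := h2 v
  have hlt := (T.symm v - T.symm z : Fin (m + 1)).isLt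
  set i := (T.symm v - T.symm z : Fin (m + 1)).val with hi
  have hs : tourSucc T v = (tourSucc T)^[i + 1] z := by rw [Function.iterate_succ_apply', hv]
  rcases Nat.lt_or_ge (i + 1) (m + 1) with h | h
  · right
    have := h3 (i + 1) h
    rw [← hs] at this
    simp only
    rw [this]
    omega
  · left
    rw [hs, show i + 1 = m + 1 by omega, h4]

section PathCost

variable {V : Type*} (w : V → V → ℝ)

/-- The weight of a path. -/
def pathCost : List V → ℝ
  | a :: b :: l => w a b + pathCost (b :: l)
  | _ => 0

theorem pathCost_eq_sum (d : V) (a : V) (l : List V) :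
    pathCost w (a :: l) =
      ∑ j ∈ Finset.range l.length, w ((a :: l).getD j d) ((a :: l).getD (j + 1) d) := by
  induction l generalizing a with
  | nil => simp [pathCost]
  | cons b l ih =>
    rw [pathCost, ih, List.length_cons, Finset.sum_range_succ']
    simp only [List.getD_cons_succ, List.getD_cons_zero]
    rw [add_comm]

theorem isChain_getD {R : V → V → Prop} (d : V) {l : List V} (h : l.IsChain R) {j : ℕ}
    (hj : j + 1 < l.length) : R (l.getD j d) (l.getD (j + 1) d) := by
  have := List.isChain_iff_getElem.1 h j hj
  rwa [List.getD_eq_getElem _ _ hj, List.getD_eq_getElem _ _ (by omega)]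

end PathCost

section Skeleton

variable {G : Instance} {S : Finset (Fin G.n)}

/-- Shortcutting a tour to a set of vertices that contains `S` and the neighbours of `S`. -/
theorem shortcut {τ : Fin G.n → Fin G.n} {X : Finset (Fin G.n)} (hS : G.IsViolatingSet S)
    (hSX : S ⊆ X) (h1 : ∀ v, v ∉ X → τ v ∉ S) (h2 : ∀ v, τ v ∉ X → v ∉ S) (l : List (Fin G.n)) :
    ∀ p y, (y = p ∨ (y ∉ X ∧ p ∉ S)) → (y :: l).IsChain (fun a b => b = τ a) →
      pathCost G.w (p :: l.filter (· ∈ X)) ≤ G.w p y + pathCost G.w (y :: l) ∧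
      (p :: l.filter (· ∈ X)).IsChain (fun a b => a ∉ S → τ a ∉ S → b ∉ S) := by
  -- Here `p` is the last vertex kept and `y` the current vertex of the tour. If `y` has been
  -- dropped, then `y` and `p` are both outside `S`, which is what the triangle inequality needs to
  -- bypass `y`.
  induction l with
  | nil => intro p y _ _; simpa [pathCost] using G.w_nonneg p y
  | cons z l ih =>
    intro p y hp hc
    obtain ⟨rfl, hc⟩ := List.isChain_cons_cons.1 hc
    by_cases hz : τ y ∈ X
    · obtain ⟨ih1, ih2⟩ := ih _ _ (.inl rfl) hc
      rw [List.filter_cons_of_pos (by simpa using hz)]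
      constructor
      · simp only [pathCost]
        have h3 : G.w p (τ y) ≤ G.w p y + G.w y (τ y) := by
          rcases hp with rfl | ⟨hy, hp⟩
          · rw [G.w_self]; linarith
          · exact hS.triangle hp (h1 y hy) (fun h => hy (hSX h))
        rw [G.w_self] at ih1
        linarith
      · refine List.isChain_cons_cons.2 ⟨fun ha hb => ?_, ih2⟩
        rcases hp with rfl | ⟨hy, hp⟩
        · exact hb
        · exact h1 y hy
    · have hy := h2 y hz
      have hpS : p ∉ S := by
        rcases hp with rfl | ⟨-, hp⟩
        · exact hy
        · exact hp
      obtain ⟨ih1, ih2⟩ := ih p (τ y) (.inr ⟨hz, hpS⟩) hc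
      rw [List.filter_cons_of_neg (by simpa using hz)]
      refine ⟨?_, ih2⟩
      have h3 := hS.triangle hpS (fun h => hz (hSX h)) hy
      simp only [pathCost]
      linarith

theorem isChain_iterate {V : Type*} (f : V → V) (a : V) (n : ℕ) :
    (List.iterate f a n).IsChain (fun x y => y = f x) := by
  induction n generalizing a with
  | zero => simp
  | succ n ih =>
    cases n with
    | zero => simp
    | succ n => exact List.isChain_cons_cons.2 ⟨rfl, ih (f a)⟩

/-- Every tour has a small skeleton which contains `S`, and which contains, for each cluster not
contained in it, an edge of the metric part starting in the cluster. -/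
theorem exists_skeleton (hS : G.IsViolatingSet S) {z : Fin G.n} (hz : z ∈ S) (T : G.Tour)
    (comp : Fin G.n → Fin G.n)
    (hcard : (Sᶜ.image comp).card ≤ S.card) :
    ∃ ℓ ≤ 4 * S.card, ∃ x : ℕ → Fin G.n, 0 < ℓ ∧ x 0 = z ∧ x ℓ = z ∧ Set.InjOn x (Set.Iio ℓ) ∧
      ∑ j ∈ Finset.range ℓ, G.w (x j) (x (j + 1)) ≤ G.weight T ∧
      ∀ v, (∀ u, comp u = comp v → ∃ j < ℓ, x j = u) ∨
        ∃ j < ℓ, comp (x j) = comp v ∧ x j ∉ S ∧ x (j + 1) ∉ S := by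
  classical
  set τ := tourSucc T with hτ
  obtain ⟨idx, hlt, hi1, hi2, hn, -⟩ := exists_tour_index T z
  rw [← hτ] at hi1 hi2 hn
  -- A root is fixed for each cluster in which some tour edge of the metric part starts. For other
  -- clusters the value is irrelevant.
  have hroot : ∀ c, ∃ r, (∃ v, comp v = c ∧ v ∉ S ∧ τ v ∉ S) → comp r = c ∧ r ∉ S ∧ τ r ∉ S := by
    intro c
    by_cases h : ∃ v, comp v = c ∧ v ∉ S ∧ τ v ∉ S
    · obtain ⟨r, hr⟩ := h; exact ⟨r, fun _ => hr⟩
    · exact ⟨z, fun h' => absurd h' h⟩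
  choose r hr using hroot
  -- Four sets of at most `|S|` vertices each. The tour neighbours of `S` are kept so that a dropped
  -- vertex has both its neighbours in the metric part.
  set X : Finset (Fin G.n) := S ∪ S.image τ ∪ S.image τ.symm ∪ (Sᶜ.image comp).image r with hX
  have hSX : S ⊆ X := fun v hv => by simp [hX, hv]
  have hX1 : ∀ v, v ∉ X → τ v ∉ S := fun v hv h => hv (by
    simp only [hX, Finset.mem_union, Finset.mem_image]
    exact .inl (.inr ⟨τ v, h, by simp⟩))
  have hX2 : ∀ v, τ v ∉ X → v ∉ S := fun v hv h => hv (by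
    simp only [hX, Finset.mem_union, Finset.mem_image]
    exact .inl (.inl (.inr ⟨v, h, rfl⟩)))
  have hXc : X.card ≤ 4 * S.card := by
    have e1 := Finset.card_union_le (S ∪ S.image τ ∪ S.image τ.symm) ((Sᶜ.image comp).image r)
    have e2 := Finset.card_union_le (S ∪ S.image τ) (S.image τ.symm)
    have e3 := Finset.card_union_le S (S.image τ)
    have e4 : (S.image τ).card ≤ S.card := Finset.card_image_le
    have e5 : (S.image τ.symm).card ≤ S.card := Finset.card_image_le
    have e6 : ((Sᶜ.image comp).image r).card ≤ (Sᶜ.image comp).card := Finset.card_image_le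
    rw [← hX] at e1
    omega
  set L := List.iterate τ z G.n with hL
  have hLget : ∀ i (h : i < L.length), L[i] = τ^[i] z := by
    intro i h; simp [hL]
  have hLlen : L.length = G.n := by simp [hL]
  have hLnd : L.Nodup := by
    rw [List.nodup_iff_injective_getElem]
    intro i j hij
    have hi := hi2 i (i.2.trans_eq hLlen)
    have hj := hi2 j (j.2.trans_eq hLlen)
    simp only [hLget] at hij
    rw [hij] at hi
    exact Fin.ext (hi.symm.trans hj)
  have hLmem : ∀ v, v ∈ L := by
    intro v
    rw [List.mem_iff_getElem]
    exact ⟨idx v, hLlen.symm ▸ hlt v, by rw [hLget, hi1]⟩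
  have hL1 : List.iterate τ z (G.n + 1) = L ++ [z] := by
    rw [List.iterate_add, hn]; rfl
  have hL2 : List.iterate τ z (G.n + 1) = z :: List.iterate τ (τ z) G.n := rfl
  set F := L.filter (· ∈ X) with hF
  have hFz : (z :: (List.iterate τ (τ z) G.n).filter (· ∈ X)) = F ++ [z] := by
    have hzX : z ∈ X := hSX hz
    have : (List.iterate τ z (G.n + 1)).filter (· ∈ X) = F ++ [z] := by
      rw [hL1, List.filter_append, hF]; simp [hzX]
    rw [← this, hL2, List.filter_cons_of_pos (by simpa using hzX)]
  obtain ⟨hcost, hchain⟩ := shortcut hS hSX hX1 hX2 (List.iterate τ (τ z) G.n) z z (.inl rfl)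
    (by rw [← hL2]; exact isChain_iterate _ _ _)
  have hFnd : F.Nodup := hLnd.filter _
  have hFmem : ∀ v, v ∈ F ↔ v ∈ X := fun v => by simp [hF, hLmem]
  have hFlen : F.length = X.card := by
    rw [← List.toFinset_card_of_nodup hFnd]; congr 1; ext v; simp [hFmem]
  have hpos : 0 < F.length := List.length_pos_of_mem ((hFmem z).2 (hSX hz))
  have hgetD : ∀ j, (F ++ [z]).getD j z = F.getD j z := by
    intro j
    rcases Nat.lt_or_ge j F.length with h | h
    · rw [List.getD_append _ _ _ _ h]
    · rw [List.getD_append_right _ _ _ _ h, List.getD_eq_default F z h]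
      cases j - F.length <;> simp
  have hmemj : ∀ v ∈ X, ∃ j < F.length, F.getD j z = v := by
    intro v hv
    obtain ⟨j, hj, rfl⟩ := List.mem_iff_getElem.1 ((hFmem v).2 hv)
    exact ⟨j, hj, List.getD_eq_getElem _ _ hj⟩
  -- The default value `z` of `getD` closes the skeleton: beyond its last vertex comes `z` again.
  refine ⟨F.length, hFlen ▸ hXc, fun j => F.getD j z, hpos, ?_, ?_, ?_, ?_, ?_⟩
  · simp only
    rw [← hgetD, ← hFz]; rfl
  · exact List.getD_eq_default _ _ le_rfl
  · intro i hi j hj hij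
    simp only [Set.mem_Iio] at hi hj
    simp only [List.getD_eq_getElem _ _ hi, List.getD_eq_getElem _ _ hj] at hij
    exact hFnd.getElem_inj_iff.1 hij
  · have e1 : ∑ j ∈ Finset.range F.length, G.w (F.getD j z) (F.getD (j + 1) z) =
        pathCost G.w (z :: (List.iterate τ (τ z) G.n).filter (· ∈ X)) := by
      rw [pathCost_eq_sum _ z, hFz]
      have : ((List.iterate τ (τ z) G.n).filter (· ∈ X)).length = F.length := by
        have := congrArg List.length hFz
        simpa using this
      rw [this]
      exact Finset.sum_congr rfl fun j _ => by rw [hgetD, hgetD]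
    have e2 : pathCost G.w (z :: List.iterate τ (τ z) G.n) = G.weight T := by
      rw [pathCost_eq_sum _ z, List.length_iterate, ← hL2, G.weight_eq_sum]
      refine Finset.sum_bij' (fun i _ => τ^[i] z) (fun v _ => idx v) ?_ ?_ ?_ ?_ ?_
      · intros; exact Finset.mem_univ _
      · intro v _; exact Finset.mem_range.2 (hlt v)
      · intro i hi; exact hi2 i (Finset.mem_range.1 hi)
      · intro v _; exact hi1 v
      · intro i hi
        have hi := Finset.mem_range.1 hi
        rw [List.getD_eq_getElem _ _ (by rw [List.length_iterate]; omega), List.getD_eq_getElem _ _ (by rw [List.length_iterate]; omega)]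
        rw [List.getElem_iterate, List.getElem_iterate, Function.iterate_succ_apply']
    simp only
    rw [e1, ← e2]
    rw [G.w_self, zero_add] at hcost
    exact hcost
  · intro v
    by_cases h : ∃ u, comp u = comp v ∧ u ∉ S ∧ τ u ∉ S
    · right
      obtain ⟨u, hu, huS, hτu⟩ := h
      obtain ⟨hr1, hr2, hr3⟩ := hr (comp v) ⟨u, hu, huS, hτu⟩
      obtain ⟨j, hj, hjr⟩ := hmemj (r (comp v)) (by
        simp only [hX, Finset.mem_union]
        exact .inr (Finset.mem_image_of_mem _ (Finset.mem_image.2 ⟨u, by simpa using huS, hu⟩)))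
      refine ⟨j, hj, ?_, ?_, ?_⟩
      · simp only [hjr, hr1]
      · simp only [hjr]; exact hr2
      -- The root and its successor on the tour are outside `S`; by `shortcut`, so is its successor
      -- on the skeleton.
      · have := isChain_getD z hchain (j := j) (by rw [hFz]; simp [hj])
        rw [hFz, hgetD, hgetD, hjr] at this
        exact this hr2 hr3
    -- Every vertex of such a cluster is in `S` or is followed by a vertex of `S` on the tour, and
    -- in both cases it was kept.
    · left
      intro u hu
      apply hmemj
      push Not at h
      by_cases huS : u ∈ S
      · exact hSX huS
      · by_contra hc
        exact hX1 u hc (h u hu huS)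

end Skeleton

/-! ### Realizing a skeleton, and inserting the remaining vertices -/

section Realization

variable {G : Instance} {S : Finset (Fin G.n)}

/-- A cheapest path through layers of vertices is at most as long as any path through them. -/
theorem layered_path {V : Type*} {w : V → V → ℝ} {x : ℕ → V} {ℓ : ℕ} {z : V}
    {comp : V → V} {pos : V → ℕ} {f : V → V} {D : V → ℝ} (hℓ : 0 < ℓ) (hx0 : x 0 = z) (hxℓ : x ℓ = z)
    (hpx : ∀ j < ℓ, pos (x j) = ℓ - j) (hpc : ∀ v, ∀ j < ℓ, pos v = ℓ - j → comp v = comp (x j))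
    (h1 : ∀ v, pos v = 1 → f v = z ∧ D v = w v z)
    (h2 : ∀ v p, 1 ≤ p → p < ℓ → pos v = p + 1 → pos (f v) = p ∧ D v = w v (f v) + D (f v) ∧
      ∀ u, pos u = p → D v ≤ w v u + D u) :
    f^[ℓ] z = z ∧ Set.InjOn (fun j => f^[j] z) (Set.Iio ℓ) ∧
      (∀ j ≤ ℓ, comp (f^[j] z) = comp (x j)) ∧
      ∑ j ∈ Finset.range ℓ, w (f^[j] z) (f^[j + 1] z) ≤ ∑ j ∈ Finset.range ℓ, w (x j) (x (j + 1)) := by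
  have hp : ∀ j < ℓ, pos (f^[j] z) = ℓ - j := by
    intro j
    induction j with
    | zero => intro hj; simpa [hx0] using hpx 0 hj
    | succ j ih =>
      intro hj
      rw [Function.iterate_succ_apply']
      exact (h2 _ (ℓ - (j + 1)) (by omega) (by omega) (by rw [ih (by omega)]; omega)).1
  have hend : f^[ℓ] z = z := by
    obtain ⟨m, rfl⟩ : ∃ m, ℓ = m + 1 := ⟨ℓ - 1, by omega⟩
    rw [Function.iterate_succ_apply']
    exact (h1 _ (by rw [hp m (by omega)]; omega)).1
  refine ⟨hend, ?_, ?_, ?_⟩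
  · intro i hi j hj hij
    simp only [Set.mem_Iio] at hi hj
    have e1 := hp i hi
    have e2 := hp j hj
    simp only at hij
    rw [hij] at e1
    omega
  · intro j hj
    rcases Nat.lt_or_ge j ℓ with h | h
    · exact hpc _ j h (hp j h)
    · rw [show j = ℓ by omega, hend, hxℓ]
  -- Induction from the end of the path: `D` is the exact remaining cost along `f`, and a lower
  -- bound for the remaining cost along `x`.
  · have key : ∀ d, ∀ j, j + d + 1 = ℓ →
        D (f^[j] z) = ∑ i ∈ Finset.range (d + 1), w (f^[j + i] z) (f^[j + i + 1] z) ∧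
        D (x j) ≤ ∑ i ∈ Finset.range (d + 1), w (x (j + i)) (x (j + i + 1)) := by
      intro d
      induction d with
      | zero =>
        intro j hj
        have e1 := (h1 _ ((hp j (by omega)).trans (by omega))).2
        have e2 := (h1 _ ((hpx j (by omega)).trans (by omega))).2
        have e3 : x (j + 1) = z := by rw [show j + 1 = ℓ by omega, hxℓ]
        have e4 : f^[j + 1] z = z := by rw [show j + 1 = ℓ by omega, hend]
        simp only [zero_add, Finset.sum_range_one, add_zero]
        rw [e1, e2, e3, e4]
        exact ⟨rfl, le_rfl⟩
      | succ d ih =>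
        intro j hj
        obtain ⟨ih1, ih2⟩ := ih (j + 1) (by omega)
        have e1 := (h2 _ (d + 1) (by omega) (by omega) ((hp j (by omega)).trans (by omega))).2.1
        have e2 := (h2 _ (d + 1) (by omega) (by omega) ((hpx j (by omega)).trans (by omega))).2.2
          (x (j + 1)) ((hpx (j + 1) (by omega)).trans (by omega))
        have r : ∀ g : ℕ → ℝ, ∑ i ∈ Finset.range (d + 1), g (j + (i + 1)) =
            ∑ i ∈ Finset.range (d + 1), g (j + 1 + i) := fun g =>
          Finset.sum_congr rfl fun i _ => by rw [add_assoc j, add_comm 1]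
        rw [Finset.sum_range_succ' _ (d + 1), Finset.sum_range_succ' _ (d + 1),
          r fun m => w (f^[m] z) (f^[m + 1] z), r fun m => w (x m) (x (m + 1))]
        simp only [add_zero]
        rw [← Function.iterate_succ_apply' f, ih1] at e1
        constructor
        · rw [e1, add_comm]
        · linarith
    obtain ⟨k1, k2⟩ := key (ℓ - 1) 0 (by omega)
    simp only [zero_add, show ℓ - 1 + 1 = ℓ by omega, Function.iterate_zero_apply] at k1 k2
    rw [← k1, ← hx0]
    exact k2

/-! ### Assembling a vertex sequence from a path and the cycles of a permutation -/

section Assemble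

variable {V : Type*} [DecidableEq V]

/-- Append a vertex to a sequence (stored in reverse order) unless it is there already. -/
def emit (l : List V) (y : V) : List V := if y ∈ l then l else y :: l

/-- Follow `π` from `r` for `i` steps and append the vertices outside `mk`. -/
def walk (π : V → V) (mk : Finset V) (l : List V) (r : V) : ℕ → List V
  | 0 => l
  | i + 1 => if π^[i + 1] r ∈ mk then walk π mk l r i else emit (walk π mk l r i) (π^[i + 1] r)

/-- Follow `f` from `z` for `i` steps, and insert the cycles of `π` on the way. -/
def assemble (S mk : Finset V) (π f : V → V) (z : V) (n : ℕ) : ℕ → List V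
  | 0 => []
  | i + 1 =>
    if f^[i] z ∉ S ∧ f^[i + 1] z ∉ S then
      walk π mk (emit (assemble S mk π f z n i) (f^[i] z)) (f^[i] z) n
    else emit (assemble S mk π f z n i) (f^[i] z)

theorem emit_of_mem {l : List V} {y : V} (h : y ∈ l) : emit l y = l := if_pos h

theorem mem_emit {l : List V} {y v : V} : v ∈ emit l y ↔ v = y ∨ v ∈ l := by
  unfold emit; split
  · simpa using fun h => h ▸ ‹_›
  · exact List.mem_cons

theorem nodup_emit {l : List V} {y : V} (h : l.Nodup) : (emit l y).Nodup := by
  unfold emit; split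
  · exact h
  · exact List.nodup_cons.2 ⟨‹_›, h⟩

theorem suffix_emit (l : List V) (y : V) : l <:+ emit l y := by
  unfold emit; split
  · exact List.suffix_refl _
  · exact List.suffix_cons _ _

variable {S mk : Finset V} {π f : V → V} {z : V} {n : ℕ}

theorem nodup_walk {l : List V} (h : l.Nodup) (r : V) (i : ℕ) : (walk π mk l r i).Nodup := by
  induction i with
  | zero => exact h
  | succ i ih => unfold walk; split; exacts [ih, nodup_emit ih]

theorem suffix_walk (l : List V) (r : V) (i : ℕ) : l <:+ walk π mk l r i := by
  induction i with
  | zero => exact List.suffix_refl _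
  | succ i ih => unfold walk; split; exacts [ih, ih.trans (suffix_emit _ _)]

theorem nodup_assemble (i : ℕ) : (assemble S mk π f z n i).Nodup := by
  induction i with
  | zero => simp [assemble]
  | succ i ih => unfold assemble; split; exacts [nodup_walk (nodup_emit ih) _ _, nodup_emit ih]

/-- Sequences are stored in reverse order and only grow at the head; this says that the tour starts
at `z`. -/
theorem suffix_assemble (i : ℕ) : [z] <:+ assemble S mk π f z n (i + 1) := by
  induction i with
  | zero =>
    unfold assemble; split
    · exact suffix_walk (π := π) [z] _ _
    · exact List.suffix_refl _
  | succ i ih =>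
    unfold assemble; split
    · exact (ih.trans (suffix_emit _ _)).trans (suffix_walk _ _ _)
    · exact ih.trans (suffix_emit _ _)

theorem mem_walk {l : List V} {r v : V} {i : ℕ} : v ∈ walk π mk l r i ↔
    v ∈ l ∨ (v ∉ mk ∧ ∃ j, 1 ≤ j ∧ j ≤ i ∧ π^[j] r = v) := by
  induction i with
  | zero => simp [walk]
  | succ i ih =>
    have e : (∃ j, 1 ≤ j ∧ j ≤ i + 1 ∧ π^[j] r = v) ↔
        (∃ j, 1 ≤ j ∧ j ≤ i ∧ π^[j] r = v) ∨ π^[i + 1] r = v := by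
      constructor
      · rintro ⟨j, h1, h2, h3⟩
        rcases Nat.lt_or_ge j (i + 1) with h | h
        · exact .inl ⟨j, h1, by omega, h3⟩
        · obtain rfl : j = i + 1 := by omega
          exact .inr h3
      · rintro (⟨j, h1, h2, h3⟩ | h)
        · exact ⟨j, h1, by omega, h3⟩
        · exact ⟨i + 1, by omega, le_rfl, h⟩
    rw [e]
    unfold walk
    split_ifs with h
    · rw [ih]
      constructor
      · rintro (h' | ⟨h1, h2⟩); exacts [.inl h', .inr ⟨h1, .inl h2⟩]
      · rintro (h' | ⟨h1, h2 | h2⟩)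
        exacts [.inl h', .inr ⟨h1, h2⟩, absurd (h2 ▸ h) h1]
    · rw [mem_emit, ih]
      constructor
      · rintro (h' | h' | ⟨h1, h2⟩)
        exacts [.inr ⟨h' ▸ h, .inr h'.symm⟩, .inl h', .inr ⟨h1, .inl h2⟩]
      · rintro (h' | ⟨h1, h2 | h2⟩)
        exacts [.inr (.inl h'), .inr (.inr ⟨h1, h2⟩), .inl h2.symm]

/-- A walk along vertices all of which have been dealt with appends nothing. -/
theorem walk_eq_of_forall_mem {l : List V} {r : V} {i k : ℕ} (hki : k ≤ i)
    (h : ∀ j, k < j → j ≤ i → π^[j] r ∈ mk ∨ π^[j] r ∈ walk π mk l r k) :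
    walk π mk l r i = walk π mk l r k := by
  induction i with
  | zero => rw [show k = 0 by omega]
  | succ i ih =>
    rcases Nat.lt_or_ge k (i + 1) with hk | hk
    · have ih := ih (by omega) (fun j h1 h2 => h j h1 (by omega))
      rw [walk, ih]
      rcases h (i + 1) hk le_rfl with h | h
      · rw [if_pos h]
      · rw [emit_of_mem h, ite_self]
    · rw [show k = i + 1 by omega]

end Assemble

/-- The weight of the list plus the distance from its head to the current position of the walk acts
as a potential. Each step raises it by at most the edge traversed, whether the new position is
appended or skipped, because head and walk stay outside `S`. -/
theorem walk_cost {π : Fin G.n → Fin G.n} {mk : Finset (Fin G.n)} (hS : G.IsViolatingSet S)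
    (hπ : ∀ v, v ∉ S → π v ∉ S) {r : Fin G.n} (hr : r ∉ S) (l : List (Fin G.n)) (i : ℕ) :
    ∃ h t, walk π mk (r :: l) r i = h :: t ∧ h ∉ S ∧
      pathCost G.w (h :: t) + G.w h (π^[i] r) ≤
        pathCost G.w (r :: l) + ∑ j ∈ Finset.range i, G.w (π^[j] r) (π (π^[j] r)) := by
  have hit : ∀ i, π^[i] r ∉ S := by
    intro i
    induction i with
    | zero => exact hr
    | succ i ih => rw [Function.iterate_succ_apply']; exact hπ _ ih
  induction i with
  | zero => exact ⟨r, l, rfl, hr, by simp [G.w_self]⟩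
  | succ i ih =>
    obtain ⟨h, t, e, hh, hc⟩ := ih
    rw [Finset.sum_range_succ]
    have ht := hS.triangle hh (hit (i + 1)) (hit i)
    rw [Function.iterate_succ_apply'] at ht
    unfold walk emit
    rw [e]
    by_cases h1 : π^[i + 1] r ∈ mk ∨ π^[i + 1] r ∈ h :: t
    · refine ⟨h, t, ?_, hh, ?_⟩
      · rcases h1 with h1 | h1
        · rw [if_pos h1]
        · rw [if_pos h1, ite_self]
      · rw [Function.iterate_succ_apply']; linarith
    · rw [not_or] at h1
      refine ⟨π^[i + 1] r, h :: t, ?_, hit _, ?_⟩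
      · rw [if_neg h1.1, if_neg h1.2]
      · rw [G.w_self, Function.iterate_succ_apply']
        simp only [pathCost]
        rw [G.w_symm _ h]
        linarith

/-- A walk around a whole cycle. -/
theorem walk_cycle {comp : Fin G.n → Fin G.n} {π : Equiv.Perm (Fin G.n)} {mk : Finset (Fin G.n)}
    (hS : G.IsViolatingSet S) (hc : IsClustering S comp π) {r : Fin G.n} (hr : r ∉ S)
    (l : List (Fin G.n)) :
    (∃ h t, walk π mk (r :: l) r G.n = h :: t ∧ h ∉ S ∧
      pathCost G.w (h :: t) + G.w h r ≤
        pathCost G.w (r :: l) + ∑ v with comp v = comp r, G.w v (π v)) ∧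
    ∀ v, comp v = comp r ↔ ∃ j, 1 ≤ j ∧ j ≤ G.n ∧ π^[j] r = v := by
  set m := Function.minimalPeriod π r with hm
  have hmem : r ∈ Function.periodicPts π :=
    Function.Injective.mem_periodicPts π.injective r
  have hmpos : 0 < m := Function.minimalPeriod_pos_of_mem_periodicPts hmem
  have hper : π^[m] r = r := Function.isPeriodicPt_minimalPeriod π r
  have hinj : Set.InjOn (fun j => π^[j] r) (Set.Iio m) := Function.iterate_injOn_Iio_minimalPeriod
  have hmn : m ≤ G.n := by
    have := Finset.card_le_card_of_injOn (s := Finset.range m) (t := (Finset.univ : Finset (Fin G.n)))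
      (fun j => π^[j] r) (fun _ _ => by simp) (fun a ha b hb => hinj (by simpa using ha) (by simpa using hb))
    simpa using this
  have hcomp : ∀ j, comp (π^[j] r) = comp r := by
    intro j
    induction j with
    | zero => rfl
    | succ j ih => rw [Function.iterate_succ_apply', hc.comp_perm, ih]
  have hcyc : ∀ v, comp v = comp r → ∃ j, 1 ≤ j ∧ j ≤ m ∧ π^[j] r = v := by
    intro v hv
    obtain ⟨j, hj⟩ := (hc.sameCycle r v hv.symm).exists_nat_pow_eq
    rw [← Equiv.Perm.iterate_eq_pow, ← Function.iterate_mod_minimalPeriod_eq] at hj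
    have hlt : j % m < m := Nat.mod_lt _ hmpos
    rcases Nat.eq_zero_or_pos (j % m) with h0 | h0
    · refine ⟨m, hmpos, le_rfl, ?_⟩
      rw [← hm, h0] at hj
      rw [hper]; exact hj
    · exact ⟨j % m, h0, hlt.le, hj⟩
  refine ⟨?_, fun v => ⟨fun hv => ?_, ?_⟩⟩
  -- The walk takes `G.n` steps, the length `m ≤ G.n` of the cycle being unknown to the program. The
  -- cost is accounted for at step `m`, where the walk is back at `r`; later steps append nothing.
  · obtain ⟨h, t, e, hh, hcost⟩ := walk_cost (mk := mk) hS (fun v => hc.perm_notMem (v := v)) hr l m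
    refine ⟨h, t, ?_, hh, ?_⟩
    · rw [← e]
      refine walk_eq_of_forall_mem hmn fun j _ _ => ?_
      by_cases hmk : π^[j] r ∈ mk
      · exact .inl hmk
      · exact .inr (mem_walk.2 (.inr ⟨hmk, hcyc _ (hcomp j)⟩))
    · rw [hper] at hcost
      refine hcost.trans (add_le_add le_rfl ?_)
      rw [← Finset.sum_image (s := Finset.range m) (g := fun j => π^[j] r)
        (f := fun v => G.w v (π v)) (fun a ha b hb => hinj (by simpa using ha) (by simpa using hb))]
      refine Finset.sum_le_sum_of_subset_of_nonneg ?_ fun _ _ _ => G.w_nonneg _ _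
      intro v hv
      obtain ⟨j, -, rfl⟩ := Finset.mem_image.1 hv
      simp [hcomp]
  · obtain ⟨j, h1, h2, h3⟩ := hcyc v hv
    exact ⟨j, h1, h2.trans hmn, h3⟩
  · rintro ⟨j, -, -, rfl⟩
    exact hcomp j

/-- Inserting the cycles of `π` into a skeleton which touches all of them. -/
theorem assemble_cost {comp : Fin G.n → Fin G.n} {π : Equiv.Perm (Fin G.n)} {mk : Finset (Fin G.n)}
    (hS : G.IsViolatingSet S) (hc : IsClustering S comp π) {f : Fin G.n → Fin G.n} {z : Fin G.n}
    {ℓ : ℕ} (hℓ : 0 < ℓ) (hinj : Set.InjOn (fun j => f^[j] z) (Set.Iio ℓ)) (hend : f^[ℓ] z = z)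
    (hmk : ∀ v, v ∈ mk ↔ ∃ j < ℓ, f^[j] z = v)
    (hcov : ∀ v, (∃ j < ℓ, f^[j] z = v) ∨
      ∃ j < ℓ, comp (f^[j] z) = comp v ∧ f^[j] z ∉ S ∧ f^[j + 1] z ∉ S) :
    ∃ h t, assemble S mk π f z G.n G.n = h :: t ∧ (h :: t).length = G.n ∧
      pathCost G.w (h :: t) + G.w h z ≤
        ∑ j ∈ Finset.range ℓ, G.w (f^[j] z) (f^[j + 1] z) + ∑ v, G.w v (π v) := by
  set A := assemble S mk π f z G.n with hA
  set y := fun j => f^[j] z with hy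
  -- The clusters whose cycles have been inserted during the first `i` steps.
  set E : ℕ → Finset (Fin G.n) := fun i =>
    ((Finset.range i).filter fun j => y j ∉ S ∧ y (j + 1) ∉ S).image fun j => comp (y j) with hE
  have hEs : ∀ i, E (i + 1) = if y i ∉ S ∧ y (i + 1) ∉ S then insert (comp (y i)) (E i) else E i := by
    intro i
    simp only [hE]
    rw [Finset.range_add_one, Finset.filter_insert]
    split_ifs
    · rw [Finset.image_insert]
    · rfl
  have aux : ∀ a b c m e : Prop,
      ((a ∨ b ∨ m ∧ e) ∨ m ∧ c) ↔ ((a ∨ b) ∨ m ∧ (c ∨ e)) := by tauto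
  have hmem : ∀ i ≤ ℓ, ∀ v, v ∈ A i ↔ (∃ j < i, y j = v) ∨ (v ∉ mk ∧ comp v ∈ E i) := by
    intro i
    induction i with
    | zero => intro _ v; simp [hA, assemble, hE]
    | succ i ih =>
      intro hi v
      have ih := ih (by omega) v
      have e : (∃ j < i + 1, y j = v) ↔ v = y i ∨ ∃ j < i, y j = v := by
        constructor
        · rintro ⟨j, h1, h2⟩
          rcases Nat.lt_or_ge j i with h | h
          · exact .inr ⟨j, h, h2⟩
          · obtain rfl : j = i := by omega
            exact .inl h2.symm
        · rintro (h | ⟨j, h1, h2⟩)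
          exacts [⟨i, by omega, h.symm⟩, ⟨j, by omega, h2⟩]
      rw [e, hEs]
      by_cases hh : y i ∉ S ∧ y (i + 1) ∉ S
      · have hw := (walk_cycle (mk := mk) hS hc hh.1 []).2 v
        rw [if_pos hh, Finset.mem_insert, hw]
        simp only [hA, assemble]
        rw [if_pos hh, mem_walk, mem_emit]
        change ((v = y i ∨ v ∈ A i) ∨ _) ↔ _
        rw [ih]
        exact aux _ _ _ _ _
      · rw [if_neg hh]
        simp only [hA, assemble]
        rw [if_neg hh, mem_emit]
        change (v = y i ∨ v ∈ A i) ↔ _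
        rw [ih, or_assoc]
  -- The distance from the head to the next skeleton vertex is included, since that vertex is the
  -- next to be appended; at the end it becomes the closing edge.
  have hcost : ∀ i < ℓ, ∃ h t, A (i + 1) = h :: t ∧ pathCost G.w (h :: t) + G.w h (y (i + 1)) ≤
      ∑ j ∈ Finset.range (i + 1), G.w (y j) (y (j + 1)) +
        ∑ v with comp v ∈ E (i + 1), G.w v (π v) := by
    have step : ∀ i, i < ℓ → ∀ l, A i = l → pathCost G.w (y i :: l) ≤
        ∑ j ∈ Finset.range i, G.w (y j) (y (j + 1)) + ∑ v with comp v ∈ E i, G.w v (π v) →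
        ∃ h t, A (i + 1) = h :: t ∧ pathCost G.w (h :: t) + G.w h (y (i + 1)) ≤
      ∑ j ∈ Finset.range (i + 1), G.w (y j) (y (j + 1)) +
        ∑ v with comp v ∈ E (i + 1), G.w v (π v) := by
      intro i hi l hl hle
      have hym : y i ∈ mk := (hmk _).2 ⟨i, hi, rfl⟩
      have hnot : y i ∉ l := by
        rw [← hl, hmem i hi.le]
        rintro (⟨j, hj, e⟩ | ⟨h, -⟩)
        · have := hinj (by simp; omega) (by simpa using hi) e
          omega
        · exact h hym
      have hem : emit (A i) (y i) = y i :: l := by rw [hl]; exact if_neg hnot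
      have hAs : A (i + 1) = if y i ∉ S ∧ y (i + 1) ∉ S then
          walk π mk (emit (A i) (y i)) (y i) G.n else emit (A i) (y i) := rfl
      rw [hAs, hem, hEs, Finset.sum_range_succ]
      by_cases hh : y i ∉ S ∧ y (i + 1) ∉ S
      · rw [if_pos hh, if_pos hh]
        by_cases hE' : comp (y i) ∈ E i
        -- The cycle has been inserted before: all its vertices are marked or listed, so it is
        -- neither appended nor paid for again.
        · refine ⟨y i, l, ?_, ?_⟩
          · refine walk_eq_of_forall_mem (Nat.zero_le _) fun j h1 h2 => ?_
            by_cases hm' : π^[j] (y i) ∈ mk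
            · exact .inl hm'
            · right
              have hcj := ((walk_cycle (mk := mk) hS hc hh.1 []).2 (π^[j] (y i))).2 ⟨j, h1, h2, rfl⟩
              have : π^[j] (y i) ∈ A i := (hmem i hi.le _).2 (.inr ⟨hm', hcj ▸ hE'⟩)
              rw [hl] at this
              exact List.mem_cons_of_mem _ this
          · rw [Finset.insert_eq_of_mem hE']; linarith
        · obtain ⟨h, t, e, hhS, hw⟩ := (walk_cycle (mk := mk) hS hc hh.1 l).1
          refine ⟨h, t, e, ?_⟩
          have hsum : ∑ v with comp v ∈ insert (comp (y i)) (E i), G.w v (π v) =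
              ∑ v with comp v = comp (y i), G.w v (π v) + ∑ v with comp v ∈ E i, G.w v (π v) := by
            rw [← Finset.sum_union]
            · congr 1; ext v; simp
            · rw [Finset.disjoint_filter]
              intro v _ h1 h2
              exact hE' (h1 ▸ h2)
          -- The walk is charged for returning to `y i`. Its head, `y i` and `y (i + 1)` are all
          -- outside `S`, so one can go from the head straight to `y (i + 1)`; this is why cycles
          -- are inserted only at edges of the metric part.
          have ht := hS.triangle hhS hh.2 hh.1
          linarith
      · rw [if_neg hh, if_neg hh]
        exact ⟨y i, l, rfl, by linarith⟩
    intro i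
    induction i with
    | zero =>
      intro h0
      refine step 0 h0 [] rfl ?_
      simp [pathCost, hE]
    | succ i ih =>
      intro hi
      obtain ⟨h, t, e, hle⟩ := ih (by omega)
      refine step _ hi _ e ?_
      rw [pathCost, G.w_symm]
      linarith
  have hall : ∀ v, v ∈ A ℓ := by
    intro v
    rw [hmem ℓ le_rfl]
    by_cases hv : ∃ j < ℓ, f^[j] z = v
    · exact .inl hv
    · right
      refine ⟨fun h => hv ((hmk v).1 h), ?_⟩
      obtain ⟨j, h1, h2, h3⟩ := (hcov v).resolve_left hv
      simp only [hE]
      exact Finset.mem_image.2 ⟨j, Finset.mem_filter.2 ⟨Finset.mem_range.2 h1, h3⟩, h2⟩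
  have hℓn : ℓ ≤ G.n := by
    have := Finset.card_le_card_of_injOn (s := Finset.range ℓ) (t := (Finset.univ : Finset (Fin G.n)))
      (fun j => f^[j] z) (fun _ _ => by simp) (fun a ha b hb => hinj (by simpa using ha) (by simpa using hb))
    simpa using this
  -- The program takes `G.n` rounds, not knowing `ℓ`; once all vertices are listed nothing changes
  -- any more.
  have hfin : ∀ i, ℓ ≤ i → A i = A ℓ := by
    intro i hi
    induction i, hi using Nat.le_induction with
    | base => rfl
    | succ i hi ih =>
      have hAs : A (i + 1) = if y i ∉ S ∧ y (i + 1) ∉ S then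
          walk π mk (emit (A i) (y i)) (y i) G.n else emit (A i) (y i) := rfl
      rw [hAs, ih, emit_of_mem (hall _)]
      rw [walk_eq_of_forall_mem (Nat.zero_le _) fun j _ _ => .inr (hall _)]
      exact ite_self _
  obtain ⟨h, t, e, hle⟩ := hcost (ℓ - 1) (by omega)
  rw [show ℓ - 1 + 1 = ℓ by omega] at e hle
  have hnd : (A ℓ).Nodup := nodup_assemble ℓ
  refine ⟨h, t, (hfin _ hℓn).trans e, ?_, ?_⟩
  · rw [← e, ← List.toFinset_card_of_nodup hnd]
    have : (A ℓ).toFinset = Finset.univ := by ext v; simp [hall]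
    rw [this, Finset.card_univ, Fintype.card_fin]
  · have hyℓ : y ℓ = z := hend
    rw [hyℓ] at hle
    refine hle.trans (add_le_add le_rfl ?_)
    exact Finset.sum_le_sum_of_subset_of_nonneg (Finset.subset_univ _) fun _ _ _ => G.w_nonneg _ _

end Realization

/-! ### The program -/

infixr:50 ";;" => ForProg.seq

attribute [simp] NExp.eval RExp.eval Test.Holds ForProg.den

/-- Disjunction of tests. -/
def Test.disj (b c : Test) : Test := .neg (.conj (.neg b) (.neg c))

@[simp] theorem Test.disj_holds (b c : Test) (s : State) :
    (Test.disj b c).Holds s ↔ b.Holds s ∨ c.Holds s := by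
  simp [Test.disj, imp_iff_not_or]

/-- The weight of an edge. -/
def edgeW (a b : NExp) : RExp := .get 0 (.add (.get 1 a) b)

theorem ForProg.for_induction {x y : ℕ} {P : ForProg} {s : State} {N : ℕ} (hN : s.reg y = N)
    (I : ℕ → State → Prop) (h0 : I 0 (s.setReg x 0))
    (hs : ∀ i < N, ∀ s', s'.reg x = i → I i s' → I (i + 1) ((P.den s').setReg x (i + 1))) :
    I N ((ForProg.for_ x y P).den s) := by
  simp only [ForProg.den, hN]
  exact loopDen_induction I h0 hs

/-- Row offsets. -/
def rowsP : ForProg :=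
  .setReg 10 (.const 0);;
  .for_ 11 0 (.setArr 1 (.reg 11) (.reg 10);; .setReg 10 (.add (.reg 10) (.reg 0)))

/-- Add a triple to the violating set if it violates the triangle inequality. -/
def greedyTripleP : ForProg :=
  .ite (.conj (.eqN (.get 2 (.reg 12)) (.const 0)) (.conj (.eqN (.get 2 (.reg 13)) (.const 0))
      (.conj (.eqN (.get 2 (.reg 14)) (.const 0))
        (.ltR (.add (edgeW (.reg 12) (.reg 14)) (edgeW (.reg 14) (.reg 13)))
          (edgeW (.reg 12) (.reg 13))))))
    (.setArr 2 (.reg 12) (.const 1);; .setArr 2 (.reg 13) (.const 1);;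
      .setArr 2 (.reg 14) (.const 1);; .setReg 1 (.add (.reg 1) (.const 3)))
    .skip

/-- Greedy computation of a violating set. -/
def greedyP : ForProg :=
  .setArr 2 (.const 0) (.const 1);; .setReg 1 (.const 1);;
  .for_ 12 0 (.for_ 13 0 (.for_ 14 0 greedyTripleP))

/-- Initial clusters. -/
def singletonsP : ForProg :=
  .for_ 15 0 (.setArr 3 (.reg 15) (.reg 15);; .setArr 4 (.reg 15) (.reg 15));;
  .setReg 2 (.sub (.reg 0) (.add (.reg 1) (.reg 1)))

/-- Compare an edge to the cheapest one so far. -/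
def searchPairP : ForProg :=
  .ite (.conj (.eqN (.get 2 (.reg 18)) (.const 0)) (.conj (.eqN (.get 2 (.reg 19)) (.const 0))
      (.conj (.neg (.eqN (.get 3 (.reg 18)) (.get 3 (.reg 19))))
        (.disj (.eqN (.reg 17) (.const 0))
          (.ltR (edgeW (.reg 18) (.reg 19)) (edgeW (.reg 20) (.reg 21)))))))
    (.setReg 20 (.reg 18);; .setReg 21 (.reg 19);; .setReg 17 (.const 1))
    .skip

/-- Search for a cheapest edge between clusters. -/
def cheapestP : ForProg :=
  .setReg 17 (.const 0);;
  .for_ 18 0 (.for_ 19 0 searchPairP)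

/-- Splicing of two cycles. -/
def swapP : ForProg :=
  .setReg 22 (.get 3 (.reg 20));; .setReg 23 (.get 3 (.reg 21));;
  .setReg 24 (.get 4 (.reg 20));; .setArr 4 (.reg 20) (.get 4 (.reg 21));;
  .setArr 4 (.reg 21) (.reg 24)

/-- Relabelling of a cluster. -/
def relabelP : ForProg :=
  .for_ 25 0 (.ite (.eqN (.get 3 (.reg 25)) (.reg 23)) (.setArr 3 (.reg 25) (.reg 22)) .skip)

/-- Clustering of the metric part. -/
def clusterP : ForProg := .for_ 16 2 (cheapestP;; swapP;; relabelP)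

/-! ### Correctness: rows, violating set, clusters -/

/-- The input is in place. -/
structure HasInput (G : Instance) (s : State) : Prop where
  reg_zero : s.reg 0 = G.n
  weight : ∀ a b : Fin G.n, s.rarr 0 (s.arr 1 a + b) = G.w a b

theorem HasInput.congr {G : Instance} {s s' : State} (h : HasInput G s)
    (h0 : s'.reg 0 = s.reg 0 := by rfl) (h1 : s'.arr 1 = s.arr 1 := by rfl)
    (h2 : s'.rarr 0 = s.rarr 0 := by rfl) : HasInput G s' :=
  ⟨h0.trans h.reg_zero, fun a b => by rw [h1, h2]; exact h.weight a b⟩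

theorem HasInput.den {G : Instance} {s : State} (h : HasInput G s) (P : ForProg)
    (h0 : 0 ∉ P.writtenRegs := by decide) (h1 : 1 ∉ P.writtenArrs := by decide)
    (h2 : 0 ∉ P.writtenReals := by decide) : HasInput G (P.den s) :=
  h.congr (ForProg.den_reg s h0) (ForProg.den_arr s h1) (ForProg.den_rarr s h2)

theorem HasInput.edgeW_eval {G : Instance} {s : State} (h : HasInput G s) {e f : NExp}
    {a b : Fin G.n} (ha : e.eval s = a) (hb : f.eval s = b) : (edgeW e f).eval s = G.w a b := by
  simp [edgeW, ha, hb, h.weight]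

/-- The machine cannot multiply, so the offsets `a * n` of the rows of the weight matrix are
tabulated once by repeated addition. -/
theorem rowsP_spec (G : Instance) : HasInput G (rowsP.den G.input) ∧
    (rowsP.den G.input).arr 2 = fun _ => 0 := by
  have hr : rowsP.den G.input = (ForProg.for_ 11 0 (.setArr 1 (.reg 11) (.reg 10);;
    .setReg 10 (.add (.reg 10) (.reg 0)))).den (G.input.setReg 10 0) := rfl
  have hn : (G.input.setReg 10 0).reg 0 = G.n := by simp [Instance.input]
  have key := ForProg.for_induction (x := 11) (P := (.setArr 1 (.reg 11) (.reg 10);;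
    .setReg 10 (.add (.reg 10) (.reg 0)))) hn (fun i s => s.reg 0 = G.n ∧ s.reg 10 = i * G.n ∧
      ∀ j < i, s.arr 1 j = j * G.n) (by simp [Instance.input]) (by
      rintro i hi s hx ⟨h0, h1, h2⟩
      refine ⟨by simp [h0], by simp [h0, h1]; ring, fun j hj => ?_⟩
      simp only [ForProg.den, NExp.eval, State.setReg_arr, State.setArr_arr, if_true, hx,
        Function.update_apply]
      split_ifs with h
      · rw [h, h1]
      · exact h2 j (by omega))
  rw [← hr] at key
  have e2 : (rowsP.den G.input).arr 2 = G.input.arr 2 := ForProg.den_arr _ (by decide)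
  have e3 : (rowsP.den G.input).rarr 0 = G.input.rarr 0 := ForProg.den_rarr _ (by decide)
  refine ⟨⟨key.1, fun a b => ?_⟩, e2⟩
  rw [key.2.2 a a.2, e3]
  have hlt : a.1 * G.n + b < G.n * G.n := by
    calc a.1 * G.n + b < a.1 * G.n + G.n := by have := b.2; omega
      _ = (a.1 + 1) * G.n := by ring
      _ ≤ _ := Nat.mul_le_mul_right _ a.2
  have hpos : 0 < G.n := a.pos
  have e4 : (a.1 * G.n + b) / G.n = a := by
    rw [mul_comm, Nat.mul_add_div hpos, Nat.div_eq_of_lt b.2, add_zero]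
  have e5 : (a.1 * G.n + b) % G.n = b := by
    rw [mul_comm, Nat.mul_add_mod, Nat.mod_eq_of_lt b.2]
  simp only [Instance.input, hlt, and_true, dite_true, e4, e5]

/-- The array `f` is the characteristic function of `S`. -/
def SetRep {n : ℕ} (S : Finset (Fin n)) (f : ℕ → ℕ) : Prop :=
  ∀ v : Fin n, f v = if v ∈ S then 1 else 0

theorem SetRep.eq_zero {n : ℕ} {S : Finset (Fin n)} {f : ℕ → ℕ} (h : SetRep S f) (v : Fin n) :
    f v = 0 ↔ v ∉ S := by
  rw [h v]; split <;> simp_all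

theorem SetRep.insert {n : ℕ} {S : Finset (Fin n)} {f : ℕ → ℕ} (h : SetRep S f) (a : Fin n) :
    SetRep (insert a S) (Function.update f a 1) := by
  intro v
  rw [Function.update_apply, h v]
  by_cases hv : v = a
  · simp [hv]
  · simp [hv, Fin.val_inj]

/-- The array `f` lists the values of `g`. -/
def FunRep {n : ℕ} (g : Fin n → Fin n) (f : ℕ → ℕ) : Prop := ∀ v : Fin n, f v = g v

/-- The state of the greedy search for a violating set after the triples in `Q`. -/
def GreedyState (G : Instance) (Q : Fin G.n → Fin G.n → Fin G.n → Prop) (s : State) : Prop :=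
  HasInput G s ∧ ∃ S : Finset (Fin G.n), SetRep S (s.arr 2) ∧ s.reg 1 = S.card ∧
    (∃ z ∈ S, z.val = 0) ∧
    (∀ X, G.IsViolatingSet X → S.card ≤ 3 * (S ∩ X).card + 1) ∧
    ∀ a b c, Q a b c → a ∈ S ∨ b ∈ S ∨ c ∈ S ∨ G.w a b ≤ G.w a c + G.w c b

theorem GreedyState.mono {G : Instance} {Q Q' : Fin G.n → Fin G.n → Fin G.n → Prop} {s s' : State}
    (h : GreedyState G Q s) (hQ : ∀ a b c, Q' a b c → Q a b c)
    (h0 : s'.reg 0 = s.reg 0 := by rfl) (h1 : s'.reg 1 = s.reg 1 := by rfl)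
    (ha : s'.arr = s.arr := by rfl)
    (hr : s'.rarr = s.rarr := by rfl) : GreedyState G Q' s' := by
  obtain ⟨hi, S, e1, e2, e3, e4, e5⟩ := h
  exact ⟨hi.congr h0 (by rw [ha]) (by rw [hr]), S, by rwa [ha], by rwa [h1], e3, e4,
    fun a b c hq => e5 a b c (hQ a b c hq)⟩

/-- A violating triple outside `S` meets every violating set `X`, and in a vertex not yet in `S`. So
each batch of three new elements of `S` brings a new element of `S ∩ X`; the summand 1 in the
invariant pays for vertex 0. -/
theorem greedy_step {G : Instance} {Q : Fin G.n → Fin G.n → Fin G.n → Prop} {s : State}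
    {a b c : Fin G.n} (h : GreedyState G Q s) (ha : s.reg 12 = a) (hb : s.reg 13 = b)
    (hc : s.reg 14 = c) :
    GreedyState G (fun a' b' c' => Q a' b' c' ∨ (a' = a ∧ b' = b ∧ c' = c))
      (greedyTripleP.den s) := by
  obtain ⟨hi, S, e1, e2, ⟨z, hz, hz0⟩, e4, e5⟩ := h
  have w1 : (edgeW (.reg 12) (.reg 14)).eval s = G.w a c := hi.edgeW_eval (by simpa) (by simpa)
  have w2 : (edgeW (.reg 14) (.reg 13)).eval s = G.w c b := hi.edgeW_eval (by simpa) (by simpa)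
  have w3 : (edgeW (.reg 12) (.reg 13)).eval s = G.w a b := hi.edgeW_eval (by simpa) (by simpa)
  simp only [greedyTripleP, ForProg.den, Test.Holds, NExp.eval, RExp.eval, w1, w2, w3, ha, hb, hc, e1.eq_zero]
  split_ifs with hcond
  · obtain ⟨na, nb, nc, hlt⟩ := hcond
    -- Degenerate triples cannot violate the inequality. Hence exactly three elements are added, as
    -- the update of the size register presumes.
    have hab : a ≠ b := by
      rintro rfl
      have := G.w_nonneg a c; have := G.w_nonneg c a; have := G.w_self a; linarith
    have hac : a ≠ c := by
      rintro rfl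
      have := G.w_self a; linarith
    have hbc : b ≠ c := by
      rintro rfl
      have := G.w_self b; linarith
    refine ⟨hi.congr (by simp) (by simp) (by simp), insert c (insert b (insert a S)), ?_, ?_,
      ⟨z, by simp [hz], hz0⟩, ?_, ?_⟩
    · simpa [hc, hb] using ((e1.insert a).insert b).insert c
    · rw [Finset.card_insert_of_notMem, Finset.card_insert_of_notMem, Finset.card_insert_of_notMem]
      · simp [e2]
      · exact na
      · simp [nb, hab.symm]
      · simp [nc, hac.symm, hbc.symm]
    · intro X hX
      have h4 := e4 X hX
      have hin : ∃ v, v ∉ S ∧ v ∈ insert c (insert b (insert a S)) ∧ v ∈ X := by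
        by_contra hcon
        push Not at hcon
        have := hX.triangle (hcon a na (by simp)) (hcon b nb (by simp)) (hcon c nc (by simp))
        linarith
      obtain ⟨v, hv1, hv2, hv3⟩ := hin
      have hsub : insert v (S ∩ X) ⊆ insert c (insert b (insert a S)) ∩ X := by
        intro u hu
        rcases Finset.mem_insert.1 hu with rfl | hu
        · exact Finset.mem_inter.2 ⟨hv2, hv3⟩
        · rw [Finset.mem_inter] at hu ⊢
          exact ⟨by simp [hu.1], hu.2⟩
      have h5 := Finset.card_le_card hsub
      rw [Finset.card_insert_of_notMem (by simp [hv1])] at h5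
      have h6 := Finset.card_insert_le c (insert b (insert a S))
      have h7 := Finset.card_insert_le b (insert a S)
      have h8 := Finset.card_insert_le a S
      omega
    · rintro a' b' c' (hq | ⟨rfl, rfl, rfl⟩)
      · rcases e5 a' b' c' hq with h | h | h | h
        · exact .inl (by simp [h])
        · exact .inr (.inl (by simp [h]))
        · exact .inr (.inr (.inl (by simp [h])))
        · exact .inr (.inr (.inr h))
      · exact .inl (by simp)
  · refine ⟨hi, S, e1, e2, ⟨z, hz, hz0⟩, e4, ?_⟩
    rintro a' b' c' (hq | ⟨rfl, rfl, rfl⟩)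
    · exact e5 a' b' c' hq
    · by_contra hcon
      push Not at hcon
      exact hcond ⟨hcon.1, hcon.2.1, hcon.2.2.1, hcon.2.2.2⟩

/-- One pass over the triples suffices: `S` only grows, so a triple once hit stays hit, and one that
satisfies the inequality never needs another look. -/
theorem greedyP_spec {G : Instance} (hn : 0 < G.n) {s : State} (h : HasInput G s)
    (h2 : s.arr 2 = fun _ => 0) : GreedyState G (fun _ _ _ => True) (greedyP.den s) := by
  have hinit : GreedyState G (fun _ _ _ => False) ((s.setArr 2 0 1).setReg 1 1) := by
    refine ⟨h.congr, {⟨0, hn⟩}, ?_, by simp, ⟨_, Finset.mem_singleton_self _, rfl⟩, ?_, by simp⟩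
    · intro v
      simp [h2, Function.update_apply, Fin.ext_iff]
    · intro X _
      simp
  have hreg : ∀ {Q s}, GreedyState G Q s → s.reg 0 = G.n := fun h => h.1.reg_zero
  have main := ForProg.for_induction (x := 12) (y := 0) (P := .for_ 13 0 (.for_ 14 0 greedyTripleP)) (hreg hinit) (fun i s => GreedyState G (fun a _ _ => a.val < i) s)
      (hinit.mono (by simp)) ?_
  · exact main.mono (fun a _ _ _ => a.2)
  intro i hi s1 hs1 h1
  have main2 := ForProg.for_induction (x := 13) (y := 0) (P := .for_ 14 0 greedyTripleP) (hreg h1) (fun j s => s.reg 12 = i ∧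
        GreedyState G (fun a b _ => a.val < i ∨ (a.val = i ∧ b.val < j)) s)
      ⟨hs1, h1.mono (by simp)⟩ ?_
  · exact main2.2.mono (fun a b _ h => by have := b.2; omega)
  rintro j hj s2 hs2 ⟨hs2', h2⟩
  have main3 := ForProg.for_induction (x := 14) (y := 0) (P := greedyTripleP) (hreg h2) (fun k s => s.reg 12 = i ∧ s.reg 13 = j ∧
        GreedyState G (fun a b c => a.val < i ∨ (a.val = i ∧ (b.val < j ∨ (b.val = j ∧ c.val < k)))) s)
      ⟨hs2', hs2, h2.mono (by simp)⟩ ?_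
  · exact ⟨main3.1, main3.2.2.mono (fun a b c h => by have := c.2; omega)⟩
  rintro k hk s3 hs3 ⟨hs3', hs3'', h3⟩
  refine ⟨?_, ?_, ?_⟩
  · rw [State.setReg_reg, if_neg (by decide), ForProg.den_reg _ (by decide), hs3']
  · rw [State.setReg_reg, if_neg (by decide), ForProg.den_reg _ (by decide), hs3'']
  · refine (greedy_step (a := ⟨i, hi⟩) (b := ⟨j, hj⟩) (c := ⟨k, hk⟩) h3 hs3' hs3'' hs3).mono ?_
    intro a b c h
    simp only [Fin.ext_iff]
    omega

theorem singletonsP_spec {G : Instance} {s : State} (h : HasInput G s) :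
    FunRep (id : Fin G.n → Fin G.n) ((singletonsP.den s).arr 3) ∧
    FunRep (id : Fin G.n → Fin G.n) ((singletonsP.den s).arr 4) ∧
    (singletonsP.den s).reg 2 = G.n - (s.reg 1 + s.reg 1) := by
  have key := ForProg.for_induction (x := 15) (P := (.setArr 3 (.reg 15) (.reg 15);;
    .setArr 4 (.reg 15) (.reg 15))) h.reg_zero (fun i t => t.reg 0 = G.n ∧ t.reg 1 = s.reg 1 ∧
      (∀ j < i, t.arr 3 j = j) ∧ ∀ j < i, t.arr 4 j = j) (by simp [h.reg_zero]) (by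
      rintro i hi t hx ⟨h0, h1, h2, h3⟩
      refine ⟨by simp [h0], by simp [h1], fun j hj => ?_, fun j hj => ?_⟩
      · simp only [ForProg.den, NExp.eval, State.setReg_arr, State.setArr_arr, hx]
        simp [Function.update_apply]
        split_ifs with hne
        exacts [hne.symm, h2 j (by omega)]
      · simp only [ForProg.den, NExp.eval, State.setReg_arr, State.setArr_arr, hx]
        simp [Function.update_apply, hx]
        split_ifs with hne
        exacts [hne.symm, h3 j (by omega)])
  unfold singletonsP
  rw [ForProg.den, ForProg.den]
  refine ⟨fun v => key.2.2.1 v v.2, fun v => key.2.2.2 v v.2, ?_⟩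
  simp only [State.setReg_reg, NExp.eval, if_true]
  rw [key.1, key.2.1]

/-- The state of the search for a cheapest edge after the pairs in `Q`. -/
def SearchState (G : Instance) (S : Finset (Fin G.n)) (comp : Fin G.n → Fin G.n)
    (Q : Fin G.n → Fin G.n → Prop) (s : State) : Prop :=
  HasInput G s ∧ SetRep S (s.arr 2) ∧ FunRep comp (s.arr 3) ∧
    ((s.reg 17 = 0 ∧ ∀ a b, Q a b → a ∈ S ∨ b ∈ S ∨ comp a = comp b) ∨
      (s.reg 17 = 1 ∧ ∃ a b : Fin G.n, s.reg 20 = a ∧ s.reg 21 = b ∧ a ∉ S ∧ b ∉ S ∧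
        comp a ≠ comp b ∧ ∀ a' b', Q a' b' → a' ∉ S → b' ∉ S → comp a' ≠ comp b' →
          G.w a b ≤ G.w a' b'))

theorem SearchState.mono {G : Instance} {S : Finset (Fin G.n)} {comp : Fin G.n → Fin G.n}
    {Q Q' : Fin G.n → Fin G.n → Prop} {s : State} (h : SearchState G S comp Q s)
    (hQ : ∀ a b, Q' a b → Q a b) {x v : ℕ} (hx : x = 18 ∨ x = 19) :
    SearchState G S comp Q' (s.setReg x v) := by
  obtain ⟨h1, h2, h3, h4⟩ := h
  have e : ∀ y, y ≠ 18 → y ≠ 19 → (s.setReg x v).reg y = s.reg y := by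
    intro y hy hy'
    have hne : ¬ y = x := by rcases hx with rfl | rfl <;> assumption
    rw [State.setReg_reg, if_neg hne]
  have e0 := e 0 (by decide) (by decide)
  have e17 := e 17 (by decide) (by decide)
  have e20 := e 20 (by decide) (by decide)
  have e21 := e 21 (by decide) (by decide)
  refine ⟨HasInput.congr h1 e0 rfl rfl, h2, h3, ?_⟩
  rw [e17, e20, e21]
  rcases h4 with ⟨h4, h5⟩ | ⟨h4, a, b, h5, h6, h7, h8, h9, h10⟩
  · exact .inl ⟨h4, fun a b hq => h5 a b (hQ a b hq)⟩
  · exact .inr ⟨h4, a, b, h5, h6, h7, h8, h9, fun a' b' hq => h10 a' b' (hQ a' b' hq)⟩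

theorem cheapestP_spec {G : Instance} {S : Finset (Fin G.n)} {comp : Fin G.n → Fin G.n} {s : State}
    (h : HasInput G s) (hS : SetRep S (s.arr 2)) (hc : FunRep comp (s.arr 3)) :
    SearchState G S comp (fun _ _ => True) (cheapestP.den s) := by
  have hinit : SearchState G S comp (fun _ _ => False) (s.setReg 17 0) :=
    ⟨h.congr, hS, hc, .inl ⟨by simp, by simp⟩⟩
  have hreg : ∀ {Q s}, SearchState G S comp Q s → s.reg 0 = G.n := fun h => h.1.reg_zero
  have main := ForProg.for_induction (x := 18) (y := 0) (P := .for_ 19 0 searchPairP) (hreg hinit) (fun i s => SearchState G S comp (fun a _ => a.val < i) s)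
      (hinit.mono (by simp) (.inl rfl)) ?_
  · obtain ⟨h1, h2, h3, h4⟩ := main
    refine ⟨h1, h2, h3, ?_⟩
    rcases h4 with ⟨h4, h5⟩ | ⟨h4, a, b, h5, h6, h7, h8, h9, h10⟩
    · exact .inl ⟨h4, fun a b _ => h5 a b a.2⟩
    · exact .inr ⟨h4, a, b, h5, h6, h7, h8, h9, fun a' b' _ => h10 a' b' a'.2⟩
  intro i hi s1 hs1 h1
  have main2 := ForProg.for_induction (x := 19) (y := 0) (P := searchPairP) (hreg h1) (fun j s => s.reg 18 = i ∧
        SearchState G S comp (fun a b => a.val < i ∨ (a.val = i ∧ b.val < j)) s)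
      ⟨hs1, h1.mono (by simp) (.inr rfl)⟩ ?_
  · exact main2.2.mono (fun a b h => by have := b.2; omega) (.inl rfl)
  rintro j hj s2 hs2 ⟨hs2', h2⟩
  refine ⟨?_, ?_⟩
  · rw [State.setReg_reg, if_neg (by decide), ForProg.den_reg _ (by decide), hs2']
  · refine SearchState.mono (Q := fun a b => (a.val < i ∨ (a.val = i ∧ b.val < j)) ∨ (a.val = i ∧ b.val = j))
      ?_ (fun a b h => by omega) (.inr rfl)
    obtain ⟨f1, f2, f3, f4⟩ := h2
    set a : Fin G.n := ⟨i, hi⟩ with ha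
    set b : Fin G.n := ⟨j, hj⟩ with hb
    have ra : s2.reg 18 = a := hs2'
    have rb : s2.reg 19 = b := hs2
    have w1 : (edgeW (.reg 18) (.reg 19)).eval s2 = G.w a b := f1.edgeW_eval (by simpa) (by simpa)
    simp only [searchPairP, ForProg.den, Test.Holds, Test.disj_holds, NExp.eval, w1, ra, rb,
      f2.eq_zero, f3 a, f3 b, Fin.val_inj]
    have hQ : ∀ a' b' : Fin G.n, a'.val = i ∧ b'.val = j → a' = a ∧ b' = b := by
      rintro a' b' ⟨h1, h2⟩; exact ⟨Fin.ext h1, Fin.ext h2⟩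
    split_ifs with hcond
    · obtain ⟨na, nb, nab, hd⟩ := hcond
      refine ⟨f1.congr (by simp) (by simp) (by simp), by simpa using f2, by simpa using f3, .inr ⟨by simp, a, b, by simp, by simp [rb],
        na, nb, nab, ?_⟩⟩
      rintro a' b' (hq | hq) h1 h2 h3
      · rcases f4 with ⟨f4, f5⟩ | ⟨f4, a'', b'', f5, f6, f7, f8, f9, f10⟩
        · rcases f5 a' b' hq with h | h | h
          exacts [absurd h h1, absurd h h2, absurd h h3]
        · have w2 : (edgeW (.reg 20) (.reg 21)).eval s2 = G.w a'' b'' := f1.edgeW_eval (by simpa) (by simpa)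
          rw [w2, f4] at hd
          have := hd.resolve_left (by decide)
          exact this.le.trans (f10 a' b' hq h1 h2 h3)
      · obtain ⟨rfl, rfl⟩ := hQ a' b' hq
        exact le_rfl
    · refine ⟨f1, f2, f3, ?_⟩
      rcases f4 with ⟨f4, f5⟩ | ⟨f4, a'', b'', f5, f6, f7, f8, f9, f10⟩
      · refine .inl ⟨f4, ?_⟩
        rintro a' b' (hq | hq)
        · exact f5 a' b' hq
        · obtain ⟨rfl, rfl⟩ := hQ a' b' hq
          by_contra hcon
          push Not at hcon
          exact hcond ⟨hcon.1, hcon.2.1, hcon.2.2, .inl f4⟩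
      · refine .inr ⟨f4, a'', b'', f5, f6, f7, f8, f9, ?_⟩
        rintro a' b' (hq | hq) h1 h2 h3
        · exact f10 a' b' hq h1 h2 h3
        · obtain ⟨rfl, rfl⟩ := hQ a' b' hq
          have w2 : (edgeW (.reg 20) (.reg 21)).eval s2 = G.w a'' b'' := f1.edgeW_eval (by simpa) (by simpa)
          rw [w2] at hcond
          by_contra hlt
          exact hcond ⟨h1, h2, h3, .inr (not_le.1 hlt)⟩

theorem swapP_spec {G : Instance} {comp : Fin G.n → Fin G.n} {π : Equiv.Perm (Fin G.n)} {s : State}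
    (hc : FunRep comp (s.arr 3)) (hp : FunRep π (s.arr 4)) {a b : Fin G.n}
    (ha : s.reg 20 = a) (hb : s.reg 21 = b) :
    (swapP.den s).reg 22 = comp a ∧ (swapP.den s).reg 23 = comp b ∧
    FunRep (π * Equiv.swap a b) ((swapP.den s).arr 4) := by
  have e4 : (swapP.den s).arr 4 =
      Function.update (Function.update (s.arr 4) a (π b)) b (π a) := by
    simp [swapP, ha, hb, hp a, hp b]
  refine ⟨by simp [swapP, ha, hc a], by simp [swapP, hb, hc b], fun v => ?_⟩
  rw [e4]
  simp only [Function.update_apply, Equiv.Perm.mul_apply, Fin.val_inj]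
  by_cases h1 : v = b
  · subst h1; simp
  · by_cases h2 : v = a
    · subst h2; simp [h1]
    · simp [h1, h2, Equiv.swap_apply_of_ne_of_ne h2 h1, hp v]

/-- The two labels are kept in registers during the loop, so relabelling `b` itself does not disturb
the later comparisons. -/
theorem relabelP_spec {G : Instance} {comp : Fin G.n → Fin G.n} {s : State} {a b : Fin G.n}
    (h0 : s.reg 0 = G.n) (hc : FunRep comp (s.arr 3)) (ha : s.reg 22 = comp a)
    (hb : s.reg 23 = comp b) :
    FunRep (fun v => if comp v = comp b then comp a else comp v) ((relabelP.den s).arr 3) := by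
  have key := ForProg.for_induction (x := 25) (P := .ite (.eqN (.get 3 (.reg 25)) (.reg 23))
    (.setArr 3 (.reg 25) (.reg 22)) .skip) h0 (fun i t => t.reg 22 = comp a ∧ t.reg 23 = comp b ∧
      ∀ v : Fin G.n, t.arr 3 v = if v.val < i ∧ comp v = comp b then comp a else comp v)
    (by simpa [ha, hb] using fun v => hc v) (by
      rintro i hi t hx ⟨h1, h2, h3⟩
      have hi3 := h3 ⟨i, hi⟩
      simp only [lt_irrefl, false_and, if_false] at hi3
      simp only [ForProg.den, Test.Holds, NExp.eval, hx, h1, h2, hi3, Fin.val_inj]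
      split_ifs with hcond
      · refine ⟨by simp [h1], by simp [h2], fun v => ?_⟩
        simp only [State.setReg_arr, State.setArr_arr, if_true, Function.update_apply]
        by_cases hv : v = ⟨i, hi⟩
        · subst hv; simp [hcond]
        · have hv' : v.val ≠ i := fun h => hv (Fin.ext h)
          rw [if_neg hv', h3 v]
          simp only [show v.val < i + 1 ↔ v.val < i by omega]
      · refine ⟨by simp [h1], by simp [h2], fun v => ?_⟩
        simp only [State.setReg_arr]
        by_cases hv : v = ⟨i, hi⟩
        · subst hv; simp [hcond, hi3]
        · have hv' : v.val ≠ i := fun h => hv (Fin.ext h)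
          rw [h3 v]
          simp only [show v.val < i + 1 ↔ v.val < i by omega])
  intro v
  have := key.2.2 v
  simp only [v.2, true_and] at this
  exact this


theorem clusterP_spec {G : Instance} {S : Finset (Fin G.n)} (hS : G.IsViolatingSet S) {z : Fin G.n}
    (hz : z ∈ S) {s : State} (h : HasInput G s) (hSr : SetRep S (s.arr 2))
    (h3 : FunRep (id : Fin G.n → Fin G.n) (s.arr 3))
    (h4 : FunRep (id : Fin G.n → Fin G.n) (s.arr 4)) (h2 : s.reg 2 = G.n - (S.card + S.card)) :
    ∃ (comp : Fin G.n → Fin G.n) (π : Equiv.Perm (Fin G.n)), FunRep comp ((clusterP.den s).arr 3) ∧ FunRep π ((clusterP.den s).arr 4) ∧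
      IsClustering S comp π ∧ (Sᶜ.image comp).card ≤ S.card ∧
      ∀ T : G.Tour, ∑ v, G.w v (π v) ≤ 2 * G.weight T := by
  have hk : 0 < S.card := Finset.card_pos.2 ⟨z, hz⟩
  set M := G.n - (S.card + S.card) with hM
  obtain ⟨-, -, comp, π, h0, h0', hm, hc, hp⟩ := ForProg.for_induction (x := 16)
    (P := cheapestP;; swapP;; relabelP) h2 (fun i t => HasInput G t ∧ SetRep S (t.arr 2) ∧
      ∃ (comp : ℕ → Fin G.n → Fin G.n) (π : ℕ → Equiv.Perm (Fin G.n)), comp 0 = id ∧ π 0 = 1 ∧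
        (∀ j < i, IsMerge G S (comp j) (π j) (comp (j + 1)) (π (j + 1))) ∧
        FunRep (comp i) (t.arr 3) ∧ FunRep (π i) (t.arr 4))
    ⟨h.congr, hSr, fun _ => id, fun _ => 1, rfl, rfl, by simp, h3, h4⟩ (by
      rintro i hi t hx ⟨t1, t2, comp, π, h0, h0', hm, hc, hp⟩
      have hcard := (isClustering_of_merges h0 h0' hm).2
      obtain ⟨u1, u2, u3, u4⟩ := cheapestP_spec t1 t2 hc
      have hu4 : (cheapestP.den t).arr 4 = t.arr 4 := ForProg.den_arr _ (by decide)
      rcases u4 with ⟨-, u4⟩ | ⟨-, a, b, ha, hb, haS, hbS, hab, hmin⟩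
      -- Before round `i < M` more than `|S| ≥ 1` clusters are left outside `S`, so the search
      -- cannot have come back empty-handed.
      · exfalso
        have : 1 < (Sᶜ.image (comp i)).card := by omega
        obtain ⟨_, h5, _, h6, h7⟩ := Finset.one_lt_card.1 this
        obtain ⟨v, hv, rfl⟩ := Finset.mem_image.1 h5
        obtain ⟨v', hv', rfl⟩ := Finset.mem_image.1 h6
        rw [Finset.mem_compl] at hv hv'
        rcases u4 v v' trivial with h | h | h
        exacts [hv h, hv' h, h7 h]
      · obtain ⟨v1, v2, v3⟩ := swapP_spec u3 (hu4 ▸ hp) ha hb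
        have e3 : (swapP.den (cheapestP.den t)).arr 3 = (cheapestP.den t).arr 3 :=
          ForProg.den_arr _ (by decide)
        have i2 := u1.den swapP
        have h5 := relabelP_spec i2.reg_zero (e3 ▸ u3) v1 v2
        have e4 : (relabelP.den (swapP.den (cheapestP.den t))).arr 4 =
          (swapP.den (cheapestP.den t)).arr 4 := ForProg.den_arr _ (by decide)
        have e2 : (relabelP.den (swapP.den (cheapestP.den t))).arr 2 = (cheapestP.den t).arr 2 := by
          rw [ForProg.den_arr _ (by decide), ForProg.den_arr _ (by decide)]
        refine ⟨(i2.den relabelP).congr (by simp) (by simp) (by simp), ?_,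
          Function.update comp (i + 1) (fun v => if comp i v = comp i b then comp i a else comp i v),
          Function.update π (i + 1) (π i * Equiv.swap a b), ?_, ?_, ?_, ?_, ?_⟩
        · simp only [ForProg.den, State.setReg_arr]
          rw [e2]; exact u2
        · rw [Function.update_of_ne (by omega), h0]
        · rw [Function.update_of_ne (by omega), h0']
        · intro j hj
          rcases Nat.lt_or_ge j i with hji | hji
          · rw [Function.update_of_ne (by omega), Function.update_of_ne (by omega),
              Function.update_of_ne (by omega), Function.update_of_ne (by omega)]
            exact hm j hji
          · obtain rfl : j = i := by omega
            rw [Function.update_of_ne (by omega), Function.update_self,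
              Function.update_of_ne (by omega), Function.update_self]
            exact ⟨a, b, haS, hbS, hab, fun a' b' => hmin a' b' trivial, rfl, rfl⟩
        · rw [Function.update_self]
          exact h5
        · rw [Function.update_self]
          simp only [ForProg.den, State.setReg_arr]
          rw [e4]; exact v3)
  obtain ⟨hcl, hcard⟩ := isClustering_of_merges h0 h0' hm
  refine ⟨comp M, π M, hc, hp, hcl, by omega, fun T => ?_⟩
  obtain ⟨idx, -, -, -, -, hidx⟩ := exists_tour_index T z
  rw [G.weight_eq_sum]
  -- By truncated subtraction, `M` is zero or satisfies `M + 2 * |S| = G.n`. The tour is read from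
  -- `z ∈ S`, so an edge that does not increase the index ends in `S`.
  exact cost_of_merges hS h0 h0' (by omega) hm fun v => (hidx v).imp (fun h : tourSucc T v = z => h.symm ▸ hz) id

/-! ### Parameters, division, hash values and guesses -/

/-- Lengths: register `6` is `4k`, register `5` is `8k`, register `26` is `6k`. -/
def lengthsP : ForProg :=
  .setReg 6 (.add (.add (.reg 1) (.reg 1)) (.add (.reg 1) (.reg 1)));;
  .setReg 5 (.add (.reg 6) (.reg 6));;
  .setReg 26 (.add (.reg 6) (.add (.reg 1) (.reg 1)));; .setReg 3 (.const 1)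

/-- The number of hash values. -/
def hashRangeP : ForProg := .for_ 27 26 (.setReg 3 (.add (.reg 3) (.add (.reg 26) (.reg 26))))

/-- The base of the guesses. -/
def baseP : ForProg :=
  .setReg 4 (.add (.reg 3) (.const 1));; .setReg 7 (.const 1);;
  .setReg 8 (.add (.add (.reg 0) (.reg 0)) (.const 1))

/-- The number of guesses. -/
def powerP : ForProg :=
  .for_ 28 5 (.setReg 29 (.const 0);; .for_ 30 4 (.setReg 29 (.add (.reg 29) (.reg 7)));;
    .setReg 7 (.reg 29))

/-- Divide register `y` by register `m`: the remainder stays in `y`, the quotient goes to `q`. -/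
def divP (x b y m q : ℕ) : ForProg :=
  .setReg q (.const 0);;
  .for_ x b (.ite (.neg (.ltN (.reg y) (.reg m)))
    (.setReg y (.sub (.reg y) (.reg m));; .setReg q (.add (.reg q) (.const 1))) .skip)

/-- Hash values. -/
def hashP : ForProg :=
  .setReg 34 (.const 0);;
  .for_ 35 0 (.setReg 36 (.reg 34);; divP 37 8 36 3 40;; .setArr 5 (.reg 35) (.reg 36);;
    .setReg 34 (.add (.reg 34) (.reg 32));;
    .ite (.neg (.ltN (.reg 34) (.reg 31))) (.setReg 34 (.sub (.reg 34) (.reg 31))) .skip)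

/-- Digits of a guess. -/
def digitsP : ForProg :=
  .setReg 38 (.reg 33);;
  .for_ 39 5 (divP 41 7 38 4 40;; .setArr 6 (.reg 39) (.reg 38);; .setReg 38 (.reg 40))

theorem lengthsP_spec (s : State) : (lengthsP.den s).reg 6 = 4 * s.reg 1 ∧
    (lengthsP.den s).reg 5 = 8 * s.reg 1 ∧ (lengthsP.den s).reg 26 = 6 * s.reg 1 ∧
    (lengthsP.den s).reg 3 = 1 := by
  simp [lengthsP]; omega

theorem hashRangeP_spec {s : State} {m : ℕ} (h : s.reg 26 = m) (h3 : s.reg 3 = 1) :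
    (hashRangeP.den s).reg 3 = 2 * (m * m) + 1 := by
  have key := ForProg.for_induction (x := 27)
    (P := .setReg 3 (.add (.reg 3) (.add (.reg 26) (.reg 26)))) h
    (fun i t => t.reg 26 = m ∧ t.reg 3 = 2 * (i * m) + 1) (by simp [h, h3]) (by
      rintro i hi t hx ⟨h1, h2⟩
      exact ⟨by simp [h1], by simp [h1, h2]; ring⟩)
  exact key.2

theorem powerP_spec {s : State} {A D : ℕ} (h4 : s.reg 4 = A) (h5 : s.reg 5 = D)
    (h7 : s.reg 7 = 1) : (powerP.den s).reg 7 = A ^ D := by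
  have key := ForProg.for_induction (x := 28) (P := (.setReg 29 (.const 0);;
    .for_ 30 4 (.setReg 29 (.add (.reg 29) (.reg 7)));; .setReg 7 (.reg 29))) h5
    (fun i t => t.reg 4 = A ∧ t.reg 7 = A ^ i) (by simp [h4, h7]) (by
      rintro i hi t hx ⟨h1, h2⟩
      have k2 := ForProg.for_induction (x := 30) (y := 4) (s := t.setReg 29 0)
        (P := .setReg 29 (.add (.reg 29) (.reg 7))) (N := A) (by simp [h1])
        (fun j u => u.reg 4 = A ∧ u.reg 7 = A ^ i ∧ u.reg 29 = j * A ^ i) (by simp [h1, h2]) (by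
          rintro j hj u hu ⟨e1, e2, e3⟩
          exact ⟨by simp [e1], by simp [e2], by simp [e2, e3]; ring⟩)
      rw [ForProg.den, ForProg.den, ForProg.den]
      simp only [NExp.eval, State.setReg_reg]
      norm_num only [if_true, if_false]
      refine ⟨k2.1, k2.2.2.trans ?_⟩
      rw [pow_succ, mul_comm])
  exact key.2

/-- A for-loop cannot stop early, so surplus rounds do nothing. The rounds suffice: each effective
one subtracts at least 1, and `t` is less than the number of rounds. -/
theorem divP_spec {x b y m q : ℕ} {s : State} {t M : ℕ} (hy : s.reg y = t) (hm : s.reg m = M)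
    (hM : 0 < M) (hb : t < s.reg b) (hd : [x, b, y, m, q].Nodup) :
    ((divP x b y m q).den s).reg y = t % M ∧ ((divP x b y m q).den s).reg q = t / M := by
  simp only [List.nodup_cons, List.mem_cons, List.not_mem_nil, not_or] at hd
  obtain ⟨⟨d1, d2, d3, d4, -⟩, ⟨d5, d6, d7, -⟩, ⟨d8, d9, -⟩, ⟨d10, -⟩, -⟩ := hd
  have key := ForProg.for_induction (x := x) (y := b) (s := s.setReg q 0) (N := s.reg b)
    (P := .ite (.neg (.ltN (.reg y) (.reg m)))
    (.setReg y (.sub (.reg y) (.reg m));; .setReg q (.add (.reg q) (.const 1))) .skip)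
    (by simp [d7]) (fun i u => u.reg m = M ∧ u.reg y + u.reg q * M = t ∧
      (u.reg q = i ∨ u.reg y < M))
    (by simp [Ne.symm d2, Ne.symm d3, Ne.symm d4, d9, d10, hy, hm]) (by
      rintro i hi u hu ⟨h1, h2, h3⟩
      simp only [ForProg.den, Test.Holds, NExp.eval, h1]
      split_ifs with hlt
      · have h7 : ¬ y = x := fun h => d2 h.symm
        have h8 : ¬ q = x := fun h => d4 h.symm
        have h9 : ¬ m = x := fun h => d3 h.symm
        simp only [State.setReg_reg, h7, h8, h9, if_false]
        exact ⟨h1, h2, .inr hlt⟩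
      · have h4 : u.reg q = i := by omega
        have h5 : ¬ q = y := fun h => d9 h.symm
        have h6 : ¬ m = y := fun h => d8 h.symm
        have h7 : ¬ y = x := fun h => d2 h.symm
        have h8 : ¬ q = x := fun h => d4 h.symm
        have h9 : ¬ m = x := fun h => d3 h.symm
        simp only [State.setReg_reg, h1, d10, h5, h6, h7, h8, h9, d9, if_true, if_false, h4]
        refine ⟨trivial, ?_, .inl trivial⟩
        rw [add_mul]
        rw [h4] at h2
        omega)
  have hdef : (divP x b y m q).den s = (ForProg.for_ x b (.ite (.neg (.ltN (.reg y) (.reg m)))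
    (.setReg y (.sub (.reg y) (.reg m));; .setReg q (.add (.reg q) (.const 1))) .skip)).den
      (s.setReg q 0) := rfl
  rw [← hdef] at key
  obtain ⟨-, h2, h3⟩ := key
  have h4 : ((divP x b y m q).den s).reg y < M := by
    rcases h3 with h3 | h3
    · rw [h3] at h2
      have : s.reg b ≤ s.reg b * M := Nat.le_mul_of_pos_right _ hM
      omega
    · exact h3
  rw [← h2]
  constructor
  · rw [Nat.add_mul_mod_self_right, Nat.mod_eq_of_lt h4]
  · rw [Nat.add_mul_div_right _ _ hM, Nat.div_eq_of_lt h4, zero_add]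

/-- Passing from `v` to `v + 1` adds `a` to `a * v % p`; as `a < p`, at most one subtraction of `p`
restores the residue, and no multiplication is needed. -/
theorem hashP_spec {s : State} {n p a R : ℕ} (h0 : s.reg 0 = n) (h31 : s.reg 31 = p)
    (h32 : s.reg 32 = a) (h3 : s.reg 3 = R) (h8 : p ≤ s.reg 8) (hap : a < p) (hR : 0 < R) :
    ∀ v < n, (hashP.den s).arr 5 v = (a * v % p) % R := by
  have key := ForProg.for_induction (x := 35) (s := s.setReg 34 0) (y := 0) (N := n)
    (P := (.setReg 36 (.reg 34);; divP 37 8 36 3 40;; .setArr 5 (.reg 35) (.reg 36);;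
    .setReg 34 (.add (.reg 34) (.reg 32));;
    .ite (.neg (.ltN (.reg 34) (.reg 31))) (.setReg 34 (.sub (.reg 34) (.reg 31))) .skip))
    (by simp [h0]) (fun i t => t.reg 31 = p ∧ t.reg 32 = a ∧ t.reg 3 = R ∧ p ≤ t.reg 8 ∧
      t.reg 34 = a * i % p ∧ ∀ v < i, t.arr 5 v = (a * v % p) % R)
    (by simp [h31, h32, h3, h8]) (by
      rintro i hi t hx ⟨t1, t2, t3, t4, t5, t6⟩
      have hzp : a * i % p < p := Nat.mod_lt _ (by omega)
      have hd := divP_spec (x := 37) (b := 8) (y := 36) (m := 3) (q := 40)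
        (s := t.setReg 36 (a * i % p)) (t := a * i % p) (M := R) (by simp) (by simp [t3]) hR
        (by simp; omega) (by decide)
      have fr : ∀ r, r ∉ [36, 37, 40] →
          ((divP 37 8 36 3 40).den (t.setReg 36 (a * i % p))).reg r = t.reg r := by
        intro r hr
        rw [ForProg.den_reg]
        · simp at hr; simp [hr]
        · simp [divP, ForProg.writtenRegs] at hr ⊢; omega
      have fa : ((divP 37 8 36 3 40).den (t.setReg 36 (a * i % p))).arr 5 = t.arr 5 :=
        ForProg.den_arr _ (by decide)
      set u := (divP 37 8 36 3 40).den (t.setReg 36 (a * i % p)) with hu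
      have step : (a * i % p + a < p → a * (i + 1) % p = a * i % p + a) ∧
          (¬ a * i % p + a < p → a * (i + 1) % p = a * i % p + a - p) := by
        have e : a * (i + 1) % p = (a * i % p + a) % p := by
          rw [mul_add, mul_one, Nat.mod_add_mod]
        constructor
        · intro h; rw [e, Nat.mod_eq_of_lt h]
        · intro h; rw [e, Nat.mod_eq_sub_mod (by omega), Nat.mod_eq_of_lt (by omega)]
      have harr : ∀ v < i + 1, Function.update (t.arr 5) i (a * i % p % R) v = a * v % p % R := by
        intro v hv
        rw [Function.update_apply]
        split_ifs with h
        · rw [h]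
        · exact t6 v (by omega)
      rw [ForProg.den, ForProg.den, ForProg.den, ForProg.den, ForProg.den]
      simp only [NExp.eval, t5]
      rw [← hu]
      simp only [ForProg.den, Test.Holds, NExp.eval, State.setReg_reg, State.setArr_reg,
        State.setReg_arr, fr 34 (by decide), fr 32 (by decide),
        fr 31 (by decide), fr 35 (by decide), hd.1, t1, t2, t5, hx]
      norm_num only [if_true, if_false]
      split_ifs with hc
      · have := step.1 hc
        simp [fr 3 (by decide), fr 31 (by decide), fr 32 (by decide), fr 8 (by decide), t1, t2, t3, t4, this]
        rw [fa]; exact fun v hv => harr v (by omega)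
      · have := step.2 hc
        simp [fr 3 (by decide), fr 31 (by decide), fr 32 (by decide), fr 8 (by decide), t1, t2, t3, t4, this]
        rw [fa]; exact fun v hv => harr v (by omega))
  exact key.2.2.2.2.2

theorem digitsP_spec {s : State} {g A D : ℕ} (h33 : s.reg 33 = g) (h4 : s.reg 4 = A)
    (h5 : s.reg 5 = D) (h7 : g < s.reg 7) (hA : 0 < A) :
    ∀ j < D, (digitsP.den s).arr 6 j = g / A ^ j % A := by
  have key := ForProg.for_induction (x := 39) (s := s.setReg 38 g) (y := 5) (N := D)
    (P := (divP 41 7 38 4 40;; .setArr 6 (.reg 39) (.reg 38);; .setReg 38 (.reg 40)))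
    (by simp [h5]) (fun i t => t.reg 4 = A ∧ g < t.reg 7 ∧
      t.reg 38 = g / A ^ i ∧ ∀ j < i, t.arr 6 j = g / A ^ j % A)
    (by simp [h4, h7]) (by
      rintro i hi t hx ⟨t1, t2, t3, t4⟩
      have hd := divP_spec (x := 41) (b := 7) (y := 38) (m := 4) (q := 40)
        (s := t) (t := g / A ^ i) (M := A) t3 t1 hA
        ((Nat.div_le_self _ _).trans_lt t2) (by decide)
      have fr : ∀ r, r ∉ [38, 40, 41] → ((divP 41 7 38 4 40).den t).reg r = t.reg r := by
        intro r hr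
        rw [ForProg.den_reg]
        simp [divP, ForProg.writtenRegs] at hr ⊢; omega
      have fa : ((divP 41 7 38 4 40).den t).arr 6 = t.arr 6 :=
        ForProg.den_arr _ (by decide)
      rw [ForProg.den, ForProg.den]
      set u := (divP 41 7 38 4 40).den t with hu
      simp only [ForProg.den, NExp.eval, State.setReg_reg, State.setArr_reg,
        State.setReg_arr, State.setArr_arr, fr 4 (by decide), fr 7 (by decide),
        fr 39 (by decide), hd.1, hd.2, fa, t1, hx]
      norm_num only [if_true, if_false]
      refine ⟨trivial, t2, ?_, ?_⟩
      · rw [Nat.div_div_eq_div_mul, pow_succ]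
      · intro v hv
        rw [Function.update_apply]
        split_ifs with h
        · rw [h]
        · exact t4 v (by omega))
  intro j hj
  have hdef : digitsP.den s = (ForProg.for_ 39 5 (divP 41 7 38 4 40;; .setArr 6 (.reg 39) (.reg 38);; .setReg 38 (.reg 40))).den
      (s.setReg 38 (s.reg 33)) := rfl
  rw [hdef, h33]
  exact key.2.2.2 j hj

/-- Every sequence of digits is guessed. -/
theorem exists_guess {A D : ℕ} (d : ℕ → ℕ) (hd : ∀ j < D, d j < A) :
    ∃ g < A ^ D, ∀ j < D, g / A ^ j % A = d j := by
  set F : Fin D → Fin A := fun j => ⟨d j, hd j j.2⟩ with hF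
  refine ⟨finFunctionFinEquiv F, Fin.isLt _, fun j hj => ?_⟩
  have h := congrFun (finFunctionFinEquiv.symm_apply_apply F) ⟨j, hj⟩
  exact congrArg Fin.val h

/-! ### Layers and cheapest skeletons -/

/-- Compare the label of a vertex with a guessed label. -/
def matchLabelP : ForProg :=
  .ite (.conj (.eqN (.get 5 (.get 3 (.reg 42))) (.get 6 (.reg 43)))
      (.eqN (.get 5 (.reg 42)) (.get 6 (.add (.reg 6) (.reg 43)))))
    (.setArr 7 (.reg 42) (.add (.reg 43) (.const 1))) .skip

/-- The layers of the vertices. -/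
def layersP : ForProg :=
  .for_ 42 0 (.setArr 7 (.reg 42) (.const 0);; .for_ 43 6 matchLabelP)

/-- The last layer, and the resetting of the marks. -/
def lastLayerP : ForProg :=
  .for_ 44 0 (.setReal 3 (.reg 44) (edgeW (.reg 44) (.const 0));; .setArr 8 (.reg 44) (.const 0);;
    .setArr 9 (.reg 44) (.const 0);; .setArr 10 (.reg 44) (.const 0))

/-- Consider an edge to the next layer. -/
def relaxEdgeP : ForProg :=
  .ite (.conj (.eqN (.get 7 (.reg 48)) (.add (.reg 45) (.const 1)))
      (.disj (.eqN (.reg 47) (.const 0))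
        (.ltR (.add (edgeW (.reg 46) (.reg 48)) (.get 3 (.reg 48))) (.get 3 (.reg 46)))))
    (.setReal 3 (.reg 46) (.add (edgeW (.reg 46) (.reg 48)) (.get 3 (.reg 48)));;
      .setArr 8 (.reg 46) (.reg 48);; .setReg 47 (.const 1)) .skip

/-- Choose a cheapest continuation. -/
def relaxP : ForProg := .setReg 47 (.const 0);; .for_ 48 0 relaxEdgeP

/-- Choose cheapest continuations for all layers. -/
def skeletonP : ForProg :=
  .for_ 45 6 (.for_ 46 0
    (.ite (.eqN (.get 7 (.reg 46)) (.add (.reg 45) (.const 2))) relaxP .skip))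

/-- A later match overwrites an earlier one. Which match survives is left open; for the right guess
no vertex matches twice, because the colours at different positions are different. -/
theorem layersP_spec {G : Instance} {comp : Fin G.n → Fin G.n} {s : State} {L : ℕ}
    (h0 : s.reg 0 = G.n) (hL : s.reg 6 = L) (hc : FunRep comp (s.arr 3)) (v : Fin G.n) :
    ((layersP.den s).arr 7 v = 0 ∧
      ∀ i < L, ¬ (s.arr 5 (comp v) = s.arr 6 i ∧ s.arr 5 v = s.arr 6 (L + i))) ∨
    ∃ i < L, (s.arr 5 (comp v) = s.arr 6 i ∧ s.arr 5 v = s.arr 6 (L + i)) ∧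
      (layersP.den s).arr 7 v = i + 1 := by
  set mt : Fin G.n → ℕ → Prop := fun v i => s.arr 5 (comp v) = s.arr 6 i ∧ s.arr 5 v = s.arr 6 (L + i) with hmt
  set ok : State → Fin G.n → ℕ → Prop := fun t v m => (t.arr 7 v = 0 ∧ ∀ i < m, ¬ mt v i) ∨
    ∃ i < m, mt v i ∧ t.arr 7 v = i + 1 with hok
  set fr : State → Prop := fun t => t.reg 0 = G.n ∧ t.reg 6 = L ∧ t.arr 3 = s.arr 3 ∧
    t.arr 5 = s.arr 5 ∧ t.arr 6 = s.arr 6 with hfr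
  have key := ForProg.for_induction (x := 42) (s := s) (y := 0) (N := G.n)
    (P := (.setArr 7 (.reg 42) (.const 0);; .for_ 43 6 matchLabelP)) h0
    (fun i t => fr t ∧ ∀ v : Fin G.n, v.val < i → ok t v L)
    ⟨⟨by simp [h0], by simp [hL], rfl, rfl, rfl⟩, by simp⟩ (by
      rintro i hi t hx ⟨ht, ht2⟩
      set u : Fin G.n := ⟨i, hi⟩ with hu
      have k2 := ForProg.for_induction (x := 43) (y := 6) (s := t.setArr 7 i 0)
        (P := matchLabelP) (N := L) (by simp [ht.2.1])
        (fun j t => t.reg 42 = i ∧ fr t ∧ (∀ v : Fin G.n, v.val < i → ok t v L) ∧ ok t u j)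
        ⟨by simp [hx], ⟨by simp [ht.1], by simp [ht.2.1], by simp [ht.2.2.1],
          by simp [ht.2.2.2.1], by simp [ht.2.2.2.2]⟩, ?_, ?_⟩ ?_
      · rw [ForProg.den]
        simp only [ForProg.den, NExp.eval, hx] at k2 ⊢
        obtain ⟨-, k3, k4, k5⟩ := k2
        refine ⟨⟨by simpa using k3.1, by simpa using k3.2.1, k3.2.2⟩, fun v hv => ?_⟩
        rcases Nat.lt_or_ge v.val i with h | h
        · exact k4 v h
        · have : v = u := Fin.ext (by simp [hu]; omega)
          rw [this]; exact k5
      · intro v hv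
        have hne : v.val ≠ i := by omega
        simpa [hok, Function.update_apply, hne] using ht2 v hv
      · left; simp [hu]
      · rintro j hj t' hx' ⟨e1, ⟨f1, f2, f3, f4, f5⟩, e2, e3⟩
        have hcu := hc u
        have hiu : (u : ℕ) = i := rfl
        rw [hiu] at hcu
        simp only [matchLabelP, ForProg.den, Test.Holds, NExp.eval, e1, hx', f2, f3, f4, f5, hcu]
        split_ifs with hcond
        · refine ⟨by simp [e1], ⟨by simp [f1], by simp [f2], by simp [f3], by simp [f4], by simp [f5]⟩,
            fun v hv => ?_, ?_⟩
          · have hne : v.val ≠ i := by omega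
            simpa [hok, Function.update_apply, hne] using e2 v hv
          · right
            exact ⟨j, by omega, hcond, by simp [hu]⟩
        · refine ⟨by simp [e1], ⟨by simp [f1], by simp [f2], by simp [f3], by simp [f4], by simp [f5]⟩,
            e2, ?_⟩
          rcases e3 with ⟨e3, e4⟩ | ⟨i', hi', e3, e4⟩
          · refine .inl ⟨e3, fun m hm => ?_⟩
            rcases Nat.lt_or_ge m j with h | h
            · exact e4 m h
            · obtain rfl : m = j := by omega
              exact hcond
          · exact .inr ⟨i', by omega, e3, e4⟩)
  exact key.2 v v.2

theorem lastLayerP_spec {G : Instance} {s : State} (h : HasInput G s) {z : Fin G.n}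
    (hz : z.val = 0) (v : Fin G.n) :
    (lastLayerP.den s).rarr 3 v = G.w v z ∧ (lastLayerP.den s).arr 8 v = 0 ∧
      (lastLayerP.den s).arr 9 v = 0 ∧ (lastLayerP.den s).arr 10 v = 0 := by
  have key := ForProg.for_induction (x := 44) (s := s) (y := 0) (N := G.n)
    (P := (.setReal 3 (.reg 44) (edgeW (.reg 44) (.const 0));; .setArr 8 (.reg 44) (.const 0);;
    .setArr 9 (.reg 44) (.const 0);; .setArr 10 (.reg 44) (.const 0))) h.reg_zero
    (fun i t => HasInput G t ∧ ∀ v : Fin G.n, v.val < i →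
      t.rarr 3 v = G.w v z ∧ t.arr 8 v = 0 ∧ t.arr 9 v = 0 ∧ t.arr 10 v = 0)
    ⟨h.congr, by simp⟩ (by
      rintro i hi t hx ⟨t1, t2⟩
      have hw : (edgeW (.reg 44) (.const 0)).eval t = G.w ⟨i, hi⟩ z :=
        t1.edgeW_eval (by simp [hx]) (by simp [hz])
      refine ⟨t1.congr (by simp) (by simp) (by simp), fun v hv => ?_⟩
      by_cases hvi : v = ⟨i, hi⟩
      · subst hvi; simp [hx, hw]
      · have hne : v.val ≠ i := fun h => hvi (Fin.ext h)
        have := t2 v (by omega)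
        simpa [hx, Function.update_apply, hne] using this)
  exact key.2 v v.2

/-- The state of the search for a cheapest continuation of `v` to layer `p + 1`. -/
def RelaxState (G : Instance) (pos : Fin G.n → ℕ) (f : Fin G.n → Fin G.n) (D : Fin G.n → ℝ)
    (v : Fin G.n) (p : ℕ) (j : ℕ) (t : State) : Prop :=
  HasInput G t ∧ t.reg 45 = p ∧ t.reg 46 = v ∧ (∀ u : Fin G.n, t.arr 7 u = pos u) ∧
    (∀ u, u ≠ v → t.rarr 3 u = D u ∧ t.arr 8 u = f u) ∧
    ((t.reg 47 = 0 ∧ t.rarr 3 v = D v ∧ t.arr 8 v = f v ∧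
        ∀ u : Fin G.n, u.val < j → pos u ≠ p + 1) ∨
      (t.reg 47 = 1 ∧ ∃ y : Fin G.n, t.arr 8 v = y ∧ pos y = p + 1 ∧ t.rarr 3 v = G.w v y + D y ∧
        ∀ u : Fin G.n, u.val < j → pos u = p + 1 → t.rarr 3 v ≤ G.w v u + D u))

/-- The search writes only to the entries of `v`, which lies in layer `p + 2`, and reads values in
layer `p + 1`. These are therefore still the values at the start. -/
theorem relaxP_spec {G : Instance} {pos : Fin G.n → ℕ} {f : Fin G.n → Fin G.n} {s : State}
    (h : HasInput G s) {v : Fin G.n} {p : ℕ} (h45 : s.reg 45 = p) (h46 : s.reg 46 = v)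
    (h7 : ∀ u : Fin G.n, s.arr 7 u = pos u) (h8 : FunRep f (s.arr 8)) (hv : pos v = p + 2) :
    RelaxState G pos f (fun u => s.rarr 3 u) v p G.n (relaxP.den s) := by
  refine ForProg.for_induction (x := 48) (s := s.setReg 47 0) (y := 0) (N := G.n)
    (P := relaxEdgeP) (by simp [h.reg_zero]) (RelaxState G pos f (fun u => s.rarr 3 u) v p)
    ⟨h.congr, by simp [h45], by simp [h46], h7, fun u _ => ⟨rfl, h8 u⟩,
      .inl ⟨by simp, rfl, h8 v, by simp⟩⟩ ?_
  rintro j hj t hx ⟨t1, t2, t3, t4, t5, t6⟩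
  set u : Fin G.n := ⟨j, hj⟩ with hu
  have hx' : t.reg 48 = u := hx
  have hw : (edgeW (.reg 46) (.reg 48)).eval t = G.w v u := t1.edgeW_eval (by simp [t3]) (by simp [hx'])
  have hsplit : ∀ u' : Fin G.n, u'.val < j + 1 → u'.val < j ∨ u' = u := by
    intro u' h
    rcases Nat.lt_or_ge u'.val j with h' | h'
    · exact .inl h'
    · exact .inr (Fin.ext (by simp [hu]; omega))
  simp only [relaxEdgeP, ForProg.den, Test.Holds, Test.disj_holds, NExp.eval, RExp.eval, hw, t2, t3,
    hx', t4, State.setReal_reg]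
  by_cases hpu : pos u = p + 1
  · have huv : u ≠ v := by rintro h; rw [h] at hpu; omega
    have huv' : (u : ℕ) ≠ v := fun h => huv (Fin.ext h)
    rw [(t5 u huv).1]
    split_ifs with hcond
    · refine ⟨t1.congr (by simp) (by simp) (by simp), by simp [t2], by simp [t3], by simpa using t4, ?_, .inr ⟨by simp, u, ?_, hpu, ?_, ?_⟩⟩
      · intro u' hu'
        have : u'.val ≠ v.val := fun h => hu' (Fin.ext h)
        simpa [Function.update_apply, this] using t5 u' hu'
      · simp
      · simp
      · intro u' h1 h2
        have e : (((((t.setReal 3 v (G.w v u + s.rarr 3 u)).setArr 8 v u).setReg 47 1).setReg 48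
            (j + 1)).rarr 3 v) = G.w v u + s.rarr 3 u := by simp
        rw [e]
        rcases hsplit u' h1 with h1 | rfl
        · rcases t6 with ⟨-, -, -, t6⟩ | ⟨t6, y, t7, t8, t9, t10⟩
          · exact absurd h2 (t6 u' h1)
          · have := hcond.2.resolve_left (by omega)
            exact this.le.trans (t10 u' h1 h2)
        · exact le_rfl
    · refine ⟨t1.congr (by simp), by simp [t2], by simp [t3], t4, t5, ?_⟩
      rcases t6 with ⟨t6, -⟩ | ⟨t6, y, t7, t8, t9, t10⟩
      · exact absurd ⟨hpu, .inl t6⟩ hcond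
      · refine .inr ⟨by simpa using t6, y, t7, t8, t9, fun u' h1 h2 => ?_⟩
        rcases hsplit u' h1 with h1 | rfl
        · exact t10 u' h1 h2
        · by_contra hlt
          exact hcond ⟨hpu, .inr (not_le.1 hlt)⟩
  · rw [if_neg (fun h => hpu h.1)]
    refine ⟨t1.congr (by simp), by simp [t2], by simp [t3], t4, t5, ?_⟩
    rcases t6 with ⟨t6, t7, t8, t9⟩ | ⟨t6, y, t7, t8, t9, t10⟩
    · refine .inl ⟨by simpa using t6, t7, t8, fun u' h1 => ?_⟩
      rcases hsplit u' h1 with h1 | rfl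
      exacts [t9 u' h1, hpu]
    · refine .inr ⟨by simpa using t6, y, t7, t8, t9, fun u' h1 h2 => ?_⟩
      rcases hsplit u' h1 with h1 | rfl
      exacts [t10 u' h1 h2, absurd h2 hpu]

/-- Continuations have been chosen for the vertices of the layers described by `Q`. -/
def SkeletonState (G : Instance) (z : Fin G.n) (pos : Fin G.n → ℕ) (Q : Fin G.n → ℕ → Prop)
    (t : State) : Prop :=
  HasInput G t ∧ (∀ u : Fin G.n, t.arr 7 u = pos u) ∧
    ∃ f : Fin G.n → Fin G.n, FunRep f (t.arr 8) ∧
      (∀ v, pos v = 1 → f v = z ∧ t.rarr 3 v = G.w v z) ∧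
      ∀ v p, pos v = p + 2 → Q v p → (∃ u, pos u = p + 1) →
        pos (f v) = p + 1 ∧ t.rarr 3 v = G.w v (f v) + t.rarr 3 (f v) ∧
          ∀ u, pos u = p + 1 → t.rarr 3 v ≤ G.w v u + t.rarr 3 u

theorem SkeletonState.mono {G : Instance} {z : Fin G.n} {pos : Fin G.n → ℕ}
    {Q Q' : Fin G.n → ℕ → Prop} {t : State} (h : SkeletonState G z pos Q t)
    (hQ : ∀ v p, Q' v p → Q v p) {x y : ℕ} (hx : x ≠ 0) :
    SkeletonState G z pos Q' (t.setReg x y) := by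
  obtain ⟨h1, h3, f, h4, h5, h6⟩ := h
  exact ⟨h1.congr (by simp [hx.symm]), h3, f, h4, h5, fun v p hp hq => h6 v p hp (hQ v p hq)⟩

/-- The layers are treated from the end of the path backwards. Round `i` writes to layer `i + 2`,
whereas the conditions established so far for continuations refer to target layers up to `i + 1`, so
they survive. -/
theorem skeletonP_spec {G : Instance} {z : Fin G.n} {pos : Fin G.n → ℕ} {s : State} {L : ℕ}
    (h : SkeletonState G z pos (fun _ _ => False) s) (hL : s.reg 6 = L) :
    SkeletonState G z pos (fun _ p => p < L) (skeletonP.den s) := by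
  have main := ForProg.for_induction (x := 45) (s := s) (y := 6) (N := L)
    (P := .for_ 46 0
    (.ite (.eqN (.get 7 (.reg 46)) (.add (.reg 45) (.const 2))) relaxP .skip)) hL
    (fun i t => SkeletonState G z pos (fun _ p => p < i) t) (h.mono (by simp) (by decide)) ?_
  · exact main
  intro i hi t hx ht
  have main2 := ForProg.for_induction (x := 46) (s := t) (y := 0) (N := G.n)
    (P := .ite (.eqN (.get 7 (.reg 46)) (.add (.reg 45) (.const 2))) relaxP .skip) ht.1.reg_zero
    (fun j t => t.reg 45 = i ∧ SkeletonState G z pos (fun v p => p < i ∨ (p = i ∧ v.val < j)) t)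
    ⟨by simp [hx], ht.mono (by simp) (by decide)⟩ ?_
  · exact main2.2.mono (fun v p h => by have := v.2; omega) (by decide)
  rintro j hj t hx' ⟨h45, ht⟩
  refine ⟨?_, ?_⟩
  · rw [State.setReg_reg, if_neg (by decide), ForProg.den_reg _ (by decide), h45]
  refine SkeletonState.mono (Q := fun v p => (p < i ∨ (p = i ∧ v.val < j)) ∨ (p = i ∧ v.val = j))
    ?_ (fun v p h => by omega) (by decide)
  obtain ⟨h1, h3, f, h4, h5, h6⟩ := ht
  set v : Fin G.n := ⟨j, hj⟩ with hv
  have hxv : t.reg 46 = v := hx'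
  have hvj : ∀ u : Fin G.n, u.val = j → u = v := fun u h => Fin.ext h
  simp only [ForProg.den, Test.Holds, NExp.eval, hxv, h45, h3]
  split_ifs with hpv
  · obtain ⟨g1, g2, g3, g4, g5, g6⟩ := relaxP_spec h1 h45 hxv h3 h4 hpv
    have hlow : ∀ u, pos u ≠ i + 2 → (relaxP.den t).rarr 3 u = t.rarr 3 u ∧
        (relaxP.den t).arr 8 u = f u := fun u hu => g5 u (by rintro rfl; exact hu hpv)
    -- For a wrong guess layer `i + 1` may be empty. Then the old entry stays, which is a vertex
    -- too, so that the array still represents a function on the vertices.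
    obtain ⟨y, hy, hy2⟩ : ∃ y : Fin G.n, (relaxP.den t).arr 8 v = y ∧ ((∃ u, pos u = i + 1) →
        pos y = i + 1 ∧ (relaxP.den t).rarr 3 v = G.w v y + t.rarr 3 y ∧
          ∀ u, pos u = i + 1 → (relaxP.den t).rarr 3 v ≤ G.w v u + t.rarr 3 u) := by
      rcases g6 with ⟨-, -, g7, g8⟩ | ⟨-, y, g7, g8, g9, g10⟩
      · exact ⟨f v, g7, fun ⟨u, hu⟩ => absurd hu (g8 u u.2)⟩
      · exact ⟨y, g7, fun _ => ⟨g8, g9, fun u hu => g10 u u.2 hu⟩⟩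
    refine ⟨g1, g4, Function.update f v y, ?_, ?_, ?_⟩
    · intro u
      rw [Function.update_apply]
      split_ifs with hu
      · rw [hu]; exact hy
      · exact (g5 u hu).2
    · intro u hu
      have hne : u ≠ v := by rintro rfl; omega
      rw [Function.update_of_ne hne, (g5 u hne).1]
      exact h5 u hu
    · intro u p hp hq hex
      by_cases huv : u = v
      · subst huv
        obtain rfl : p = i := by omega
        obtain ⟨k1, k2, k3⟩ := hy2 hex
        rw [Function.update_self, (hlow y (by omega)).1]
        refine ⟨k1, k2, fun u' hu' => ?_⟩
        rw [(hlow u' (by omega)).1]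
        exact k3 u' hu'
      · have hq' : p < i ∨ (p = i ∧ u.val < j) := by
          rcases hq with hq | hq
          exacts [hq, absurd (hvj u hq.2) huv]
        obtain ⟨k1, k2, k3⟩ := h6 u p hp hq' hex
        have hpi : p ≤ i := by omega
        rw [Function.update_of_ne huv, (g5 u huv).1, (hlow (f u) (by omega)).1]
        refine ⟨k1, k2, fun u' hu' => ?_⟩
        rw [(hlow u' (by omega)).1]
        exact k3 u' hu'
  · refine ⟨h1, h3, f, h4, h5, fun u p hp hq hex => h6 u p hp ?_ hex⟩
    rcases hq with hq | ⟨rfl, hq⟩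
    · exact hq
    · rw [hvj u hq] at hp
      exact absurd hp hpv

/-! ### Candidate tours -/

/-- Mark the vertices of the skeleton. -/
def markP : ForProg :=
  .setReg 49 (.const 0);;
  .for_ 50 0 (.setArr 9 (.reg 49) (.const 1);; .setReg 49 (.get 8 (.reg 49)))

/-- Append the vertex in register `y` to the candidate tour. -/
def emitP (y : ℕ) : ForProg :=
  .ite (.eqN (.get 10 (.reg y)) (.const 0))
    (.setArr 11 (.reg 51) (.reg y);; .setArr 10 (.reg y) (.const 1);;
      .setReg 51 (.add (.reg 51) (.const 1))) .skip

/-- Append the rest of a cluster to the candidate tour. -/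
def walkP : ForProg :=
  .setReg 53 (.reg 49);;
  .for_ 54 0 (.setReg 53 (.get 4 (.reg 53));;
    .ite (.eqN (.get 9 (.reg 53)) (.const 0)) (emitP 53) .skip)

/-- Assemble the candidate tour. -/
def assembleP : ForProg :=
  .setReg 51 (.const 0);; .setReg 49 (.const 0);;
  .for_ 52 0 (emitP 49;;
    .ite (.conj (.eqN (.get 2 (.reg 49)) (.const 0)) (.eqN (.get 2 (.get 8 (.reg 49))) (.const 0)))
      walkP .skip;;
    .setReg 49 (.get 8 (.reg 49)))

/-- The weight of the candidate tour. -/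
def weightP : ForProg :=
  .setArr 11 (.reg 0) (.get 11 (.const 0));; .setReal 2 (.const 0) .zero;;
  .for_ 55 0 (.setReal 2 (.const 0)
    (.add (.get 2 (.const 0)) (edgeW (.get 11 (.reg 55)) (.get 11 (.add (.reg 55) (.const 1))))))

/-- Keep the candidate if it is a tour, and better than the previous ones. -/
def updateP : ForProg :=
  .ite (.conj (.eqN (.reg 51) (.reg 0)) (.disj (.eqN (.reg 9) (.const 0))
      (.ltR (.get 2 (.const 0)) (.get 1 (.const 0)))))
    (.setReal 1 (.const 0) (.get 2 (.const 0));; .setReg 9 (.const 1);;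
      .for_ 56 0 (.setArr 0 (.reg 56) (.get 11 (.reg 56)))) .skip

theorem markP_spec {n : ℕ} {s : State} {f : Fin n → Fin n} {z : Fin n} (hz : z.val = 0)
    (h0 : s.reg 0 = n) (h8 : FunRep f (s.arr 8)) (h9 : ∀ v : Fin n, s.arr 9 v = 0) :
    SetRep ((Finset.range n).image fun j => f^[j] z) ((markP.den s).arr 9) := by
  have key := ForProg.for_induction (x := 50) (s := s.setReg 49 0) (y := 0) (N := n)
    (P := (.setArr 9 (.reg 49) (.const 1);; .setReg 49 (.get 8 (.reg 49)))) (by simp [h0])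
    (fun i t => t.arr 8 = s.arr 8 ∧ t.reg 49 = f^[i] z ∧
      SetRep ((Finset.range i).image fun j => f^[j] z) (t.arr 9))
    ⟨by simp, by simp [hz], by intro v; simp [h9]⟩ (by
      rintro i hi t hx ⟨t1, t2, t3⟩
      refine ⟨by simp [t1], ?_, ?_⟩
      · simp only [ForProg.den, NExp.eval, State.setReg_reg, State.setArr_reg, State.setArr_arr]
        norm_num only [if_true, if_false]
        rw [t1, t2, Function.iterate_succ_apply']
        exact h8 _
      · rw [Finset.range_add_one, Finset.image_insert]
        simpa [t2] using t3.insert (f^[i] z))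
  exact key.2.2

/-- The list `l` is stored, in reverse order, in the array `g`. -/
def Stored {n : ℕ} : List (Fin n) → (ℕ → ℕ) → Prop
  | [], _ => True
  | y :: l, g => g l.length = y ∧ Stored l g

theorem Stored.congr {n : ℕ} {l : List (Fin n)} {g g' : ℕ → ℕ} (h : Stored l g)
    (hg : ∀ i < l.length, g' i = g i) : Stored l g' := by
  induction l with
  | nil => trivial
  | cons y l ih =>
    exact ⟨(hg _ (by simp)).trans h.1, ih h.2 fun i hi => hg i (by simp; omega)⟩

/-- The list `l` is the candidate sequence. -/
def ListRep {n : ℕ} (l : List (Fin n)) (s : State) : Prop :=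
  s.reg 51 = l.length ∧ (∀ v : Fin n, s.arr 10 v = if v ∈ l then 1 else 0) ∧ Stored l (s.arr 11)

theorem ListRep.congr {n : ℕ} {l : List (Fin n)} {s s' : State} (h : ListRep l s)
    (h51 : s'.reg 51 = s.reg 51 := by rfl) (h10 : s'.arr 10 = s.arr 10 := by rfl)
    (h11 : s'.arr 11 = s.arr 11 := by rfl) : ListRep l s' :=
  ⟨h51.trans h.1, fun v => by rw [h10]; exact h.2.1 v, by rw [h11]; exact h.2.2⟩

theorem emitP_spec {n : ℕ} {l : List (Fin n)} {s : State} (h : ListRep l s) {x : ℕ} {y : Fin n}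
    (hy : s.reg x = y) : ListRep (emit l y) ((emitP x).den s) := by
  obtain ⟨h1, h2, h3⟩ := h
  have h10 := h2 y
  simp only [emitP, ForProg.den, Test.Holds, NExp.eval, hy, emit, State.setArr_reg]
  by_cases hm : y ∈ l
  · rw [if_pos hm] at h10
    rw [if_pos hm, if_neg (by omega)]
    exact ⟨h1, h2, h3⟩
  · rw [if_neg hm] at h10
    rw [if_neg hm, if_pos h10]
    refine ⟨by simp [h1], fun v => ?_, ?_, ?_⟩
    · by_cases hv : v = y
      · subst hv; simp
      · have hv' : v.val ≠ y.val := fun h => hv (Fin.ext h)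
        simp [hv', hv, h2 v]
    · simp [h1]
    · refine h3.congr fun i hi => ?_
      simp [h1, Function.update_apply]
      omega

theorem walkP_spec {n : ℕ} {l : List (Fin n)} {s : State} (h : ListRep l s) (h0 : s.reg 0 = n)
    {mk : Finset (Fin n)} (h9 : SetRep mk (s.arr 9)) {π : Fin n → Fin n} (h4 : FunRep π (s.arr 4))
    {r : Fin n} (hr : s.reg 49 = r) : ListRep (walk π mk l r n) (walkP.den s) := by
  have key := ForProg.for_induction (x := 54) (s := s.setReg 53 r) (y := 0) (N := n)
    (P := (.setReg 53 (.get 4 (.reg 53));;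
    .ite (.eqN (.get 9 (.reg 53)) (.const 0)) (emitP 53) .skip)) (by simp [h0])
    (fun i t => t.arr 4 = s.arr 4 ∧ t.arr 9 = s.arr 9 ∧ t.reg 53 = π^[i] r ∧
      ListRep (walk π mk l r i) t)
    ⟨rfl, rfl, by simp, h.congr (by simp)⟩ (by
      rintro i hi t hx ⟨t1, t2, t3, t4⟩
      have e : t.arr 4 (t.reg 53) = π^[i + 1] r := by
        rw [t1, t3, Function.iterate_succ_apply']; exact h4 _
      have hL : ListRep (walk π mk l r i) (t.setReg 53 (π^[i + 1] r)) := t4.congr (by simp)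
      simp only [ForProg.den, Test.Holds, NExp.eval, e, State.setReg_arr, State.setReg_reg,
        if_true, t2, h9.eq_zero]
      rw [walk]
      by_cases hm : π^[i + 1] r ∈ mk
      · rw [if_pos hm, if_neg (not_not.2 hm)]
        exact ⟨t1, t2, by simp, hL.congr (by simp)⟩
      · rw [if_neg hm, if_pos hm]
        refine ⟨?_, ?_, ?_, ?_⟩
        · rw [ForProg.den_arr _ (by decide)]; exact t1
        · rw [ForProg.den_arr _ (by decide)]; exact t2
        · rw [if_neg (by decide), ForProg.den_reg _ (by decide)]; simp
        · exact (emitP_spec (x := 53) hL (by simp)).congr (by simp))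
  have hdef : walkP.den s = (ForProg.for_ 54 0 (.setReg 53 (.get 4 (.reg 53));;
    .ite (.eqN (.get 9 (.reg 53)) (.const 0)) (emitP 53) .skip)).den (s.setReg 53 (s.reg 49)) := rfl
  rw [hdef, hr]
  exact key.2.2.2

theorem assembleP_spec {n : ℕ} {s : State} (h0 : s.reg 0 = n)
    {S mk : Finset (Fin n)} (h2 : SetRep S (s.arr 2)) (h9 : SetRep mk (s.arr 9))
    {π f : Fin n → Fin n} (h4 : FunRep π (s.arr 4)) (h8 : FunRep f (s.arr 8))
    (h10 : ∀ v : Fin n, s.arr 10 v = 0) {z : Fin n} (hz : z.val = 0) :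
    ListRep (assemble S mk π f z n n) (assembleP.den s) := by
  have key := ForProg.for_induction (x := 52) (s := (s.setReg 51 0).setReg 49 0) (y := 0) (N := n)
    (P := (emitP 49;;
    .ite (.conj (.eqN (.get 2 (.reg 49)) (.const 0)) (.eqN (.get 2 (.get 8 (.reg 49))) (.const 0)))
      walkP .skip;;
    .setReg 49 (.get 8 (.reg 49)))) (by simp [h0])
    (fun i t => t.reg 0 = n ∧ t.arr 2 = s.arr 2 ∧ t.arr 4 = s.arr 4 ∧ t.arr 8 = s.arr 8 ∧
      t.arr 9 = s.arr 9 ∧ t.reg 49 = f^[i] z ∧ ListRep (assemble S mk π f z n i) t)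
    ⟨by simp [h0], rfl, rfl, rfl, rfl, by simp [hz], ⟨by simp [assemble], by simpa [assemble] using h10, trivial⟩⟩ (by
      rintro i hi t hx ⟨t0, t2, t4, t8, t9, t49, tl⟩
      have hL := emitP_spec tl t49
      have u0 : ((emitP 49).den t).reg 0 = n := by rw [ForProg.den_reg _ (by decide)]; exact t0
      have u49 : ((emitP 49).den t).reg 49 = f^[i] z := by
        rw [ForProg.den_reg _ (by decide)]; exact t49
      have ua : ∀ a, a ∉ (emitP 49).writtenArrs → ((emitP 49).den t).arr a = t.arr a :=
        fun a ha => ForProg.den_arr _ ha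
      have u2 := (ua 2 (by decide)).trans t2
      have u4 := (ua 4 (by decide)).trans t4
      have u8 := (ua 8 (by decide)).trans t8
      have u9 := (ua 9 (by decide)).trans t9
      rw [ForProg.den, ForProg.den, assemble]
      set u := (emitP 49).den t with hu
      have hf : s.arr 8 (f^[i] z) = f^[i + 1] z := by
        rw [Function.iterate_succ_apply']; exact h8 _
      have hite : (ForProg.ite (.conj (.eqN (.get 2 (.reg 49)) (.const 0))
          (.eqN (.get 2 (.get 8 (.reg 49))) (.const 0))) walkP .skip).den u =
          if f^[i] z ∉ S ∧ f^[i + 1] z ∉ S then walkP.den u else u := by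
        rw [ForProg.den]
        simp only [Test.Holds, NExp.eval, u49, u2, u8, hf, h2.eq_zero, ForProg.den]
      rw [hite]
      by_cases hc : f^[i] z ∉ S ∧ f^[i + 1] z ∉ S
      · rw [if_pos hc, if_pos hc]
        have hW := walkP_spec hL u0 (u9 ▸ h9) (u4 ▸ h4) u49
        have wa : ∀ a, a ∉ walkP.writtenArrs → (walkP.den u).arr a = u.arr a :=
          fun a ha => ForProg.den_arr _ ha
        have w49 : (walkP.den u).reg 49 = f^[i] z := by
          rw [ForProg.den_reg _ (by decide)]; exact u49
        have w0 : (walkP.den u).reg 0 = n := by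
          rw [ForProg.den_reg _ (by decide)]; exact u0
        have w8 := (wa 8 (by decide)).trans u8
        refine ⟨by simp [w0], (wa 2 (by decide)).trans u2, (wa 4 (by decide)).trans u4, w8,
          (wa 9 (by decide)).trans u9, by simp [w8, w49, hf], hW.congr (by simp)⟩
      · rw [if_neg hc, if_neg hc]
        refine ⟨by simp [u0], u2, u4, u8, u9, by simp [u8, u49, hf], hL.congr (by simp)⟩)
  exact key.2.2.2.2.2.2

theorem Stored.getElem {n : ℕ} {l : List (Fin n)} {g : ℕ → ℕ} (h : Stored l g) (i : ℕ)
    (hi : i < l.length) : g (l.length - 1 - i) = l[i] := by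
  induction l generalizing i with
  | nil => simp at hi
  | cons y l ih =>
    cases i with
    | zero => simpa using h.1
    | succ i =>
      simp only [List.length_cons, List.getElem_cons_succ] at hi ⊢
      rw [← ih h.2 i (by omega)]
      congr 1; omega

/-- The weight of the stored closed tour. -/
theorem Stored.pathCost {G : Instance} {l : List (Fin G.n)} {g : ℕ → ℕ} (h : Stored l g)
    (c : ℕ → ℝ) (hc : ∀ i (a b : Fin G.n), g i = a → g (i + 1) = b → c i = G.w a b) :
    pathCost G.w l = ∑ i ∈ Finset.range (l.length - 1), c i := by
  induction l with
  | nil => simp [ParamTSP.pathCost]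
  | cons y l ih =>
    cases l with
    | nil => simp [ParamTSP.pathCost]
    | cons a l =>
      have e := ih h.2
      simp only [List.length_cons, Nat.add_sub_cancel] at e ⊢
      rw [Finset.sum_range_succ, ← e, hc l.length a y h.2.1 h.1, ParamTSP.pathCost, G.w_symm y a, add_comm]

/-- The first vertex is repeated at position `G.n`, which makes the closing edge an ordinary round
of the loop. -/
theorem weightP_spec {G : Instance} {s : State} (h : HasInput G s) {y : ℕ → Fin G.n}
    (hy : ∀ i < G.n, s.arr 11 i = y i) (hn : 0 < G.n) (hyn : y G.n = y 0) :
    (weightP.den s).rarr 2 0 = ∑ i ∈ Finset.range G.n, G.w (y i) (y (i + 1)) ∧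
    ∀ i < G.n, (weightP.den s).arr 11 i = y i := by
  have key := ForProg.for_induction (x := 55) (y := 0) (N := G.n)
    (s := (s.setArr 11 G.n (s.arr 11 0)).setReal 2 0 0)
    (P := .setReal 2 (.const 0)
    (.add (.get 2 (.const 0)) (edgeW (.get 11 (.reg 55)) (.get 11 (.add (.reg 55) (.const 1))))))
    (by simp [h.reg_zero]) (fun i t => HasInput G t ∧ (∀ i ≤ G.n, t.arr 11 i = y i) ∧
      t.rarr 2 0 = ∑ i ∈ Finset.range i, G.w (y i) (y (i + 1)))
    ⟨h.congr (by simp) (by simp) (by simp), ?_, by simp⟩ (by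
      rintro i hi t hx ⟨t1, t2, t3⟩
      have hw : (edgeW (.get 11 (.reg 55)) (.get 11 (.add (.reg 55) (.const 1)))).eval t =
          G.w (y i) (y (i + 1)) :=
        t1.edgeW_eval (by simp [hx, t2 i hi.le]) (by simp [hx, t2 (i + 1) hi])
      exact ⟨t1.congr (by simp) (by simp) (by simp), by simpa using t2, by simp [hw, t3, Finset.sum_range_succ]⟩)
  · have hdef : weightP.den s = (ForProg.for_ 55 0 (.setReal 2 (.const 0)
      (.add (.get 2 (.const 0)) (edgeW (.get 11 (.reg 55)) (.get 11 (.add (.reg 55) (.const 1))))))).den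
      ((s.setArr 11 (s.reg 0) (s.arr 11 0)).setReal 2 0 0) := rfl
    rw [hdef, h.reg_zero]
    exact ⟨key.2.2, fun i hi => key.2.1 i hi.le⟩
  · intro i hi
    by_cases hin : i = G.n
    · subst hin; simp [hyn, hy 0 hn]
    · simp [hin, hy i (by omega)]

/-- The best tour so far is stored, with its weight. -/
def BestRep (G : Instance) (s : State) : Prop :=
  s.reg 9 = 0 ∨ (s.reg 9 = 1 ∧ ∃ T : G.Tour, G.IsOutput s T ∧ s.rarr 1 0 = G.weight T)

/-- The best tour so far has weight at most `c`. -/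
def BestLe (c : ℝ) (s : State) : Prop := s.reg 9 = 1 ∧ s.rarr 1 0 ≤ c

/-- Register 9 tells whether some tour has been stored. A stored tour is replaced only by a lighter
one, so any bound on its weight persists and a single successful guess decides the outcome. -/
theorem updateP_spec {G : Instance} {s : State} (h0 : s.reg 0 = G.n) (hb : BestRep G s)
    (hT : s.reg 51 = G.n → ∃ T : G.Tour, (∀ i : Fin G.n, s.arr 11 i = T i) ∧ s.rarr 2 0 = G.weight T) :
    BestRep G (updateP.den s) ∧ (∀ c, BestLe c s → BestLe c (updateP.den s)) ∧
      (s.reg 51 = G.n → BestLe (s.rarr 2 0) (updateP.den s)) := by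
  have key := ForProg.for_induction (x := 56) (s := (s.setReal 1 0 (s.rarr 2 0)).setReg 9 1) (y := 0) (N := G.n)
    (P := .setArr 0 (.reg 56) (.get 11 (.reg 56))) (by simp [h0])
    (fun i t => t.reg 9 = 1 ∧ t.rarr 1 0 = s.rarr 2 0 ∧ t.arr 11 = s.arr 11 ∧
      ∀ j < i, t.arr 0 j = s.arr 11 j)
    (by simp) (by
      rintro i hi t hx ⟨t1, t2, t3, t4⟩
      refine ⟨by simp [t1], by simp [t2], by simp [t3], fun j hj => ?_⟩
      simp only [ForProg.den, NExp.eval, State.setReg_arr, State.setArr_arr, if_true, hx,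
        Function.update_apply, t3]
      split_ifs with h
      · rw [h]
      · exact t4 j (by omega))
  simp only [updateP, ForProg.den, Test.Holds, Test.disj_holds, NExp.eval, RExp.eval] at key ⊢
  split_ifs with hc
  · obtain ⟨k1, k2, k3, k4⟩ := key
    simp only [h0, State.setReg_reg, State.setReal_reg] at k1 k2 k3 k4 ⊢
    norm_num only [if_true, if_false] at k1 k2 k3 k4 ⊢
    obtain ⟨T, hT1, hT2⟩ := hT (hc.1.trans h0)
    refine ⟨.inr ⟨k1, T, fun i => (k4 i i.2).trans (hT1 i), k2.trans hT2⟩, fun c hc' => ⟨k1, ?_⟩,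
      fun _ => ⟨k1, k2.le⟩⟩
    rw [k2]
    have := hc.2.resolve_left (by rw [hc'.1]; decide)
    exact this.le.trans hc'.2
  · refine ⟨hb, fun c h => h, fun h51 => ?_⟩
    rcases hb with hb | ⟨hb, -⟩
    · exact absurd ⟨h51.trans h0.symm, .inl hb⟩ hc
    · refine ⟨hb, not_lt.1 fun hlt => hc ⟨h51.trans h0.symm, .inr hlt⟩⟩

/-! ### One guess -/

/-- Make and evaluate the candidate for the chosen continuations. -/
def candidateP : ForProg := markP;; assembleP;; weightP;; updateP

/-- Try the labels given by the hash values and the guessed digits. -/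
def tryP : ForProg := layersP;; lastLayerP;; skeletonP;; candidateP

/-- The list is stored backwards, so `z`, its last element, is visited first and its head last; the
closing edge joins the head to `z`. A list without repetitions and of the right length visits every
vertex. -/
theorem exists_tour_of_list {G : Instance} {z : Fin G.n} {A : List (Fin G.n)} (hA : A.Nodup)
    (hlen : A.length = G.n) (hz : [z] <:+ A) {g : ℕ → ℕ} (hg : Stored A g) :
    ∃ (T : G.Tour) (y : ℕ → Fin G.n), (∀ i < G.n, g i = y i) ∧ y G.n = y 0 ∧
      (∀ i : Fin G.n, T i = y i) ∧
      G.weight T = ∑ i ∈ Finset.range G.n, G.w (y i) (y (i + 1)) ∧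
      ∀ h t, A = h :: t → G.weight T = pathCost G.w (h :: t) + G.w h z := by
  have hn : 0 < G.n := z.pos
  -- Reducing the index modulo `G.n` makes the sequence close up.
  set y : ℕ → Fin G.n := fun i => A.getD (G.n - 1 - i % G.n) z with hy
  have hyi : ∀ i (hi : i < G.n), y i = A[G.n - 1 - i]'(by omega) := by
    intro i hi
    simp only [hy]
    rw [Nat.mod_eq_of_lt hi, List.getD_eq_getElem]
  have hgy : ∀ i < G.n, g i = y i := by
    intro i hi
    have := hg.getElem (G.n - 1 - i) (by omega)
    rw [hyi i hi, ← this]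
    congr 1; omega
  have hyn : y G.n = y 0 := by simp [hy]
  have hinj : Function.Injective fun i : Fin G.n => y i := by
    intro i j hij
    simp only [hyi i i.2, hyi j j.2] at hij
    have := (List.Nodup.getElem_inj_iff hA).1 hij
    exact Fin.ext (by have := i.2; have := j.2; omega)
  set T : G.Tour := Equiv.ofBijective _ (Finite.injective_iff_bijective.1 hinj) with hT
  have hTi : ∀ i : Fin G.n, T i = y i := fun i => rfl
  have hw : G.weight T = ∑ i ∈ Finset.range G.n, G.w (y i) (y (i + 1)) := by
    rw [Instance.weight, ← Fin.sum_univ_eq_sum_range (fun i => G.w (y i) (y (i + 1)))]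
    refine Finset.sum_congr rfl fun i _ => ?_
    rw [hTi, hTi]
    congr 1
    have : ((finRotate G.n i : Fin G.n) : ℕ) = (i + 1) % G.n := by
      generalize G.n = n at i hn
      obtain ⟨m, rfl⟩ : ∃ m, n = m + 1 := ⟨n - 1, by omega⟩
      rw [finRotate_apply, Fin.val_add_one]
      split_ifs with h
      · simp [h]
      · have : i.val ≠ m := fun h' => h (Fin.ext h')
        rw [Nat.mod_eq_of_lt (by have := i.2; omega)]
    rw [this]
    simp [hy]
  refine ⟨T, y, hgy, hyn, hTi, hw, fun h t hA' => ?_⟩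
  have hst : Stored A (fun i => (y i : ℕ)) := hg.congr fun i hi => (hgy i (by omega)).symm
  have hp := hst.pathCost (fun i => G.w (y i) (y (i + 1))) (fun i a b ha hb => by
    rw [Fin.ext ha, Fin.ext hb])
  have hlast : y (G.n - 1) = h := by
    rw [hyi _ (by omega)]
    simp [hA']
  have hfirst : y 0 = z := by
    rw [hyi 0 hn]
    obtain ⟨B, rfl⟩ := hz
    simp only [List.length_append, List.length_singleton] at hlen
    simp [show G.n - 1 = B.length by omega]
  rw [← hA', hp, hw, hlen]
  have e := Finset.sum_range_succ (fun i => G.w (y i) (y (i + 1))) (G.n - 1)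
  rw [show G.n - 1 + 1 = G.n by omega, hlast, hyn, hfirst] at e
  exact e

theorem BestRep.congr {G : Instance} {s s' : State} (h : BestRep G s) (h9 : s'.reg 9 = s.reg 9)
    (h0 : s'.arr 0 = s.arr 0) (h1 : s'.rarr 1 = s.rarr 1) : BestRep G s' := by
  rcases h with h | ⟨h, T, hT, hw⟩
  · exact .inl (h9.trans h)
  · exact .inr ⟨h9.trans h, T, fun i => by rw [h0]; exact hT i, by rw [h1]; exact hw⟩

theorem BestLe.congr {c : ℝ} {s s' : State} (h : BestLe c s) (h9 : s'.reg 9 = s.reg 9)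
    (h1 : s'.rarr 1 = s.rarr 1) : BestLe c s' := ⟨h9.trans h.1, by rw [h1]; exact h.2⟩

theorem BestLe.mono {c c' : ℝ} {s : State} (h : BestLe c s) (hc : c ≤ c') : BestLe c' s :=
  ⟨h.1, h.2.trans hc⟩

theorem candidateP_spec {G : Instance} {s : State} (h : HasInput G s)
    {S : Finset (Fin G.n)} (h2 : SetRep S (s.arr 2)) {π f : Fin G.n → Fin G.n}
    (h4 : FunRep π (s.arr 4)) (h8 : FunRep f (s.arr 8)) (h9 : ∀ v : Fin G.n, s.arr 9 v = 0)
    (h10 : ∀ v : Fin G.n, s.arr 10 v = 0) {z : Fin G.n} (hz : z.val = 0) (hb : BestRep G s)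
    {mk : Finset (Fin G.n)} (hmk : mk = (Finset.range G.n).image fun j => f^[j] z) :
    BestRep G (candidateP.den s) ∧ (∀ c, BestLe c s → BestLe c (candidateP.den s)) ∧
      ∀ x t, assemble S mk π f z G.n G.n = x :: t → (x :: t).length = G.n →
        BestLe (pathCost G.w (x :: t) + G.w x z) (candidateP.den s) := by
  have hn : 0 < G.n := z.pos
  have m9 := markP_spec hz h.reg_zero h8 h9
  rw [← hmk] at m9
  have ma : ∀ a, a ∉ markP.writtenArrs → (markP.den s).arr a = s.arr a := fun a ha => ForProg.den_arr _ ha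
  have m0 := h.den markP
  have hL := assembleP_spec m0.reg_zero (S := S) (mk := mk) (by rw [ma 2 (by decide)]; exact h2) m9
    (by rw [ma 4 (by decide)]; exact h4) (by rw [ma 8 (by decide)]; exact h8)
    (by rw [ma 10 (by decide)]; exact h10) hz
  have hu := m0.den assembleP
  set u := assembleP.den (markP.den s) with hudef
  set A := assemble S mk π f z G.n G.n with hA
  have hAz : [z] <:+ A := by
    obtain ⟨m, hm⟩ : ∃ m, G.n = m + 1 := ⟨G.n - 1, by omega⟩
    have := suffix_assemble (S := S) (mk := mk) (π := π) (f := f) (z := z) (n := G.n) m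
    rw [← hm] at this
    exact this
  have hAn : A.Nodup := nodup_assemble _
  have t51 : (weightP.den u).reg 51 = A.length := (ForProg.den_reg _ (by decide)).trans hL.1
  have hcand : A.length = G.n → ∃ T : G.Tour, (∀ i : Fin G.n, (weightP.den u).arr 11 i = T i) ∧
      (weightP.den u).rarr 2 0 = G.weight T ∧
      ∀ x t, A = x :: t → G.weight T = pathCost G.w (x :: t) + G.w x z := by
    intro hlen
    obtain ⟨T, y, hy1, hy2, hy3, hy4, hy5⟩ := exists_tour_of_list hAn hlen hAz hL.2.2
    obtain ⟨e1, e2⟩ := weightP_spec hu hy1 hn hy2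
    exact ⟨T, fun i => by rw [e2 i i.2, hy3], by rw [e1, hy4], hy5⟩
  have hpre : (markP;; assembleP;; weightP).den s = weightP.den u := rfl
  have hb' : BestRep G (weightP.den u) := by
    rw [← hpre]
    exact hb.congr (ForProg.den_reg _ (by decide)) (ForProg.den_arr _ (by decide))
      (ForProg.den_rarr _ (by decide))
  have hl' : ∀ c, BestLe c s → BestLe c (weightP.den u) := by
    intro c hc
    rw [← hpre]
    exact hc.congr (ForProg.den_reg _ (by decide)) (ForProg.den_rarr _ (by decide))
  have hden : candidateP.den s = updateP.den (weightP.den u) := rfl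
  obtain ⟨k1, k2, k3⟩ := updateP_spec (hu.den weightP).reg_zero hb' (fun h => by
    obtain ⟨T, hT⟩ := hcand (t51.symm.trans h)
    exact ⟨T, hT.1, hT.2.1⟩)
  rw [hden]
  refine ⟨k1, fun c hc => k2 c (hl' c hc), fun x t hx hlen => ?_⟩
  rw [← hx] at hlen
  obtain ⟨T, -, hT1, hT2⟩ := hcand hlen
  rw [← hT2 x t hx, ← hT1]
  exact k3 (t51.trans hlen)

/-- What the search needs to know about the results of the first phase. -/
structure Env (G : Instance) (S : Finset (Fin G.n)) (comp π : Fin G.n → Fin G.n) (s : State) : Prop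
    where
  input : HasInput G s
  set : SetRep S (s.arr 2)
  comp : FunRep comp (s.arr 3)
  perm : FunRep π (s.arr 4)

theorem Env.den {G : Instance} {S : Finset (Fin G.n)} {comp π : Fin G.n → Fin G.n} {s : State}
    (h : Env G S comp π s) (P : ForProg)
    (h0 : 0 ∉ P.writtenRegs := by decide) (h1 : 1 ∉ P.writtenArrs := by decide)
    (h2 : 2 ∉ P.writtenArrs := by decide) (h3 : 3 ∉ P.writtenArrs := by decide)
    (h4 : 4 ∉ P.writtenArrs := by decide)
    (h5 : 0 ∉ P.writtenReals := by decide) : Env G S comp π (P.den s) :=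
  ⟨h.input.den P h0 h1 h5, by rw [ForProg.den_arr s h2]; exact h.set,
    by rw [ForProg.den_arr s h3]; exact h.comp, by rw [ForProg.den_arr s h4]; exact h.perm⟩

/-- Nothing is assumed about the guess. For any digits, the best tour does not get worse; the rest
describes the continuations chosen, in the form in which `exists_good_guess` uses them. -/
theorem tryP_spec {G : Instance} {S : Finset (Fin G.n)} {comp π : Fin G.n → Fin G.n} {s : State}
    (h : Env G S comp π s) {z : Fin G.n} (hz : z.val = 0) (hb : BestRep G s) {L : ℕ}
    (hL : s.reg 6 = L) :
    BestRep G (tryP.den s) ∧ (∀ c, BestLe c s → BestLe c (tryP.den s)) ∧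
    ∃ (f : Fin G.n → Fin G.n) (pos : Fin G.n → ℕ) (D : Fin G.n → ℝ),
      (∀ v, (pos v = 0 ∧ ∀ i < L, ¬ (s.arr 5 (comp v) = s.arr 6 i ∧ s.arr 5 v = s.arr 6 (L + i))) ∨
        ∃ i < L, (s.arr 5 (comp v) = s.arr 6 i ∧ s.arr 5 v = s.arr 6 (L + i)) ∧ pos v = i + 1) ∧
      (∀ v, pos v = 1 → f v = z ∧ D v = G.w v z) ∧
      (∀ v p, pos v = p + 2 → p < L → (∃ u, pos u = p + 1) →
        pos (f v) = p + 1 ∧ D v = G.w v (f v) + D (f v) ∧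
          ∀ u, pos u = p + 1 → D v ≤ G.w v u + D u) ∧
      ∀ x t, assemble S ((Finset.range G.n).image fun j => f^[j] z) π f z G.n G.n = x :: t →
        (x :: t).length = G.n → BestLe (pathCost G.w (x :: t) + G.w x z) (tryP.den s) := by
  have l7 := fun v => layersP_spec h.input.reg_zero hL h.comp v
  have e1 := h.den layersP
  have d := lastLayerP_spec e1.input hz
  set pos : Fin G.n → ℕ := fun v => (layersP.den s).arr 7 v with hpos
  have hsk : SkeletonState G z pos (fun _ _ => False) (lastLayerP.den (layersP.den s)) := by
    refine ⟨e1.input.den _, fun u => ?_, fun _ => z, fun v => (d v).2.1.trans hz.symm,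
      fun v _ => ⟨rfl, (d v).1⟩, fun _ _ _ hf => hf.elim⟩
    rw [ForProg.den_arr _ (by decide)]
  have hpre : (layersP;; lastLayerP).den s = lastLayerP.den (layersP.den s) := rfl
  obtain ⟨g1, g2, f, g3, g4, g5⟩ := skeletonP_spec hsk (L := L)
    (by rw [← hpre, ForProg.den_reg _ (by decide), hL])
  set u := skeletonP.den (lastLayerP.den (layersP.den s)) with hu
  have hpre2 : (layersP;; lastLayerP;; skeletonP).den s = u := rfl
  have eu : Env G S comp π u := by rw [← hpre2]; exact h.den _
  have hbu : BestRep G u := by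
    rw [← hpre2]
    exact hb.congr (ForProg.den_reg _ (by decide)) (ForProg.den_arr _ (by decide))
      (ForProg.den_rarr _ (by decide))
  obtain ⟨k1, k2, k3⟩ := candidateP_spec eu.input eu.set eu.perm g3
    (fun v => by rw [hu, ForProg.den_arr _ (by decide)]; exact (d v).2.2.1)
    (fun v => by rw [hu, ForProg.den_arr _ (by decide)]; exact (d v).2.2.2) hz hbu rfl
  have hden : tryP.den s = candidateP.den u := rfl
  rw [hden]
  refine ⟨k1, fun c hc => k2 c ?_, f, pos, fun v => u.rarr 3 v, l7, g4, g5, k3⟩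
  rw [← hpre2]
  exact hc.congr (ForProg.den_reg _ (by decide)) (ForProg.den_rarr _ (by decide))

/-! ### The right guess -/

theorem IsClustering.mem_iff {V : Type*} {S : Finset V} {comp : V → V} {π : Equiv.Perm V}
    (h : IsClustering S comp π) {a b : V} (hab : comp a = comp b) : a ∈ S ↔ b ∈ S := by
  constructor
  · intro ha
    rwa [h.eq_of_comp_eq a ha b (by rw [← hab, h.comp_S a ha])]
  · intro hb
    rwa [h.eq_of_comp_eq b hb a (by rw [hab, h.comp_S b hb])]

/-- The cluster digits from `ℓ` on are no colours, so only positions below `ℓ` can match. Since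
colours separate the points of `X`, the vertex digit fixes the position of a skeleton vertex, and
the cluster digit fixes the cluster of any matching vertex. Positions are counted from the end of
the skeleton, so that layer 1 always precedes the return to `z` and the length need not be known. -/
theorem layers_of_labels {V : Type*} {x : ℕ → V} {ℓ L : ℕ} {comp : V → V} {col : V → ℕ}
    {dig : ℕ → ℕ} {pos : V → ℕ} {X : Set V} (hℓ : ℓ ≤ L) (hinj : Set.InjOn x (Set.Iio ℓ))
    (hcol : Set.InjOn col X) (hx : ∀ j < ℓ, x j ∈ X) (hcomp : ∀ v, comp v ∈ X)
    (hd : ∀ i < ℓ, dig i = col (comp (x (ℓ - 1 - i))) ∧ dig (L + i) = col (x (ℓ - 1 - i)))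
    (hd' : ∀ i < L, ℓ ≤ i → ∀ v, col v ≠ dig i)
    (hpos : ∀ v, (pos v = 0 ∧ ∀ i < L, ¬ (col (comp v) = dig i ∧ col v = dig (L + i))) ∨
      ∃ i < L, (col (comp v) = dig i ∧ col v = dig (L + i)) ∧ pos v = i + 1) :
    (∀ j < ℓ, pos (x j) = ℓ - j) ∧ ∀ v, ∀ j < ℓ, pos v = ℓ - j → comp v = comp (x j) := by
  have hlt : ∀ {v i}, i < L → col (comp v) = dig i → i < ℓ := fun {v i} hi h => by
    by_contra hcon
    exact hd' i hi (not_lt.1 hcon) _ h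
  constructor
  · intro j hj
    rcases hpos (x j) with ⟨-, h⟩ | ⟨i, hi, ⟨h1, h2⟩, h3⟩
    · obtain ⟨e1, e2⟩ := hd (ℓ - 1 - j) (by omega)
      rw [show ℓ - 1 - (ℓ - 1 - j) = j by omega] at e1 e2
      exact absurd ⟨e1.symm, e2.symm⟩ (h (ℓ - 1 - j) (by omega))
    · have hil := hlt hi h1
      rw [(hd i hil).2] at h2
      have := hinj (show j ∈ Set.Iio ℓ from hj) (show ℓ - 1 - i ∈ Set.Iio ℓ by
        simp only [Set.mem_Iio]; omega) (hcol (hx j hj) (hx _ (by omega)) h2)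
      omega
  · intro v j hj hv
    rcases hpos v with ⟨h, -⟩ | ⟨i, hi, ⟨h1, h2⟩, h3⟩
    · omega
    · have hil := hlt hi h1
      rw [(hd i hil).1, show ℓ - 1 - i = j by omega] at h1
      exact hcol (hcomp _) (hcomp _) h1

section GoodGuess

variable {G : Instance} {S : Finset (Fin G.n)} {comp : Fin G.n → Fin G.n}
  {π : Equiv.Perm (Fin G.n)} {z : Fin G.n}

/-- A skeleton realized in the clusters of a given one can be completed to a tour. -/
theorem assemble_of_skeleton (hS : G.IsViolatingSet S) (hc : IsClustering S comp π) {T : G.Tour}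
    (hπ : ∑ v, G.w v (π v) ≤ 2 * G.weight T) {ℓ : ℕ} {x : ℕ → Fin G.n} (hℓ : 0 < ℓ)
    (hinj : Set.InjOn x (Set.Iio ℓ))
    (hw : ∑ j ∈ Finset.range ℓ, G.w (x j) (x (j + 1)) ≤ G.weight T)
    (hcov : ∀ v, (∀ u, comp u = comp v → ∃ j < ℓ, x j = u) ∨
      ∃ j < ℓ, comp (x j) = comp v ∧ x j ∉ S ∧ x (j + 1) ∉ S) {f : Fin G.n → Fin G.n}
    (hend : f^[ℓ] z = z) (hfinj : Set.InjOn (fun j => f^[j] z) (Set.Iio ℓ))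
    (hfc : ∀ j ≤ ℓ, comp (f^[j] z) = comp (x j))
    (hfw : ∑ j ∈ Finset.range ℓ, G.w (f^[j] z) (f^[j + 1] z) ≤
      ∑ j ∈ Finset.range ℓ, G.w (x j) (x (j + 1))) :
    ∃ h t, assemble S ((Finset.range G.n).image fun j => f^[j] z) π f z G.n G.n = h :: t ∧
      (h :: t).length = G.n ∧ pathCost G.w (h :: t) + G.w h z ≤ 3 * G.weight T := by
  have hℓn : ℓ ≤ G.n := by
    have := Finset.card_le_card_of_injOn (s := Finset.range ℓ) (t := Finset.univ) x (by simp)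
      (by simpa using hinj)
    simpa using this
  have hmk : ∀ v, v ∈ ((Finset.range G.n).image fun j => f^[j] z) ↔ ∃ j < ℓ, f^[j] z = v := by
    intro v
    simp only [Finset.mem_image, Finset.mem_range]
    constructor
    · rintro ⟨j, -, rfl⟩
      exact ⟨j % ℓ, Nat.mod_lt _ hℓ, Function.IsPeriodicPt.iterate_mod_apply hend j⟩
    · rintro ⟨j, hj, rfl⟩
      exact ⟨j, by omega, rfl⟩
  obtain ⟨h, t, h1, h2, h3⟩ := assemble_cost hS hc hℓ hfinj hend hmk (by
    intro v
    rcases hcov v with hv | ⟨j, hj, e1, e2, e3⟩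
    · left
      -- The realized path has as many positions in the cluster as the skeleton, with distinct
      -- vertices. If the skeleton exhausts the cluster, then by counting so does the path.
      set J := (Finset.range ℓ).filter fun j => comp (x j) = comp v with hJ
      set C := Finset.univ.filter fun u => comp u = comp v with hC
      have hCJ : C ⊆ J.image x := by
        intro u hu
        obtain ⟨j, hj, rfl⟩ := hv u (by simpa [hC] using hu)
        exact Finset.mem_image_of_mem _ (by simpa [hJ, hj, hC] using hu)
      have hJC : (J.image fun j => f^[j] z) ⊆ C := by
        intro u hu
        obtain ⟨j, hj, rfl⟩ := Finset.mem_image.1 hu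
        simp only [hJ, Finset.mem_filter, Finset.mem_range] at hj
        simp [hC, hfc j hj.1.le, hj.2]
      have hcard : (J.image fun j => f^[j] z).card = J.card :=
        Finset.card_image_of_injOn (hfinj.mono fun j hj => by
          simp only [hJ, Finset.coe_filter, Finset.mem_range] at hj
          exact hj.1)
      have heq := Finset.eq_of_subset_of_card_le hJC (by
        rw [hcard]
        exact (Finset.card_le_card hCJ).trans Finset.card_image_le)
      have hvC : v ∈ C := by simp [hC]
      rw [← heq] at hvC
      obtain ⟨j, hj, hjv⟩ := Finset.mem_image.1 hvC
      simp only [hJ, Finset.mem_filter, Finset.mem_range] at hj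
      exact ⟨j, hj.1, hjv⟩
    · right
      -- Elements of `S` form clusters of their own, so being outside `S` carries over between
      -- vertices of the same cluster.
      exact ⟨j, hj, (hfc j hj.le).trans e1, fun h => e2 ((hc.mem_iff (hfc j hj.le)).1 h),
        fun h => e3 ((hc.mem_iff (hfc (j + 1) hj)).1 h)⟩)
  exact ⟨h, t, h1, h2, by linarith⟩

/-- Some hash function and some guess lead to a tour of weight at most three times the weight of
a given one. -/
theorem exists_good_guess (hS : G.IsViolatingSet S) (hz : z ∈ S) (hc : IsClustering S comp π)
    (hcard : (Sᶜ.image comp).card ≤ S.card) {T : G.Tour}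
    (hπ : ∑ v, G.w v (π v) ≤ 2 * G.weight T) {R A L : ℕ}
    (hR : R = 2 * (6 * S.card * (6 * S.card)) + 1) (hA : A = R + 1) (hL : L = 4 * S.card) :
    ∃ p a g, p ≤ 2 * G.n ∧ a < p ∧ g < A ^ (8 * S.card) ∧
      ∀ (f : Fin G.n → Fin G.n) (pos : Fin G.n → ℕ) (D : Fin G.n → ℝ) (col : Fin G.n → ℕ)
        (dig : ℕ → ℕ), (∀ v : Fin G.n, col v = a * v % p % R) →
      (∀ i < 8 * S.card, dig i = g / A ^ i % A) →
      (∀ v, (pos v = 0 ∧ ∀ i < L, ¬ (col (comp v) = dig i ∧ col v = dig (L + i))) ∨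
        ∃ i < L, (col (comp v) = dig i ∧ col v = dig (L + i)) ∧ pos v = i + 1) →
      (∀ v, pos v = 1 → f v = z ∧ D v = G.w v z) →
      (∀ v p, pos v = p + 2 → p < L → (∃ u, pos u = p + 1) →
        pos (f v) = p + 1 ∧ D v = G.w v (f v) + D (f v) ∧
          ∀ u, pos u = p + 1 → D v ≤ G.w v u + D u) →
      ∃ h t, assemble S ((Finset.range G.n).image fun j => f^[j] z) π f z G.n G.n = h :: t ∧
        (h :: t).length = G.n ∧ pathCost G.w (h :: t) + G.w h z ≤ 3 * G.weight T := by
  obtain ⟨ℓ, hℓL, x, hℓ, hx0, hxℓ, hinj, hw, hcov⟩ := exists_skeleton hS hz T comp hcard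
  -- The vertices the colouring has to separate: at most `4 * |S|` on the skeleton, the elements of
  -- `S`, and at most `|S|` cluster representatives outside `S`.
  set X : Finset (Fin G.n) := (Finset.range ℓ).image x ∪ S ∪ Sᶜ.image comp with hX
  have hXc : X.card ≤ 6 * S.card := by
    have e1 := Finset.card_union_le ((Finset.range ℓ).image x ∪ S) (Sᶜ.image comp)
    have e2 := Finset.card_union_le ((Finset.range ℓ).image x) S
    have e3 := Finset.card_image_le (s := Finset.range ℓ) (f := x)
    rw [Finset.card_range] at e3
    rw [← hX] at e1
    omega
  obtain ⟨p, a, hp, hap, hhash⟩ := exists_hash (n := G.n) (m := 6 * S.card)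
    (X.image Fin.val) (by simp) (Finset.card_image_le.trans hXc) z.pos.ne'
  rw [← hR] at hhash
  have hRpos : 0 < R := by omega
  set c : Fin G.n → ℕ := fun v => a * v % p % R with hcdef
  have hcR : ∀ v, c v < R := fun v => Nat.mod_lt _ hRpos
  -- The first `L` digits give colours of clusters, the next `L` colours of vertices. The digit `R`
  -- is not a hash value and marks unused positions, so words of one fixed length encode skeletons
  -- of every length `ℓ ≤ L`.
  set d : ℕ → ℕ := fun i =>
    if i < L then (if i < ℓ then c (comp (x (ℓ - 1 - i))) else R)
    else if i - L < ℓ then c (x (ℓ - 1 - (i - L))) else R with hd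
  obtain ⟨g, hg, hgd⟩ := exists_guess (A := A) (D := 8 * S.card) d (by
    intro i _
    simp only [hd]
    split_ifs
    · exact (hcR _).trans (by omega)
    · omega
    · exact (hcR _).trans (by omega)
    · omega)
  refine ⟨p, a, g, hp, hap, hg, fun f pos D col dig hcol hdig hpos h1 h2 => ?_⟩
  have hdd : ∀ i < 8 * S.card, dig i = d i := fun i hi => (hdig i hi).trans (hgd i hi)
  have hlayers : (∀ j < ℓ, pos (x j) = ℓ - j) ∧
      ∀ v, ∀ j < ℓ, pos v = ℓ - j → comp v = comp (x j) := by
    refine layers_of_labels (X := X) (by omega) hinj (col := col) ?_ ?_ ?_ ?_ ?_ hpos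
    · intro u hu v hv huv
      rw [hcol, hcol] at huv
      exact Fin.ext (hhash (Finset.mem_coe.2 (Finset.mem_image_of_mem _ hu))
          (Finset.mem_coe.2 (Finset.mem_image_of_mem _ hv)) huv)
    · intro j hj
      simp only [hX, Finset.coe_union, Set.mem_union, Finset.mem_coe, Finset.mem_image, Finset.mem_range]
      exact .inl (.inl ⟨j, hj, rfl⟩)
    · intro v
      simp only [hX, Finset.coe_union, Set.mem_union, Finset.mem_coe]
      by_cases hv : v ∈ S
      · exact .inl (.inr (by rwa [hc.comp_S v hv]))
      · exact .inr (Finset.mem_image_of_mem _ (by simpa using hv))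
    · intro i hi
      rw [hdd i (by omega), hdd (L + i) (by omega)]
      simp only [hd, hcol]
      rw [if_pos (by omega), if_pos hi, if_neg (by omega), if_pos (by omega), Nat.add_sub_cancel_left]
      exact ⟨rfl, rfl⟩
    · intro i hi hil v
      rw [hdd i (by omega), hcol]
      simp only [hd]
      rw [if_pos hi, if_neg (by omega)]
      exact (hcR v).ne
  obtain ⟨l1, l2⟩ := hlayers
  obtain ⟨b1, b2, b3, b4⟩ := layered_path hℓ hx0 hxℓ l1 l2 h1 (by
    intro v q hq1 hq2 hv
    obtain ⟨q, rfl⟩ : ∃ r, q = r + 1 := ⟨q - 1, by omega⟩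
    exact h2 v q hv (by omega) ⟨x (ℓ - (q + 1)), by rw [l1 _ (by omega)]; omega⟩)
  exact assemble_of_skeleton hS hc hπ hℓ hinj hw hcov b1 b2 b3 b4

end GoodGuess

/-! ### The search through all guesses -/

/-- Try all digit sequences. -/
def guessesP : ForProg := .for_ 33 7 (digitsP;; tryP)

/-- Try all hash functions and all digit sequences. -/
def searchP : ForProg := .for_ 31 8 (.for_ 32 8 (hashP;; guessesP))

/-- The state during the search. -/
structure SearchEnv (G : Instance) (S : Finset (Fin G.n)) (comp π : Fin G.n → Fin G.n)
    (R A k : ℕ) (s : State) : Prop where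
  env : Env G S comp π s
  best : BestRep G s
  reg_three : s.reg 3 = R
  reg_four : s.reg 4 = A
  reg_five : s.reg 5 = 8 * k
  reg_six : s.reg 6 = 4 * k
  reg_seven : s.reg 7 = A ^ (8 * k)
  reg_eight : s.reg 8 = 2 * G.n + 1

section Search

variable {G : Instance} {S : Finset (Fin G.n)} {comp π : Fin G.n → Fin G.n} {R A k : ℕ} {s : State}

theorem SearchEnv.of_den (h : SearchEnv G S comp π R A k s) (P : ForProg) (hb : BestRep G (P.den s))
    (hr : ∀ r ∈ [0, 3, 4, 5, 6, 7, 8], r ∉ P.writtenRegs := by decide)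
    (ha : ∀ a ∈ [1, 2, 3, 4], a ∉ P.writtenArrs := by decide)
    (h0 : 0 ∉ P.writtenReals := by decide) : SearchEnv G S comp π R A k (P.den s) where
  env := h.env.den P (hr 0 (by simp)) (ha 1 (by simp)) (ha 2 (by simp)) (ha 3 (by simp))
    (ha 4 (by simp)) h0
  best := hb
  reg_three := (ForProg.den_reg s (hr 3 (by simp))).trans h.reg_three
  reg_four := (ForProg.den_reg s (hr 4 (by simp))).trans h.reg_four
  reg_five := (ForProg.den_reg s (hr 5 (by simp))).trans h.reg_five
  reg_six := (ForProg.den_reg s (hr 6 (by simp))).trans h.reg_six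
  reg_seven := (ForProg.den_reg s (hr 7 (by simp))).trans h.reg_seven
  reg_eight := (ForProg.den_reg s (hr 8 (by simp))).trans h.reg_eight

theorem SearchEnv.den (h : SearchEnv G S comp π R A k s) (P : ForProg)
    (hr : ∀ r ∈ [0, 3, 4, 5, 6, 7, 8], r ∉ P.writtenRegs := by decide)
    (ha : ∀ a ∈ [1, 2, 3, 4], a ∉ P.writtenArrs := by decide)
    (h0 : 0 ∉ P.writtenReals := by decide) (h9 : 9 ∉ P.writtenRegs := by decide)
    (ha0 : 0 ∉ P.writtenArrs := by decide) (hr1 : 1 ∉ P.writtenReals := by decide) :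
    SearchEnv G S comp π R A k (P.den s) :=
  h.of_den P (h.best.congr (ForProg.den_reg s h9) (ForProg.den_arr s ha0) (ForProg.den_rarr s hr1))
    hr ha h0

theorem SearchEnv.setReg (h : SearchEnv G S comp π R A k s) {x : ℕ} (y : ℕ) (hx : 9 < x) :
    SearchEnv G S comp π R A k (s.setReg x y) := by
  have hr : ∀ r < 10, (s.setReg x y).reg r = s.reg r := fun r hr => by
    rw [State.setReg_reg, if_neg (by omega)]
  obtain ⟨⟨h1, h2, h3, h4⟩, h5, g3, g4, g5, g6, g7, g8⟩ := h
  refine ⟨⟨h1.congr (hr 0 (by omega)), h2, h3, h4⟩, h5.congr (hr 9 (by omega)) rfl rfl,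
    ?_, ?_, ?_, ?_, ?_, ?_⟩ <;> rw [hr _ (by omega)] <;> assumption

theorem SearchEnv.tryP (h : SearchEnv G S comp π R A k s) {z : Fin G.n} (hz : z.val = 0) :
    SearchEnv G S comp π R A k (tryP.den s) :=
  h.of_den _ (tryP_spec h.env hz h.best h.reg_six).1

theorem BestLe.setReg {c : ℝ} (h : BestLe c s) {x : ℕ} (y : ℕ) (hx : 9 < x) :
    BestLe c (s.setReg x y) :=
  h.congr (by rw [State.setReg_reg, if_neg (by omega)]) rfl

/-- As bounds on the best weight persist, it suffices that one guess succeeds. Success is a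
hypothesis on every state with the right colours and digits, so nothing else about the state in that
round needs to be known. -/
theorem guessesP_spec (h : SearchEnv G S comp π R A k s) {z : Fin G.n} (hz : z.val = 0)
    (hA : 0 < A) {c : ℝ} :
    SearchEnv G S comp π R A k (guessesP.den s) ∧ (BestLe c s → BestLe c (guessesP.den s)) ∧
    ∀ g < A ^ (8 * k), (∀ t, SearchEnv G S comp π R A k t → t.arr 5 = s.arr 5 →
        (∀ j < 8 * k, t.arr 6 j = g / A ^ j % A) → BestLe c (tryP.den t)) →
      BestLe c (guessesP.den s) := by
  have key := ForProg.for_induction (x := 33) (s := s) (y := 7) (P := (digitsP;; tryP)) h.reg_seven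
    (fun i t => SearchEnv G S comp π R A k t ∧ t.arr 5 = s.arr 5 ∧ (BestLe c s → BestLe c t) ∧
      ∀ g < i, (∀ t, SearchEnv G S comp π R A k t → t.arr 5 = s.arr 5 →
        (∀ j < 8 * k, t.arr 6 j = g / A ^ j % A) → BestLe c (tryP.den t)) → BestLe c t)
    ⟨h.setReg _ (by decide), rfl, fun hc => hc.setReg _ (by decide), by simp⟩ (by
      rintro i hi t hx ⟨t1, t2, t3, t4⟩
      have u1 := t1.den digitsP
      have u2 : (digitsP.den t).arr 5 = s.arr 5 := (ForProg.den_arr _ (by decide)).trans t2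
      have u3 : ∀ {c}, BestLe c t → BestLe c (digitsP.den t) := fun hc =>
        hc.congr (ForProg.den_reg _ (by decide)) (ForProg.den_rarr _ (by decide))
      have hd := digitsP_spec hx t1.reg_four t1.reg_five (by rw [t1.reg_seven]; exact hi) hA
      have hden : (digitsP;; tryP).den t = tryP.den (digitsP.den t) := rfl
      rw [hden]
      set u := digitsP.den t with hu
      have hmono := (tryP_spec u1.env hz u1.best u1.reg_six).2.1 c
      refine ⟨(u1.tryP hz).setReg _ (by decide), ?_, fun hc => (hmono (u3 (t3 hc))).setReg _ (by decide),
        fun g hg hgood => ?_⟩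
      · rw [State.setReg_arr, ForProg.den_arr _ (by decide), u2]
      · refine BestLe.setReg ?_ _ (by decide)
        rcases Nat.lt_or_ge g i with h | h
        · exact hmono (u3 (t4 g h hgood))
        · obtain rfl : g = i := by omega
          exact hgood u u1 u2 hd)
  exact ⟨key.1, key.2.2.1, key.2.2.2⟩

/-- Both loops run through all values up to `2 * G.n`, whether or not they give a sensible hash
function; there is no test of primality, and useless pairs cost only time. -/
theorem searchP_spec (h : SearchEnv G S comp π R A k s) {z : Fin G.n} (hz : z.val = 0)
    (hR : 0 < R) (hA : 0 < A) {c : ℝ} {p a g : ℕ} (hp : p ≤ 2 * G.n) (hap : a < p)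
    (hg : g < A ^ (8 * k)) (hgood : ∀ t, SearchEnv G S comp π R A k t →
      (∀ v < G.n, t.arr 5 v = a * v % p % R) →
        (∀ j < 8 * k, t.arr 6 j = g / A ^ j % A) → BestLe c (tryP.den t)) :
    SearchEnv G S comp π R A k (searchP.den s) ∧ BestLe c (searchP.den s) := by
  have main := ForProg.for_induction (x := 31) (s := s) (y := 8)
    (P := .for_ 32 8 (hashP;; guessesP)) h.reg_eight
    (fun i t => SearchEnv G S comp π R A k t ∧ (p < i → BestLe c t))
    ⟨h.setReg _ (by decide), by simp⟩ (by
      rintro i hi t hx ⟨t1, t2⟩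
      have main2 := ForProg.for_induction (x := 32) (s := t) (y := 8)
        (P := (hashP;; guessesP)) t1.reg_eight
        (fun j u => u.reg 31 = i ∧ SearchEnv G S comp π R A k u ∧ (p < i → BestLe c u) ∧
          (p = i → a < j → BestLe c u))
        ⟨by simp [hx], t1.setReg _ (by decide), fun hc => (t2 hc).setReg _ (by decide), by simp⟩ (by
          rintro j hj u hy ⟨u0, u1, u2, u3⟩
          have hden : (hashP;; guessesP).den u = guessesP.den (hashP.den u) := rfl
          have v1 := u1.den hashP
          have v3 : BestLe c u → BestLe c (hashP.den u) := fun hc =>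
            hc.congr (ForProg.den_reg _ (by decide)) (ForProg.den_rarr _ (by decide))
          obtain ⟨w1, w2, w3⟩ := guessesP_spec (c := c) v1 hz hA
          refine ⟨?_, ?_, fun hc => ?_, fun hpi haj => ?_⟩
          · rw [State.setReg_reg, if_neg (by decide), ForProg.den_reg _ (by decide), u0]
          · rw [hden]; exact w1.setReg _ (by decide)
          · rw [hden]; exact (w2 (v3 (u2 hc))).setReg _ (by decide)
          · rw [hden]
            refine BestLe.setReg ?_ _ (by decide)
            rcases Nat.lt_or_ge a j with h' | h'
            · exact w2 (v3 (u3 hpi h'))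
            · obtain rfl : a = j := by omega
              subst hpi
              have hh := hashP_spec u1.env.input.reg_zero u0 hy u1.reg_three
                (by rw [u1.reg_eight]; omega) hap hR
              exact w3 g hg fun t' ht' h5 h6 => hgood t' ht' (by rw [h5]; exact hh) h6)
      obtain ⟨-, m1, m2, m3⟩ := main2
      refine ⟨m1.setReg _ (by decide), fun hpi => BestLe.setReg ?_ _ (by decide)⟩
      rcases Nat.lt_or_ge p i with h' | h'
      · exact m2 h'
      · exact m3 (by omega) (by omega))
  exact ⟨main.1, main.2 (by omega)⟩

end Search

/-- The search finds a tour of weight at most three times the weight of any given one. -/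
theorem searchP_best {G : Instance} {S : Finset (Fin G.n)} {comp : Fin G.n → Fin G.n}
    {π : Equiv.Perm (Fin G.n)} {z : Fin G.n} {R A : ℕ} {s : State}
    (hS : G.IsViolatingSet S) (hz : z ∈ S) (hz0 : z.val = 0) (hc : IsClustering S comp π)
    (hcard : (Sᶜ.image comp).card ≤ S.card) {T : G.Tour}
    (hπ : ∑ v, G.w v (π v) ≤ 2 * G.weight T)
    (hR : R = 2 * (6 * S.card * (6 * S.card)) + 1) (hA : A = R + 1)
    (h : SearchEnv G S comp π R A S.card s) :
    ∃ T' : G.Tour, G.IsOutput (searchP.den s) T' ∧ G.weight T' ≤ 3 * G.weight T := by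
  obtain ⟨p, a, g, hp, hap, hg, hgood⟩ := exists_good_guess hS hz hc hcard hπ hR hA rfl
  obtain ⟨h1, h2⟩ := searchP_spec (c := 3 * G.weight T) h hz0 (by omega) (by omega) hp hap hg (by
    intro t ht h5 h6
    obtain ⟨-, -, f, pos, D, k1, k2, k3, k4⟩ := tryP_spec ht.env hz0 ht.best ht.reg_six
    obtain ⟨x, l, e1, e2, e3⟩ := hgood f pos D (fun v => t.arr 5 v) (t.arr 6) (fun v => h5 v v.2) h6 k1 k2 k3
    exact (k4 x l e1 e2).mono e3)
  rcases h1.best with h3 | ⟨-, T', hT', hw⟩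
  · exact absurd (h3.symm.trans h2.1) (by decide)
  · exact ⟨T', hT', hw ▸ h2.2⟩

/-! ### The whole program -/

/-- Everything before the search. -/
def prepareP : ForProg :=
  rowsP;; greedyP;; singletonsP;; clusterP;; lengthsP;; hashRangeP;; baseP;; powerP

/-- The whole program. -/
def algorithmP : ForProg := prepareP;; searchP

namespace ForProg

instance CountersSafe.decidable : ∀ P : ForProg, Decidable P.CountersSafe
  | skip | setReg _ _ | setArr _ _ _ | setReal _ _ _ => isTrue trivial
  | seq P Q | ite _ P Q =>
    @instDecidableAnd P.CountersSafe Q.CountersSafe (decidable P) (decidable Q)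
  | for_ x _ P => @instDecidableAnd (x ∉ P.writtenRegs) P.CountersSafe _ (decidable P)

/-- Started in `s`, the compiled program computes its denotation within the time bound. -/
def RunsIn (P : ForProg) (M : ℕ) (s : State) : Prop :=
  ∃ t ≤ P.timeBound M, Runs P.toProg s t (P.den s)

theorem RunsIn.seq {P Q : ForProg} {M : ℕ} {s : State} (hP : P.RunsIn M s)
    (hQ : Q.RunsIn M (P.den s)) : (P;; Q).RunsIn M s := by
  obtain ⟨t, ht, h⟩ := hP
  obtain ⟨t', ht', h'⟩ := hQ
  exact ⟨t + t', add_le_add ht ht', h.seq h'⟩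

theorem runsIn (P : ForProg) {M : ℕ} {s : State} (l : List ℕ) (hM : ∀ y ∈ l, s.reg y ≤ M)
    (hl : ∀ y ∈ P.boundRegs, y ∈ l := by decide) (hP : P.CountersSafe := by decide)
    (hw : ∀ y ∈ P.boundRegs, y ∉ P.writtenRegs := by decide) : P.RunsIn M s :=
  runs_toProg hP hw s fun y hy => hM y (hl y hy)

end ForProg

theorem prepareP_spec (G : Instance) (hn : 0 < G.n) :
    ∃ (S : Finset (Fin G.n)) (z : Fin G.n) (comp : Fin G.n → Fin G.n) (π : Equiv.Perm (Fin G.n))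
      (A : ℕ), G.IsViolatingSet S ∧ z ∈ S ∧ z.val = 0 ∧ IsClustering S comp π ∧
      (Sᶜ.image comp).card ≤ S.card ∧ (∀ T : G.Tour, ∑ v, G.w v (π v) ≤ 2 * G.weight T) ∧
      S.card ≤ 3 * G.q + 1 ∧ A = 2 * (6 * S.card * (6 * S.card)) + 1 + 1 ∧
      SearchEnv G S comp π (2 * (6 * S.card * (6 * S.card)) + 1) A S.card (prepareP.den G.input) ∧
      algorithmP.RunsIn (2 * G.n + 1 + A ^ (8 * S.card)) G.input := by
  obtain ⟨a1, a2⟩ := rowsP_spec G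
  set s₁ := rowsP.den G.input with hs₁
  obtain ⟨b1, S, b2, b3, ⟨z, hz, hz0⟩, b4, b5⟩ := greedyP_spec hn a1 a2
  set s₂ := greedyP.den s₁ with hs₂
  have hS : G.IsViolatingSet S := by
    intro a ha b hb c hc
    refine ⟨G.w_self a, G.w_symm a b, ?_⟩
    rcases b5 a b c trivial with h | h | h | h
    exacts [absurd h ha, absurd h hb, absurd h hc, h]
  obtain ⟨c1, c2, c3⟩ := singletonsP_spec b1
  have c0 := b1.den singletonsP
  have c4 : (singletonsP.den s₂).arr 2 = s₂.arr 2 := ForProg.den_arr _ (by decide)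
  have c5 : (singletonsP.den s₂).reg 1 = S.card := (ForProg.den_reg _ (by decide)).trans b3
  rw [b3] at c3
  set s₃ := singletonsP.den s₂ with hs₃
  obtain ⟨comp, π, d1, d2, d3, d4, d5⟩ := clusterP_spec hS hz c0 (by rw [c4]; exact b2) c1 c2 c3
  have d0 := c0.den clusterP
  have d6 : (clusterP.den s₃).arr 2 = s₂.arr 2 := (ForProg.den_arr _ (by decide)).trans c4
  have d7 : (clusterP.den s₃).reg 1 = S.card := (ForProg.den_reg _ (by decide)).trans c5
  set s₄ := clusterP.den s₃ with hs₄
  obtain ⟨e6, e5, e26, e3⟩ := lengthsP_spec s₄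
  rw [d7] at e6 e5 e26
  set s₅ := lengthsP.den s₄ with hs₅
  have f3 := hashRangeP_spec e26 e3
  have fr : ∀ r ∉ [27, 3], (hashRangeP.den s₅).reg r = s₅.reg r := fun r hr =>
    ForProg.den_reg _ (by simpa [hashRangeP, ForProg.writtenRegs] using hr)
  set s₆ := hashRangeP.den s₅ with hs₆
  have hE : ∀ P : ForProg, (∀ a ∈ [1, 2, 3, 4], a ∉ P.writtenArrs) → 0 ∉ P.writtenRegs →
      0 ∉ P.writtenReals → Env G S comp π (P.den s₄) := fun P ha h0 h0' =>
    Env.den ⟨d0, by rw [d6]; exact b2, d1, d2⟩ P h0 (ha 1 (by simp)) (ha 2 (by simp))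
      (ha 3 (by simp)) (ha 4 (by simp)) h0'
  set R := 2 * (6 * S.card * (6 * S.card)) + 1 with hR
  have g4 : (baseP.den s₆).reg 4 = R + 1 := by simp [baseP, f3]
  have g7 : (baseP.den s₆).reg 7 = 1 := by simp [baseP]
  have h6 : HasInput G s₆ := (hE (lengthsP;; hashRangeP) (by decide) (by decide) (by decide)).input
  have g8 : (baseP.den s₆).reg 8 = 2 * G.n + 1 := by simp [baseP, h6.reg_zero]; omega
  have gr : ∀ r ∉ [4, 7, 8], (baseP.den s₆).reg r = s₆.reg r := fun r hr =>
    ForProg.den_reg _ (by simpa [baseP, ForProg.writtenRegs] using hr)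
  have g5 : (baseP.den s₆).reg 5 = 8 * S.card :=
    (gr 5 (by decide)).trans ((fr 5 (by decide)).trans e5)
  have g6 : (baseP.den s₆).reg 6 = 4 * S.card :=
    (gr 6 (by decide)).trans ((fr 6 (by decide)).trans e6)
  have g3 : (baseP.den s₆).reg 3 = R := (gr 3 (by decide)).trans f3
  set s₇ := baseP.den s₆ with hs₇
  have k7 := powerP_spec g4 g5 g7
  have kr : ∀ r ∉ [28, 29, 30, 7], (powerP.den s₇).reg r = s₇.reg r := fun r hr =>
    ForProg.den_reg _ (by
      simp only [List.mem_cons, List.not_mem_nil, not_or] at hr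
      simp [powerP, ForProg.writtenRegs]; omega)
  have hfin : prepareP.den G.input = powerP.den s₇ := rfl
  have hbest : (prepareP.den G.input).reg 9 = 0 := (ForProg.den_reg _ (by decide)).trans rfl
  have hsearch : SearchEnv G S comp π R (R + 1) S.card (prepareP.den G.input) := by
    refine ⟨?_, .inl hbest, ?_, ?_, ?_, ?_, ?_, ?_⟩
    · exact hE (lengthsP;; hashRangeP;; baseP;; powerP) (by decide) (by decide) (by decide)
    · rw [hfin, kr 3 (by decide), g3]
    · rw [hfin, kr 4 (by decide), g4]
    · rw [hfin, kr 5 (by decide), g5]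
    · rw [hfin, kr 6 (by decide), g6]
    · rw [hfin, k7]
    · rw [hfin, kr 8 (by decide), g8]
  have hq : S.card ≤ 3 * G.q + 1 := by
    obtain ⟨X, hX, hXq⟩ := G.q_attained
    have h1 := b4 X hX
    have h2 := Finset.card_le_card (Finset.inter_subset_right (s₁ := S) (s₂ := X))
    omega
  have hk : 0 < S.card := Finset.card_pos.2 ⟨z, hz⟩
  set M := 2 * G.n + 1 + (R + 1) ^ (8 * S.card) with hM
  have hAM : R + 1 ≤ M := by
    have := Nat.le_self_pow (show 8 * S.card ≠ 0 by omega) (R + 1)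
    omega
  have hkM : 8 * S.card ≤ M := by
    have : S.card ≤ S.card * S.card := Nat.le_mul_self _
    have : 8 * S.card ≤ R + 1 := by rw [hR]; nlinarith
    omega
  refine ⟨S, z, comp, π, R + 1, hS, hz, hz0, d3, d4, d5, hq, rfl, hsearch, ?_⟩
  -- The program itself computes its loop bounds, so they are checked against `M` piece by piece,
  -- each in the state in which the piece starts.
  refine .seq (.seq ?_ (.seq ?_ (.seq ?_ (.seq ?_ (.seq ?_ (.seq ?_ (.seq ?_ ?_))))))) ?_
  · refine ForProg.runsIn _ [0] ?_
    simp [Instance.input]; omega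
  · refine ForProg.runsIn _ [0] ?_
    simp [← hs₁, a1.reg_zero]; omega
  · refine ForProg.runsIn _ [0] ?_
    simp [← hs₁, ← hs₂, b1.reg_zero]; omega
  · refine ForProg.runsIn _ [0, 2] ?_
    simp [← hs₁, ← hs₂, ← hs₃, c0.reg_zero, c3]; omega
  · exact ForProg.runsIn _ [] (by simp)
  · refine ForProg.runsIn _ [26] ?_
    simp only [← hs₁, ← hs₂, ← hs₃, ← hs₄, ← hs₅, List.mem_singleton, forall_eq, e26]
    omega
  · exact ForProg.runsIn _ [] (by simp)
  · refine ForProg.runsIn _ [4, 5] ?_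
    simp only [← hs₁, ← hs₂, ← hs₃, ← hs₄, ← hs₅, ← hs₆, ← hs₇, List.mem_cons, List.not_mem_nil,
      or_false, forall_eq_or_imp, forall_eq, g4, g5]
    omega
  · refine ForProg.runsIn _ [8, 0, 7, 5, 6] ?_
    simp only [List.mem_cons, List.not_mem_nil, or_false, forall_eq_or_imp, forall_eq,
      hsearch.env.input.reg_zero, hsearch.reg_eight, hsearch.reg_seven, hsearch.reg_five,
      hsearch.reg_six]
    omega

/-- The number of guesses is slightly superexponential in the parameter. -/
theorem guesses_le {q k A : ℕ} (hk : 0 < k) (hkq : k ≤ 3 * q + 1)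
    (hA : A = 2 * (6 * k * (6 * k)) + 1 + 1) :
    ((A ^ (8 * k) : ℕ) : ℝ) ≤ 1184 ^ 32 * (2 : ℝ) ^ (416 * (q * Real.logb 2 q)) := by
  rcases Nat.lt_or_ge q 2 with hq | hq
  -- For `q ≤ 1` the exponent vanishes and the constant must suffice: `k ≤ 4` gives `A ≤ 72 * 16 + 2
  -- ≤ 1184` and `8 * k ≤ 32`.
  · have h1 : (q : ℝ) * Real.logb 2 q = 0 := by interval_cases q <;> simp
    rw [h1, mul_zero, Real.rpow_zero, mul_one]
    have hA' : A ≤ 1184 := by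
      have : k * k ≤ 4 * 4 := Nat.mul_le_mul (by omega) (by omega)
      have e : 2 * (6 * k * (6 * k)) = 72 * (k * k) := by ring
      omega
    have : A ^ (8 * k) ≤ 1184 ^ 32 :=
      (Nat.pow_le_pow_left hA' _).trans (Nat.pow_le_pow_right (by norm_num) (show 8 * k ≤ 32 by omega))
    refine (Nat.cast_le.2 this).trans_eq ?_
    rw [Nat.cast_pow, Nat.cast_ofNat]
  -- Now `k ≤ 4 * q`, so `A ≤ 1152 * q ^ 2 + 2 ≤ 2 ^ 11 * q ^ 2`, and `2 ≤ q` absorbs the constant.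
  -- With `8 * k ≤ 32 * q` the exponent becomes `13 * 32 * q = 416 * q`.
  · have hA' : A ≤ q ^ 13 := by
      have h1 : k * k ≤ (4 * q) * (4 * q) := Nat.mul_le_mul (by omega) (by omega)
      have h2 : 2 ^ 11 ≤ q ^ 11 := Nat.pow_le_pow_left hq _
      have h3 : A ≤ 2 ^ 11 * q ^ 2 := by
        rw [hA]; nlinarith
      calc A ≤ 2 ^ 11 * q ^ 2 := h3
        _ ≤ q ^ 11 * q ^ 2 := Nat.mul_le_mul_right _ h2
        _ = q ^ 13 := by ring
    have h4 : A ^ (8 * k) ≤ q ^ (416 * q) := by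
      calc A ^ (8 * k) ≤ (q ^ 13) ^ (8 * k) := Nat.pow_le_pow_left hA' _
        _ = q ^ (13 * (8 * k)) := (pow_mul q 13 (8 * k)).symm
        _ ≤ q ^ (416 * q) := Nat.pow_le_pow_right (by omega) (by omega)
    have hq0 : (0 : ℝ) < q := by exact_mod_cast (by omega : 0 < q)
    have h5 : (2 : ℝ) ^ (416 * (q * Real.logb 2 q)) = ((q ^ (416 * q) : ℕ) : ℝ) := by
      rw [show 416 * (q * Real.logb 2 q) = Real.logb 2 q * ((416 * q : ℕ) : ℝ) by push_cast; ring,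
        Real.rpow_mul (by norm_num), Real.rpow_logb (by norm_num) (by norm_num) hq0,
        Real.rpow_natCast]
      push_cast; rfl
    rw [h5]
    have h6 : ((A ^ (8 * k) : ℕ) : ℝ) ≤ ((q ^ (416 * q) : ℕ) : ℝ) := by exact_mod_cast h4
    refine h6.trans (le_mul_of_one_le_left (by positivity) (one_le_pow₀ (by norm_num)))

end ParamTSP
-- The approximation theorem
open ParamTSP

theorem theorem3 :
    ∃ (P : Prog) (c₁ c₂ c₃ : ℕ), ∀ G : Instance, 3 ≤ G.n →
      ∃ (t : ℕ) (s : State) (T : G.Tour),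
        Runs P G.input t s ∧ G.IsOutput s T ∧
        G.weight T ≤ 3 * G.opt ∧
        (t : ℝ) ≤ c₁ * (2 : ℝ) ^ (c₂ * (G.q * Real.logb 2 G.q)) * (G.n : ℝ) ^ c₃ := by
  obtain ⟨C, d, hC⟩ := algorithmP.timeBound_poly
  refine ⟨algorithmP.toProg, C * (5 * 1184 ^ 32) ^ d, 416 * d, d, fun G hn => ?_⟩
  obtain ⟨S, z, comp, π, A, hS, hz, hz0, hc, hcard, hπ, hq, hA, hsearch, t, ht, hrun⟩ :=
    prepareP_spec G (by omega)
  obtain ⟨T, hT⟩ := G.opt_isLeast.1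
  obtain ⟨T', hT', hw⟩ := searchP_best hS hz hz0 hc hcard (hπ T) rfl hA hsearch
  refine ⟨t, _, T', hrun, hT', hT ▸ hw, ?_⟩
  have hX := guesses_le (Finset.card_pos.2 ⟨z, hz⟩) hq hA
  set X := A ^ (8 * S.card) with hXdef
  set E : ℝ := (2 : ℝ) ^ (416 * (G.q * Real.logb 2 G.q)) with hE
  have hX1 : 1 ≤ X := Nat.one_le_pow _ _ (by omega)
  -- Replacing the sum by a product lets the power `d` split into a factor depending on `G.n` and
  -- one depending on the parameter.
  have hM : 2 * G.n + 1 + X + 1 ≤ 5 * G.n * X := by nlinarith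
  have h1 : t ≤ C * (5 * G.n * X) ^ d :=
    ht.trans ((hC _).trans (Nat.mul_le_mul_left _ (Nat.pow_le_pow_left hM _)))
  have hEd : (2 : ℝ) ^ (((416 * d : ℕ) : ℝ) * (G.q * Real.logb 2 G.q)) = E ^ d := by
    rw [hE, ← Real.rpow_natCast, ← Real.rpow_mul (by norm_num)]
    congr 1; push_cast; ring
  rw [hEd]
  calc (t : ℝ) ≤ ((C * (5 * G.n * X) ^ d : ℕ) : ℝ) := by exact_mod_cast h1
    _ = C * (5 * G.n * (X : ℝ)) ^ d := by push_cast; ring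
    _ ≤ C * (5 * G.n * (1184 ^ 32 * E)) ^ d := by gcongr
    _ = ((C * (5 * 1184 ^ 32) ^ d : ℕ) : ℝ) * E ^ d * (G.n : ℝ) ^ d := by
      push_cast; ring
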